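/- Let $R_\theta$ denote the rotation of $\mathbb R^2$ about the origin by the angle $\theta$, and let $F\subset\mathbb R^2$ be the Koch curve, i.e. the unique non-empty compact set with $F=\bigcup_{i=1}^4\psi_i(F)$, where $$\psi_1(x)=\tfrac13x,\quad \psi_2(x)=\tfrac13R_{\pi/3}(x)+\tfrac13\begin{pmatrix}1\\0\end{pmatrix},\quad \psi_3(x)=\tfrac13R_{-\pi/3}(x)+\tfrac16\begin{pmatrix}3\\\sqrt3\end{pmatrix},\quad \psi_4(x)=\tfrac13x+\tfrac13\begin{pmatrix}2\\0\end{pmatrix}.$$ Let $c:=\frac16\binom{3}{-\sqrt3}$, let $V$ be the open region bounded by $F$ and the two line segments joining $\binom00$ and $\binom10$ to $c$, and let $V^1,V^2$ be the images of $V$ under the rotations about $c$ by $\frac{2\pi}3$ and $\frac{4\pi}3$. Let $K:=\overline{V\cup V^1\cup V^2}$, the filled-in Koch snowflake with base length $1$. For $\epsilon>0$ let $$K_{-\epsilon}:=\{x\in K : \inf_{y\in\partial K}\|x-y\|_2\le\epsilon\}$$ be its inner $\epsilon$-neighbourhood, and let $\Gamma$ be the filled-in equilateral triangle with vertices $\frac1{18}\binom{3}{-\sqrt3}$,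 $\frac19\binom{3}{-\sqrt3}$ and $\frac13\binom10$. Write $\{t\}:=t-\lfloor t\rfloor$ and $\alpha(\epsilon):=\left\{-\frac{\log\epsilon}{\log3}\right\}$. Then the map $\epsilon\mapsto\operatorname{vol}_2(K_{-\epsilon})$ is continuous on $(0,\infty)$, and $$\operatorname{vol}_2(K_{-\epsilon})=\begin{cases} \frac{2\sqrt3}5 & :\ \epsilon>\frac13,\\[2pt] \frac{7\sqrt3}{30}+\sqrt{\epsilon^2-\frac1{36}}+6\epsilon^2\arcsin\left(\frac1{6\epsilon}\right)-\pi\epsilon^2 & :\ \frac{\sqrt3}9<\epsilon\le\frac13,\\[2pt] \frac{8\sqrt3}{45}+\pi\epsilon^2+12\operatorname{vol}_2(K_{-\epsilon}\cap\Gamma) & :\ \frac19<\epsilon\le\frac{\sqrt3}9,\\[2pt] u(\alpha(\epsilon))\,\epsilon^{2-\log4/\log3}+v(\alpha(\epsilon))\,\epsilon^2 & :\ 0<\epsilon\le\frac19\text{ and }\alpha(\epsilon)<\frac12,\\[2pt] \widetilde u(\alpha(\epsilon))\,\epsilon^{2-\log4/\log3}+v(\alpha(\epsilon))\,\epsilon^2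 & :\ 0<\epsilon\le\frac19\text{ and }\alpha(\epsilon)\ge\frac12, \end{cases}$$ where $$u(t):=\left(\tfrac94\right)^t\left[\tfrac{21\sqrt3}{40}+\tfrac34\sqrt{3^{-2t}-\tfrac14}+81\operatorname{vol}_2(K_{-3^{-t-2}}\cap\Gamma)\right]+\left(\tfrac14\right)^t\left[\tfrac32\arcsin\left(\tfrac{3^t}2\right)-\tfrac\pi6\right]\quad\text{for }0\le t<\tfrac12,$$ and, for $0\le t<1$, $$\widetilde u(t):=\left(\tfrac94\right)^t\left[\tfrac{2\sqrt3}5+27\operatorname{vol}_2(K_{-3^{-t-1}}\cap\Gamma)+81\operatorname{vol}_2(K_{-3^{-t-2}}\cap\Gamma)\right]+\left(\tfrac14\right)^t\tfrac\pi3,$$ $$v(t):=-\tfrac\pi3-324\cdot9^t\operatorname{vol}_2(K_{-3^{-t-2}}\cap\Gamma).$$ -/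

import Mathlib

open Set Topology MeasureTheory

noncomputable section

namespace Koch

/-! The Euclidean plane `ℝ²` is modelled by `ℂ`: the point with coordinates `(x, y)` is `x + i y`,
`‖·‖` is the Euclidean norm, `volume` is the Lebesgue measure, and multiplication by `exp (i θ)` is
the rotation `R_θ` about the origin by the angle `θ`. -/

/-- The rotation of the plane about the point `c` by the angle `θ`. -/
def rot (c : ℂ) (θ : ℝ) (z : ℂ) : ℂ := c + Complex.exp (θ * Complex.I) * (z - c)

/-- The four contracting similarities `ψ₁, …, ψ₄` that generate the Koch curve. -/
def psi : Fin 4 → ℂ → ℂ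
  | 0 => fun z => (1 / 3 : ℝ) * z
  | 1 => fun z => (1 / 3 : ℝ) * rot 0 (Real.pi / 3) z + (1 / 3 : ℝ) * (⟨1, 0⟩ : ℂ)
  | 2 => fun z => (1 / 3 : ℝ) * rot 0 (-(Real.pi / 3)) z + (1 / 6 : ℝ) * (⟨3, √3⟩ : ℂ)
  | 3 => fun z => (1 / 3 : ℝ) * z + (1 / 3 : ℝ) * (⟨2, 0⟩ : ℂ)

/-- The action `A ↦ ψ₁(A) ∪ … ∪ ψ₄(A)` of the iterated function system on sets. -/
def hutchinson (A : Set ℂ) : Set ℂ := ⋃ i, psi i '' A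

/-- The Koch curve over the unit segment from `0` to `1`: the attractor of `ψ₁, …, ψ₄`. It is the
unique non-empty compact set `F` with `F = ψ₁(F) ∪ … ∪ ψ₄(F)`, see `isCompact_kochCurve`,
`kochCurve_nonempty`, `hutchinson_kochCurve` and `eq_kochCurve` below. -/
def kochCurve : Set ℂ := ⋂ n : ℕ, hutchinson^[n] (Metric.closedBall 0 1)

theorem dist_psi (i : Fin 4) (x y : ℂ) : dist (psi i x) (psi i y) = dist x y / 3 := by
  have h : ∀ (θ : ℝ) (a : ℂ), dist ((1 / 3 : ℝ) * rot 0 θ x + a) ((1 / 3 : ℝ) * rot 0 θ y + a)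
      = dist x y / 3 := by
    intro θ a
    have : (((1 / 3 : ℝ) : ℂ) * rot 0 θ x + a) - (((1 / 3 : ℝ) : ℂ) * rot 0 θ y + a)
        = ((1 / 3 : ℝ) : ℂ) * (Complex.exp (θ * Complex.I) * (x - y)) := by
      simp only [rot]; ring
    rw [dist_eq_norm, this, norm_mul, norm_mul, Complex.norm_exp_ofReal_mul_I, Complex.norm_real,
      dist_eq_norm]
    norm_num
    ring
  have h0 : ∀ z, rot 0 0 z = z := by intro z; simp [rot]
  fin_cases i
  · have := h 0 0
    simpa [psi, h0] using this
  · exact h _ _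
  · exact h _ _
  · have := h 0 ((1 / 3 : ℝ) * (⟨2, 0⟩ : ℂ))
    simpa only [psi, h0] using this

theorem continuous_psi (i : Fin 4) : Continuous (psi i) := by
  refine (LipschitzWith.of_dist_le_mul (K := 1) fun x y => ?_).continuous
  rw [dist_psi]
  have : 0 ≤ dist x y := dist_nonneg
  simp only [NNReal.coe_one, one_mul]
  linarith

theorem injective_psi (i : Fin 4) : Function.Injective (psi i) := by
  intro x y hxy
  have := dist_psi i x y
  rw [hxy, dist_self] at this
  exact dist_eq_zero.1 (by linarith)

theorem norm_psi_zero_le (i : Fin 4) : ‖psi i 0‖ ≤ 2 / 3 := by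
  have hr : ∀ θ, rot 0 θ 0 = 0 := by intro θ; simp [rot]
  fin_cases i
  · simp [psi]; norm_num
  · simp only [psi, hr, mul_zero, zero_add]
    rw [norm_mul, Complex.norm_real, Complex.norm_eq_sqrt_sq_add_sq]
    norm_num
  · simp only [psi, hr, mul_zero, zero_add]
    rw [norm_mul, Complex.norm_real, Complex.norm_eq_sqrt_sq_add_sq]
    have : √((3 : ℝ) ^ 2 + √3 ^ 2) ≤ 4 := by
      rw [Real.sqrt_le_left (by norm_num), Real.sq_sqrt (by norm_num)]; norm_num
    have h6 : ‖(1 / 6 : ℝ)‖ = 1 / 6 := by norm_num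
    rw [h6]
    calc 1 / 6 * √((3 : ℝ) ^ 2 + √3 ^ 2) ≤ 1 / 6 * 4 :=
          mul_le_mul_of_nonneg_left this (by norm_num)
      _ = 2 / 3 := by norm_num
  · simp only [psi, mul_zero, zero_add]
    rw [norm_mul, Complex.norm_real, Complex.norm_eq_sqrt_sq_add_sq]
    norm_num

theorem hutchinson_mono {A B : Set ℂ} (h : A ⊆ B) : hutchinson A ⊆ hutchinson B :=
  iUnion_mono fun _ => image_mono h

theorem hutchinson_closedBall :
    hutchinson (Metric.closedBall 0 1) ⊆ Metric.closedBall 0 1 := by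
  refine iUnion_subset fun i => ?_
  rintro _ ⟨x, hx, rfl⟩
  rw [Metric.mem_closedBall] at hx ⊢
  have h1 := dist_triangle (psi i x) (psi i 0) 0
  rw [dist_psi, dist_zero_right (psi i 0)] at h1
  have := norm_psi_zero_le i
  linarith

theorem iterate_succ_subset (n : ℕ) :
    hutchinson^[n + 1] (Metric.closedBall 0 1) ⊆ hutchinson^[n] (Metric.closedBall 0 1) := by
  induction n with
  | zero => exact hutchinson_closedBall
  | succ n ih =>
    have h := hutchinson_mono ih
    rwa [← Function.iterate_succ_apply' hutchinson, ← Function.iterate_succ_apply' hutchinson] at h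

theorem isCompact_iterate (n : ℕ) : IsCompact (hutchinson^[n] (Metric.closedBall 0 1)) := by
  induction n with
  | zero => exact isCompact_closedBall 0 1
  | succ n ih =>
    rw [Function.iterate_succ_apply']
    exact isCompact_iUnion fun i => ih.image (continuous_psi i)

theorem nonempty_iterate (n : ℕ) : (hutchinson^[n] (Metric.closedBall 0 1)).Nonempty := by
  induction n with
  | zero => exact ⟨0, by simp⟩
  | succ n ih =>
    rw [Function.iterate_succ_apply']
    exact nonempty_iUnion.2 ⟨0, ih.image _⟩

theorem isCompact_kochCurve : IsCompact kochCurve :=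
  (isCompact_iterate 0).of_isClosed_subset
    (isClosed_iInter fun n => (isCompact_iterate n).isClosed) (iInter_subset _ 0)

theorem kochCurve_nonempty : kochCurve.Nonempty :=
  IsCompact.nonempty_iInter_of_sequence_nonempty_isCompact_isClosed _ iterate_succ_subset
    nonempty_iterate (isCompact_iterate 0) fun n => (isCompact_iterate n).isClosed

theorem hutchinson_kochCurve : hutchinson kochCurve = kochCurve := by
  have hanti : Antitone fun n : ℕ => hutchinson^[n] (Metric.closedBall 0 1) :=
    antitone_nat_of_succ_le iterate_succ_subset
  apply Subset.antisymm
  · refine subset_iInter fun n => ?_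
    refine Subset.trans ?_ (iterate_succ_subset n)
    rw [Function.iterate_succ_apply']
    exact hutchinson_mono (iInter_subset _ n)
  · intro x hx
    have h1 : ∀ n : ℕ, ∃ i, x ∈ psi i '' (hutchinson^[n] (Metric.closedBall 0 1)) := by
      intro n
      have := mem_iInter.1 hx (n + 1)
      rw [Function.iterate_succ_apply'] at this
      exact mem_iUnion.1 this
    have h2 : ∃ i, ∀ n : ℕ, x ∈ psi i '' (hutchinson^[n] (Metric.closedBall 0 1)) := by
      by_contra! hcon
      choose m hm using hcon
      obtain ⟨i, hi⟩ := h1 (Finset.univ.sup m)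
      exact hm i (image_mono (hanti (Finset.le_sup (Finset.mem_univ i))) hi)
    obtain ⟨i, hi⟩ := h2
    obtain ⟨y, -, rfl⟩ := hi 0
    refine mem_iUnion.2 ⟨i, y, mem_iInter.2 fun n => ?_, rfl⟩
    obtain ⟨z, hz, hzy⟩ := hi n
    rwa [← injective_psi i hzy]

theorem subset_of_hutchinson_eq {A B : Set ℂ} (hA : IsCompact A) (hB : IsCompact B)
    (hBne : B.Nonempty) (hAe : hutchinson A = A) (hBe : hutchinson B = B) : A ⊆ B := by
  obtain ⟨C, hC⟩ := Metric.isBounded_iff.1 (hA.union hB).isBounded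
  obtain ⟨b, hb⟩ := hBne
  have key : ∀ n : ℕ, ∀ x ∈ A, ∃ y ∈ B, dist x y ≤ C * (1 / 3) ^ n := by
    intro n
    induction n with
    | zero =>
      intro x hx
      exact ⟨b, hb, by simpa using hC (Or.inl hx) (Or.inr hb)⟩
    | succ n ih =>
      intro x hx
      rw [← hAe] at hx
      obtain ⟨i, x', hx', rfl⟩ := mem_iUnion.1 hx
      obtain ⟨y, hy, hxy⟩ := ih x' hx'
      refine ⟨psi i y, ?_, ?_⟩
      · rw [← hBe]
        exact mem_iUnion.2 ⟨i, y, hy, rfl⟩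
      · rw [dist_psi, pow_succ]
        linarith
  intro x hx
  rw [← hB.isClosed.closure_eq, Metric.mem_closure_iff]
  intro δ hδ
  have hlim : Filter.Tendsto (fun n : ℕ => C * (1 / 3 : ℝ) ^ n) Filter.atTop (𝓝 (C * 0)) :=
    (tendsto_pow_atTop_nhds_zero_of_lt_one (by norm_num) (by norm_num)).const_mul C
  rw [mul_zero] at hlim
  obtain ⟨n, hn⟩ := (hlim.eventually (gt_mem_nhds hδ)).exists
  obtain ⟨y, hy, hxy⟩ := key n x hx
  exact ⟨y, hy, hxy.trans_lt hn⟩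

theorem eq_kochCurve {A : Set ℂ} (hA : IsCompact A) (hne : A.Nonempty)
    (hAe : hutchinson A = A) : A = kochCurve :=
  Subset.antisymm
    (subset_of_hutchinson_eq hA isCompact_kochCurve kochCurve_nonempty hAe hutchinson_kochCurve)
    (subset_of_hutchinson_eq isCompact_kochCurve hA hne hutchinson_kochCurve hAe)

/-- The centre `(1/6) (3, -√3)` of the snowflake. -/
def center : ℂ := (1 / 6 : ℝ) * (⟨3, -√3⟩ : ℂ)

/-- The closed curve formed by the Koch curve and the two segments that join its end points
`(0, 0)` and `(1, 0)` to the centre. -/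
def sectorBoundary : Set ℂ := kochCurve ∪ segment ℝ 0 center ∪ segment ℝ 1 center

/-- The open region `V` bounded by the Koch curve and the two segments: the points off the curve
`sectorBoundary` whose connected component in the complement of that curve is bounded. -/
def sector : Set ℂ :=
  {z | z ∉ sectorBoundary ∧ Bornology.IsBounded (connectedComponentIn sectorBoundaryᶜ z)}

/-- The filled-in Koch snowflake `K` of base length `1`: the closure of the union of `V` and its
images under the rotations about the centre by `2π/3` and `4π/3`. -/
def snowflake : Set ℂ := closure (⋃ k : Fin 3, rot center (2 * Real.pi * (k : ℕ) / 3) '' sector)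

/-- The inner `ε`-neighbourhood `K_{-ε}` of the snowflake. -/
def inner (ε : ℝ) : Set ℂ := {z ∈ snowflake | Metric.infDist z (frontier snowflake) ≤ ε}

/-- The filled-in equilateral triangle `Γ`. -/
def triangle : Set ℂ :=
  convexHull ℝ {(1 / 18 : ℝ) * (⟨3, -√3⟩ : ℂ), (1 / 9 : ℝ) * (⟨3, -√3⟩ : ℂ),
    (1 / 3 : ℝ) * (⟨1, 0⟩ : ℂ)}

/-- `vol₂ (K_{-ε} ∩ Γ)`. -/
def triangleArea (ε : ℝ) : ℝ := volume.real (inner ε ∩ triangle)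

/-- `α(ε)`, the fractional part of `-log ε / log 3`. -/
def alpha (ε : ℝ) : ℝ := Int.fract (-(Real.log ε / Real.log 3))

/-- The function `u`; it is only used for `0 ≤ t < 1/2`, where the root and the arcsine are those of
a positive number and of a number in `(0, 1)`. -/
def u (t : ℝ) : ℝ :=
  (9 / 4 : ℝ) ^ t * (21 * √3 / 40 + 3 / 4 * √((3 : ℝ) ^ (-2 * t) - 1 / 4)
      + 81 * triangleArea ((3 : ℝ) ^ (-t - 2)))
    + (1 / 4 : ℝ) ^ t * (3 / 2 * Real.arcsin ((3 : ℝ) ^ t / 2) - Real.pi / 6)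

/-- The function `ũ`. -/
def uTilde (t : ℝ) : ℝ :=
  (9 / 4 : ℝ) ^ t * (2 * √3 / 5 + 27 * triangleArea ((3 : ℝ) ^ (-t - 1))
      + 81 * triangleArea ((3 : ℝ) ^ (-t - 2)))
    + (1 / 4 : ℝ) ^ t * (Real.pi / 3)

/-- The function `v`. -/
def v (t : ℝ) : ℝ :=
  -(Real.pi / 3) - 324 * (9 : ℝ) ^ t * triangleArea ((3 : ℝ) ^ (-t - 2))

end Koch

end

/-!
The Koch curve `F` over the unit segment is invariant under the reflection in `x = 1/2`, and its
pieces `ψ₁(F)` and `ψ₂(F)` are mirror images in the bisector of the reentrant corner between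
them. A point on one side of an axis of symmetry is at least as close to the part of the curve on
its own side as to the mirror image of this part. Hence the bisectors of the corners cut an
inner neighbourhood of the snowflake into strips, one along each edge of an approximating
polygon, and within a strip only the distance to the copy of the Koch curve over this edge matters.

A strip (`strip a b e`) depends, up to a similarity, on the ratio `e` of `ε` to the length of
the edge and on the kinds `a`, `b` of the corners at its ends, convex (`60°`) or reentrant
(`240°`). Each refinement of the polygon replaces a strip by four strips of a third of the size,
provided that `e ≤ 1/3` (`volume_real_leftStrip`). Iterating this linear recursion until
`1/3 < e ≤ 1` leads to `2 · 4^m + 4` edges with one reentrant corner and `4^m - 4` edges with two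
(`volume_real_strip_convex_convex_pow`). For `e ≥ 1/3` a strip consists of a full sector of the
snowflake of area `2√3/15`, and, at each reentrant corner, of a circular sector of `30°` and of a
part of the neighbourhood below one half of the curve. If the other corner is convex, its bisector
cuts these two parts off. What remains of the second one is congruent to the neighbourhood within an
enlarged copy of the triangle `Γ` (`cornerPart`); what the first one loses, if `e > 1/√3`, is the
circular tip `wedgeTip e`, the source of the arcsine. If both corners are reentrant, the copy of
`Γ` at the next larger scale provides the missing area (`volume_real_cornerPart_div_three`).

It has to be shown that the topological definition of the snowflake yields the expected set. With
`bump` the union of `F` and the small triangles `ψ_w(Δ)`, the sector `V` is the region between `bump`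
and the two segments (`sector_eq`): this region is relatively clopen in the complement of the
closed curve, and any point outside can be led to infinity through the gaps between the pieces of
the hull of the curve (`escapes_of_mem_hull`). Both facts are shown by an induction along the
iterated function system that terminates because the distance to `F` triples in each step
(`hull_induction`). As `F` is a null set, the closure of `V` is the closed region, and the
boundary of the snowflake consists of the three Koch curves (`mem_frontier_iff`).

Continuity holds because the set of the points at a fixed positive distance from a closed set has
no density points (`volume_infDist_eq`).
-/

namespace Koch

/-! ### Coordinates -/

/-- The second coordinate in units of `√3`. In the coordinates `z.re` and `ht z`, the maps `psi i`
and all the lines of the construction have rational coefficients. -/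
noncomputable def ht (z : ℂ) : ℝ := z.im / √3

/-- The point with given coordinates `z.re` and `ht z`. -/
noncomputable def pt (x h : ℝ) : ℂ := ⟨x, √3 * h⟩

@[simp] lemma pt_re (x h : ℝ) : (pt x h).re = x := rfl

@[simp] lemma ht_pt (x h : ℝ) : ht (pt x h) = h := by
  simp [ht, pt]

lemma im_eq (z : ℂ) : z.im = √3 * ht z := by
  simp only [ht]; field_simp

@[simp] lemma ht_zero : ht 0 = 0 := by simp [ht]

@[simp] lemma ht_one : ht 1 = 0 := by simp [ht]

lemma ext_ht {z w : ℂ} (h1 : z.re = w.re) (h2 : ht z = ht w) : z = w :=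
  Complex.ext h1 (by rw [im_eq, im_eq, h2])

@[fun_prop]
lemma continuous_ht : Continuous ht := Complex.continuous_im.div_const _

lemma ht_add (z w : ℂ) : ht (z + w) = ht z + ht w := by simp [ht, add_div]

lemma ht_sub (z w : ℂ) : ht (z - w) = ht z - ht w := by simp [ht, sub_div]

lemma ht_smul (a : ℝ) (z : ℂ) : ht (a • z) = a * ht z := by simp [ht, mul_div_assoc]

lemma ht_real_mul (a : ℝ) (z : ℂ) : ht (a * z) = a * ht z := by
  simp [ht, mul_div_assoc]

lemma norm_sq_eq (z : ℂ) : ‖z‖ ^ 2 = z.re ^ 2 + 3 * ht z ^ 2 := by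
  rw [← Complex.normSq_eq_norm_sq, Complex.normSq_apply, im_eq]
  nlinarith [Real.sq_sqrt (show (0 : ℝ) ≤ 3 by norm_num)]

lemma dist_sq (z w : ℂ) : dist z w ^ 2 = (z.re - w.re) ^ 2 + 3 * (ht z - ht w) ^ 2 := by
  rw [dist_eq_norm, norm_sq_eq, Complex.sub_re, ht_sub]

lemma dist_le_iff {z w : ℂ} {e : ℝ} (he : 0 ≤ e) :
    dist z w ≤ e ↔ (z.re - w.re) ^ 2 + 3 * (ht z - ht w) ^ 2 ≤ e ^ 2 := by
  rw [← dist_sq, sq_le_sq₀ dist_nonneg he]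

lemma dist_le_dist_iff {z w z' w' : ℂ} :
    dist z w ≤ dist z' w' ↔ (z.re - w.re) ^ 2 + 3 * (ht z - ht w) ^ 2 ≤
      (z'.re - w'.re) ^ 2 + 3 * (ht z' - ht w') ^ 2 := by
  rw [← dist_sq, ← dist_sq, sq_le_sq₀ dist_nonneg dist_nonneg]

/-- The functional `3h - x`, twice the signed distance to a line of slope `30°`, is
`2`-Lipschitz. -/
lemma sub_three_mul_ht_le (z w : ℂ) {e : ℝ} (h : dist z w ≤ e) :
    3 * ht w - w.re ≤ 3 * ht z - z.re + 2 * e := by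
  have he : 0 ≤ e := dist_nonneg.trans h
  rw [dist_le_iff he] at h
  by_contra! hc
  nlinarith [sq_nonneg (z.re - w.re + (ht z - ht w))]

@[simp] lemma psi_zero_re (z : ℂ) : (psi 0 z).re = z.re / 3 := by
  simp [psi]; ring

@[simp] lemma ht_psi_zero (z : ℂ) : ht (psi 0 z) = ht z / 3 := by
  simp [psi, ht]; ring

lemma exp_pi_div_three : Complex.exp ((Real.pi / 3 : ℝ) * Complex.I) = ⟨1 / 2, √3 / 2⟩ := by
  rw [Complex.exp_mul_I, ← Complex.ofReal_cos, ← Complex.ofReal_sin, Real.cos_pi_div_three,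
    Real.sin_pi_div_three]
  apply Complex.ext <;> simp

lemma exp_neg_pi_div_three :
    Complex.exp ((-(Real.pi / 3) : ℝ) * Complex.I) = ⟨1 / 2, -(√3 / 2)⟩ := by
  rw [Complex.exp_mul_I, ← Complex.ofReal_cos, ← Complex.ofReal_sin, Real.cos_neg, Real.sin_neg,
    Real.cos_pi_div_three, Real.sin_pi_div_three]
  apply Complex.ext <;> simp

lemma sqrt_three_sq : √3 * √3 = (3 : ℝ) := Real.mul_self_sqrt (by norm_num)

@[simp] lemma psi_one_re (z : ℂ) : (psi 1 z).re = z.re / 6 - ht z / 2 + 1 / 3 := by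
  simp only [psi, rot, exp_pi_div_three]
  simp
  rw [im_eq z]
  linear_combination (-ht z / 6) * sqrt_three_sq

@[simp] lemma ht_psi_one (z : ℂ) : ht (psi 1 z) = (z.re + ht z) / 6 := by
  simp only [psi, rot, exp_pi_div_three]
  rw [ht, div_eq_iff (by positivity)]
  simp
  rw [im_eq z]
  ring

@[simp] lemma psi_two_re (z : ℂ) : (psi 2 z).re = z.re / 6 + ht z / 2 + 1 / 2 := by
  simp only [psi, rot, exp_neg_pi_div_three]
  simp
  rw [im_eq z]
  linear_combination (ht z / 6) * sqrt_three_sq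

@[simp] lemma ht_psi_two (z : ℂ) : ht (psi 2 z) = (1 - z.re + ht z) / 6 := by
  simp only [psi, rot, exp_neg_pi_div_three]
  rw [ht, div_eq_iff (by positivity)]
  simp
  rw [im_eq z]
  ring

@[simp] lemma psi_three_re (z : ℂ) : (psi 3 z).re = z.re / 3 + 2 / 3 := by
  simp [psi]; ring

@[simp] lemma ht_psi_three (z : ℂ) : ht (psi 3 z) = ht z / 3 := by
  simp [psi, ht]; ring

@[simp] lemma center_re : center.re = 1 / 2 := by simp [center]; norm_num

@[simp] lemma ht_center : ht center = -1 / 6 := by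
  simp [center, ht]; field_simp

/-! ### Volumes -/

open scoped Pointwise in
/-- A similarity of the plane with ratio `k` multiplies all areas by `k²`. -/
lemma volume_real_image_of_dist {f : ℂ → ℂ} {k : ℝ} (hk : 0 < k)
    (hf : ∀ x y, dist (f x) (f y) = k * dist x y) (A : Set ℂ) :
    volume.real (f '' A) = k ^ 2 * volume.real A := by
  have hiso : Isometry fun z => (k⁻¹ : ℝ) • f z := by
    refine Isometry.of_dist_eq fun x y => ?_
    rw [dist_smul₀, hf, Real.norm_of_nonneg (by positivity)]
    field_simp
  let g := hiso.affineIsometryOfStrictConvexSpace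
  let L := g.linearIsometry.toLinearIsometryEquiv rfl
  have hg : ∀ z, f z = k • L z + f 0 := by
    intro z
    have h1 : g z = g.linearIsometry z + g 0 := by
      have := g.map_vadd 0 z
      simpa using this
    have h2 : ∀ z, g z = (k⁻¹ : ℝ) • f z := fun z => rfl
    have h3 : L z = g.linearIsometry z := rfl
    rw [h3, ← sub_eq_iff_eq_add.2 h1, h2, h2, smul_sub, smul_inv_smul₀ hk.ne',
      smul_inv_smul₀ hk.ne']
    ring
  have himg : f '' A = (fun z => z + f 0) '' (k • (L '' A)) := by
    ext z; simp only [mem_image, mem_smul_set]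
    constructor
    · rintro ⟨x, hx, rfl⟩
      exact ⟨k • L x, ⟨L x, ⟨x, hx, rfl⟩, rfl⟩, (hg x).symm⟩
    · rintro ⟨_, ⟨_, ⟨x, hx, rfl⟩, rfl⟩, rfl⟩
      exact ⟨x, hx, hg x⟩
  have hL : volume (L '' A) = volume A := by
    have := L.measurePreserving.measure_preimage_equiv (f := L.toHomeomorph.toMeasurableEquiv)
      (L '' A)
    rw [← this]
    congr 1
    exact (preimage_image_eq A L.injective)
  rw [himg, measureReal_def, image_add_right, measure_preimage_add_right, Measure.addHaar_smul, hL,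
    measureReal_def, ENNReal.toReal_mul, Complex.finrank_real_complex, abs_of_nonneg (by positivity),
    ENNReal.toReal_ofReal (by positivity)]

lemma volume_real_psi_image (i : Fin 4) (A : Set ℂ) :
    volume.real (psi i '' A) = volume.real A / 9 := by
  rw [volume_real_image_of_dist (k := 1 / 3) (by norm_num)
    (fun x y => by rw [dist_psi]; ring)]
  ring

lemma volume_line {a b : ℝ} (hab : a ≠ 0 ∨ b ≠ 0) (c : ℝ) :
    volume {z : ℂ | a * z.re + b * ht z = c} = 0 := by
  let f : ℂ →ₗ[ℝ] ℝ :=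
    { toFun := fun z => a * z.re + b * ht z
      map_add' := fun z w => by rw [Complex.add_re, ht_add]; ring
      map_smul' := fun r z => by
        rw [ht_smul, Complex.real_smul, Complex.re_ofReal_mul]; simp; ring }
  let S : AffineSubspace ℝ ℂ := (AffineSubspace.mk' c ⊥).comap f.toAffineMap
  have hS : ({z : ℂ | a * z.re + b * ht z = c}) = (S : Set ℂ) := by
    ext z
    simp [S, AffineSubspace.mem_mk', sub_eq_zero, f]
  rw [hS]
  refine Measure.addHaar_affineSubspace _ _ fun htop => ?_
  have hall : ∀ z : ℂ, a * z.re + b * ht z = c := by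
    intro z
    have : z ∈ (S : Set ℂ) := by rw [htop]; trivial
    rwa [← hS] at this
  have h0 := hall 0
  have h1 := hall (pt 1 0)
  have h2 := hall (pt 0 1)
  simp at h0 h1 h2
  rcases hab with h | h <;> apply h <;> linarith

/-- Cutting a set of finite area along a line. -/
lemma volume_real_split {A : Set ℂ} (hA : volume A ≠ ⊤) (a b c : ℝ) (hab : a ≠ 0 ∨ b ≠ 0) :
    volume.real A = volume.real (A ∩ {z | a * z.re + b * ht z ≤ c}) +
      volume.real (A ∩ {z | c ≤ a * z.re + b * ht z}) := by
  have hmeas : MeasurableSet {z : ℂ | a * z.re + b * ht z ≤ c} :=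
    (isClosed_le (by fun_prop) (by fun_prop)).measurableSet
  have h := measureReal_inter_add_sdiff (μ := volume) (s := A) hmeas hA
  rw [← h]
  congr 1
  refine measureReal_congr ?_
  have hnull : ∀ᵐ z : ℂ, z ∉ {z : ℂ | a * z.re + b * ht z = c} :=
    measure_eq_zero_iff_ae_notMem.1 (volume_line hab c)
  filter_upwards [hnull] with z hz
  refine propext ?_
  change (z ∈ A ∧ ¬ (_ ≤ c)) ↔ (z ∈ A ∧ c ≤ _)
  refine and_congr_right fun _ => ?_
  rw [not_le]
  exact ⟨le_of_lt, fun h => lt_of_le_of_ne h (fun h' => hz h'.symm)⟩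

/-! ### The Koch curve -/

lemma mem_kochCurve_iff {z : ℂ} : z ∈ kochCurve ↔ ∃ i, ∃ w ∈ kochCurve, psi i w = z := by
  conv_lhs => rw [← hutchinson_kochCurve]
  simp [hutchinson]

lemma psi_mem_kochCurve (i : Fin 4) {z : ℂ} (hz : z ∈ kochCurve) : psi i z ∈ kochCurve :=
  mem_kochCurve_iff.2 ⟨i, z, hz, rfl⟩

lemma mem_kochCurve_of_psi_eq {i : Fin 4} {z : ℂ} (hz : psi i z = z) (h1 : ‖z‖ ≤ 1) :
    z ∈ kochCurve := by
  refine mem_iInter.2 fun n => ?_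
  induction n with
  | zero => simpa using h1
  | succ n ih =>
    rw [Function.iterate_succ_apply']
    exact mem_iUnion.2 ⟨i, z, ih, hz⟩

lemma zero_mem_kochCurve : (0 : ℂ) ∈ kochCurve :=
  mem_kochCurve_of_psi_eq (i := 0) (ext_ht (by simp) (by simp)) (by simp)

lemma one_mem_kochCurve : (1 : ℂ) ∈ kochCurve :=
  mem_kochCurve_of_psi_eq (i := 3) (ext_ht (by simp; norm_num) (by simp)) (by simp)

lemma psi_surjective (i : Fin 4) (z : ℂ) : ∃ w, psi i w = z := by
  fin_cases i
  · exact ⟨pt (3 * z.re) (3 * ht z), ext_ht (by simp) (by simp)⟩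
  · refine ⟨pt (9 / 2 * ht z + 3 / 2 * z.re - 1 / 2) (3 / 2 * (ht z - z.re + 1 / 3)),
      ext_ht ?_ ?_⟩ <;> simp <;> ring
  · refine ⟨pt (3 / 2 * z.re - 9 / 2 * ht z) (3 / 2 * (ht z + z.re) - 1),
      ext_ht ?_ ?_⟩ <;> simp <;> ring
  · exact ⟨pt (3 * z.re - 2) (3 * ht z), ext_ht (by simp; ring) (by simp)⟩

/-- Every non-empty bounded set that is mapped into itself by `ψ₁, …, ψ₄` has the Koch curve in its
closure. -/
lemma kochCurve_subset_closure {P : Set ℂ} (hne : P.Nonempty) (hb : Bornology.IsBounded P)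
    (hP : ∀ i, ∀ z ∈ P, psi i z ∈ P) : kochCurve ⊆ closure P := by
  obtain ⟨C, hC⟩ := Metric.isBounded_iff.1 (isCompact_kochCurve.isBounded.union hb)
  obtain ⟨p, hp⟩ := hne
  have key : ∀ n : ℕ, ∀ x ∈ kochCurve, ∃ y ∈ P, dist x y ≤ C * (1 / 3) ^ n := by
    intro n
    induction n with
    | zero => exact fun x hx => ⟨p, hp, by simpa using hC (Or.inl hx) (Or.inr hp)⟩
    | succ n ih =>
      intro x hx
      obtain ⟨i, x', hx', rfl⟩ := mem_kochCurve_iff.1 hx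
      obtain ⟨y, hy, hxy⟩ := ih x' hx'
      refine ⟨psi i y, hP i y hy, ?_⟩
      rw [dist_psi, pow_succ]
      linarith
  intro x hx
  rw [Metric.mem_closure_iff]
  intro δ hδ
  have hlim : Filter.Tendsto (fun n : ℕ => C * (1 / 3 : ℝ) ^ n) Filter.atTop (𝓝 (C * 0)) :=
    (tendsto_pow_atTop_nhds_zero_of_lt_one (by norm_num) (by norm_num)).const_mul C
  rw [mul_zero] at hlim
  obtain ⟨n, hn⟩ := (hlim.eventually (gt_mem_nhds hδ)).exists
  obtain ⟨y, hy, hxy⟩ := key n x hx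
  exact ⟨y, hy, hxy.trans_lt hn⟩

/-- The isosceles triangle with vertices `0`, `1` and the tip `(1/2, √3/6)` of the Koch curve, which
is the convex hull of the Koch curve. -/
def hull : Set ℂ := {z | 0 ≤ ht z ∧ 3 * ht z ≤ z.re ∧ 3 * ht z ≤ 1 - z.re}

lemma isClosed_hull : IsClosed hull := by
  simp only [hull, ofPred_and]
  refine IsClosed.inter ?_ (IsClosed.inter ?_ ?_) <;> apply isClosed_le <;> fun_prop

lemma norm_le_one_of_mem_hull {z : ℂ} (hz : z ∈ hull) : ‖z‖ ≤ 1 := by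
  obtain ⟨h0, h1, h2⟩ := hz
  rw [← sq_le_one_iff₀ (norm_nonneg z), norm_sq_eq]
  nlinarith

lemma hull_subset_closedBall : hull ⊆ Metric.closedBall 0 1 := fun _ hz =>
  mem_closedBall_zero_iff.2 (norm_le_one_of_mem_hull hz)

lemma isBounded_hull : Bornology.IsBounded hull :=
  Metric.isBounded_closedBall.subset hull_subset_closedBall

lemma psi_mem_hull (i : Fin 4) {z : ℂ} (hz : z ∈ hull) : psi i z ∈ hull := by
  obtain ⟨h0, h1, h2⟩ := hz
  fin_cases i <;> refine ⟨?_, ?_, ?_⟩ <;> simp <;> linarith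

lemma kochCurve_subset_hull : kochCurve ⊆ hull :=
  (kochCurve_subset_closure ⟨0, by simp [hull]⟩ isBounded_hull
    fun i _ hz => psi_mem_hull i hz).trans isClosed_hull.closure_eq.subset

/-- Induction along the construction of the Koch curve: a property of the points of the hull off the
curve holds if it can be passed on from all the preimages under `ψ₁, …, ψ₄` that are points of
the same kind. The distance to the curve triples from a point to its preimages, so that
this recursion stops. -/
lemma hull_induction {P : ℂ → Prop}
    (h : ∀ z ∈ hull, z ∉ kochCurve →
      (∀ i, ∀ w ∈ hull, w ∉ kochCurve → psi i w = z → P w) → P z) :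
    ∀ z ∈ hull, z ∉ kochCurve → P z := by
  have key : ∀ n : ℕ, ∀ z ∈ hull, z ∉ kochCurve →
      (∀ y ∈ kochCurve, (1 / 3 : ℝ) ^ n < dist z y) → P z := by
    intro n
    induction n with
    | zero =>
      intro z hz _ hd
      have := hd 0 zero_mem_kochCurve
      rw [dist_zero_right, pow_zero] at this
      linarith [norm_le_one_of_mem_hull hz]
    | succ n ih =>
      intro z hz hzF hd
      refine h z hz hzF fun i w hw hwF hwz => ih w hw hwF fun y hy => ?_
      have := hd _ (psi_mem_kochCurve i hy)
      rw [← hwz, dist_psi, pow_succ] at this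
      linarith
  intro z hz hzF
  obtain ⟨δ, hδ, hball⟩ := Metric.isOpen_iff.1 isCompact_kochCurve.isClosed.isOpen_compl z hzF
  obtain ⟨n, hn⟩ := exists_pow_lt_of_lt_one hδ (show (1 / 3 : ℝ) < 1 by norm_num)
  refine key n z hz hzF fun y hy => hn.trans_le ?_
  by_contra! hlt
  exact hball (by rwa [Metric.mem_ball, dist_comm]) hy

/-- The reflection in the axis of symmetry `x = 1/2` of the Koch curve. -/
noncomputable def mirror (z : ℂ) : ℂ := pt (1 - z.re) (ht z)

@[simp] lemma mirror_re (z : ℂ) : (mirror z).re = 1 - z.re := rfl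

@[simp] lemma ht_mirror (z : ℂ) : ht (mirror z) = ht z := by simp [mirror]

@[simp] lemma mirror_mirror (z : ℂ) : mirror (mirror z) = z := ext_ht (by simp) (by simp)

lemma dist_mirror (z w : ℂ) : dist (mirror z) (mirror w) = dist z w := by
  apply le_antisymm <;> rw [dist_le_dist_iff] <;> simp <;> nlinarith

lemma continuous_mirror : Continuous mirror :=
  (Isometry.of_dist_eq dist_mirror).continuous

lemma psi_mirror (i : Fin 4) (z : ℂ) : psi i (mirror z) = mirror (psi i.rev z) := by
  fin_cases i <;> apply ext_ht <;> simp [Fin.rev] <;> ring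

lemma mirror_image_kochCurve : mirror '' kochCurve = kochCurve := by
  refine eq_kochCurve (isCompact_kochCurve.image continuous_mirror)
    (kochCurve_nonempty.image _) (Subset.antisymm ?_ ?_)
  · refine iUnion_subset fun i => ?_
    rintro _ ⟨_, ⟨w, hw, rfl⟩, rfl⟩
    exact ⟨psi i.rev w, psi_mem_kochCurve _ hw, (psi_mirror i w).symm⟩
  · rintro _ ⟨w, hw, rfl⟩
    obtain ⟨i, v, hv, rfl⟩ := mem_kochCurve_iff.1 hw
    refine mem_iUnion.2 ⟨i.rev, mirror v, ⟨v, hv, rfl⟩, ?_⟩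
    rw [psi_mirror, Fin.rev_rev]

lemma mirror_mem_kochCurve {z : ℂ} (hz : z ∈ kochCurve) : mirror z ∈ kochCurve := by
  rw [← mirror_image_kochCurve]; exact ⟨z, hz, rfl⟩

lemma mirror_mem_hull {z : ℂ} (hz : z ∈ hull) : mirror z ∈ hull := by
  obtain ⟨h0, h1, h2⟩ := hz
  refine ⟨?_, ?_, ?_⟩ <;> simp <;> linarith

lemma volume_real_mirror_image (A : Set ℂ) : volume.real (mirror '' A) = volume.real A := by
  rw [volume_real_image_of_dist one_pos (fun x y => by rw [dist_mirror, one_mul])]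
  simp

/-! ### The region between the Koch curve and its base -/

/-- The equilateral triangle over the middle third of the unit segment. -/
def midTriangle : Set ℂ := {z | 0 ≤ ht z ∧ ht z ≤ z.re - 1 / 3 ∧ ht z ≤ 2 / 3 - z.re}

/-- The closed region between the Koch curve and the unit segment. -/
def bump : Set ℂ := kochCurve ∪ ⋃ n : ℕ, hutchinson^[n] midTriangle

lemma mem_bump_iff {z : ℂ} : z ∈ bump ↔ z ∈ midTriangle ∨ ∃ i, ∃ w ∈ bump, psi i w = z := by
  constructor
  · rintro (hz | hz)
    · obtain ⟨i, w, hw, rfl⟩ := mem_kochCurve_iff.1 hz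
      exact Or.inr ⟨i, w, Or.inl hw, rfl⟩
    · obtain ⟨n, hn⟩ := mem_iUnion.1 hz
      cases n with
      | zero => exact Or.inl hn
      | succ n =>
        rw [Function.iterate_succ_apply'] at hn
        obtain ⟨i, w, hw, rfl⟩ := mem_iUnion.1 hn
        exact Or.inr ⟨i, w, Or.inr (mem_iUnion.2 ⟨n, hw⟩), rfl⟩
  · rintro (hz | ⟨i, w, hw | hw, rfl⟩)
    · exact Or.inr (mem_iUnion.2 ⟨0, hz⟩)
    · exact Or.inl (psi_mem_kochCurve i hw)
    · obtain ⟨n, hn⟩ := mem_iUnion.1 hw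
      refine Or.inr (mem_iUnion.2 ⟨n + 1, ?_⟩)
      rw [Function.iterate_succ_apply']
      exact mem_iUnion.2 ⟨i, w, hn, rfl⟩

lemma psi_mem_bump (i : Fin 4) {z : ℂ} (hz : z ∈ bump) : psi i z ∈ bump :=
  mem_bump_iff.2 (Or.inr ⟨i, z, hz, rfl⟩)

lemma kochCurve_subset_bump : kochCurve ⊆ bump := subset_union_left

lemma midTriangle_subset_bump : midTriangle ⊆ bump := fun _ hz => mem_bump_iff.2 (Or.inl hz)

lemma midTriangle_subset_hull : midTriangle ⊆ hull := by
  rintro z ⟨h0, h1, h2⟩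
  exact ⟨h0, by linarith, by linarith⟩

lemma bump_subset_hull : bump ⊆ hull := by
  refine union_subset kochCurve_subset_hull (iUnion_subset fun n => ?_)
  induction n with
  | zero => exact midTriangle_subset_hull
  | succ n ih =>
    rw [Function.iterate_succ_apply']
    refine iUnion_subset fun i => ?_
    rintro _ ⟨w, hw, rfl⟩
    exact psi_mem_hull i (ih hw)

lemma isClosed_midTriangle : IsClosed midTriangle := by
  simp only [midTriangle, ofPred_and]
  refine IsClosed.inter ?_ (IsClosed.inter ?_ ?_) <;> apply isClosed_le <;> fun_prop

lemma isClosedEmbedding_psi (i : Fin 4) : IsClosedEmbedding (psi i) := by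
  refine AntilipschitzWith.isClosedEmbedding (K := 3)
    (AntilipschitzWith.of_le_mul_dist fun x y => ?_)
    (LipschitzWith.uniformContinuous (K := 1) (LipschitzWith.of_dist_le_mul fun x y => ?_))
  · rw [dist_psi, NNReal.coe_ofNat]; linarith
  · rw [dist_psi]
    have : 0 ≤ dist x y := dist_nonneg
    simp only [NNReal.coe_one, one_mul]
    linarith

lemma isClosed_bump : IsClosed bump := by
  have hcl : closure bump ⊆ hull := closure_minimal bump_subset_hull isClosed_hull
  have hsub : closure bump ⊆ midTriangle ∪ ⋃ i, psi i '' closure bump := by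
    refine closure_minimal ?_ (isClosed_midTriangle.union (isClosed_iUnion_of_finite fun i =>
      (isClosedEmbedding_psi i).isClosedMap _ isClosed_closure))
    intro z hz
    rcases mem_bump_iff.1 hz with h | ⟨i, w, hw, rfl⟩
    · exact Or.inl h
    · exact Or.inr (mem_iUnion.2 ⟨i, w, subset_closure hw, rfl⟩)
  refine isClosed_of_closure_subset fun z hz => ?_
  by_cases hzF : z ∈ kochCurve
  · exact kochCurve_subset_bump hzF
  refine hull_induction (P := fun z => z ∈ closure bump → z ∈ bump) ?_ z (hcl hz) hzF hz
  intro z _ hzF ih hz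
  rcases hsub hz with h | h
  · exact midTriangle_subset_bump h
  · obtain ⟨i, w, hw, rfl⟩ := mem_iUnion.1 h
    exact psi_mem_bump i
      (ih i w (hcl hw) (fun h => hzF (psi_mem_kochCurve i h)) rfl hw)

lemma isBounded_bump : Bornology.IsBounded bump := isBounded_hull.subset bump_subset_hull

lemma mirror_mem_bump {z : ℂ} (hz : z ∈ bump) : mirror z ∈ bump := by
  by_cases hzF : z ∈ kochCurve
  · exact kochCurve_subset_bump (mirror_mem_kochCurve hzF)
  refine hull_induction (P := fun z => z ∈ bump → mirror z ∈ bump) ?_ z (bump_subset_hull hz)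
    hzF hz
  intro z _ hzF ih hz
  rcases mem_bump_iff.1 hz with ⟨h0, h1, h2⟩ | ⟨i, w, hw, rfl⟩
  · refine midTriangle_subset_bump ⟨?_, ?_, ?_⟩ <;> simp <;> linarith
  · have := ih i w (bump_subset_hull hw) (fun h => hzF (psi_mem_kochCurve i h)) rfl hw
    have h2 := psi_mem_bump i.rev this
    rwa [psi_mirror, Fin.rev_rev] at h2

/-- The unit segment belongs to the region above it. -/
lemma mem_bump_of_ht_eq_zero {z : ℂ} (h0 : ht z = 0) (h1 : 0 ≤ z.re) (h2 : z.re ≤ 1) :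
    z ∈ bump := by
  by_cases hzF : z ∈ kochCurve
  · exact kochCurve_subset_bump hzF
  refine hull_induction (P := fun z => ht z = 0 → z ∈ bump) ?_ z
    ⟨by linarith, by linarith, by linarith⟩ hzF h0
  intro z hz hzF ih h0
  obtain ⟨-, h1, h2⟩ := hz
  rw [h0] at h1 h2
  by_cases ha : z.re ≤ 1 / 3
  · obtain ⟨w, rfl⟩ := psi_surjective 0 z
    simp at ha h1 h2 h0
    exact psi_mem_bump 0 (ih 0 w ⟨by linarith, by linarith, by linarith⟩
      (fun h => hzF (psi_mem_kochCurve 0 h)) rfl h0)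
  by_cases hb : z.re ≤ 2 / 3
  · exact midTriangle_subset_bump ⟨by linarith, by linarith, by linarith⟩
  · obtain ⟨w, rfl⟩ := psi_surjective 3 z
    simp at ha hb h1 h2 h0
    exact psi_mem_bump 3 (ih 3 w ⟨by linarith, by linarith, by linarith⟩
      (fun h => hzF (psi_mem_kochCurve 3 h)) rfl h0)

/-- The part of the region that lies to the left of the bisector of the left reentrant corner. -/
lemma mem_bump_left {z : ℂ} (hz : z ∈ bump) (hl : ht z ≤ 1 / 3 - z.re) : z ∈ psi 0 '' bump := by
  have h1 : z = psi 0 1 → z ∈ psi 0 '' bump := fun h =>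
    ⟨1, kochCurve_subset_bump one_mem_kochCurve, h.symm⟩
  rcases mem_bump_iff.1 hz with ⟨a, b, c⟩ | ⟨i, w, hw, rfl⟩
  · exact h1 (ext_ht (by simp; linarith) (by simp; linarith))
  · obtain ⟨a, b, c⟩ := bump_subset_hull hw
    fin_cases i
    · exact ⟨w, hw, rfl⟩
    all_goals simp at hl
    · exact h1 (ext_ht (by simp; linarith) (by simp; linarith))
    · linarith
    · linarith

/-- The part of the left half of the region that lies to the right of the bisector of the left
reentrant corner. -/
lemma mem_bump_middle {z : ℂ} (hz : z ∈ bump) (hl : 1 / 3 - z.re ≤ ht z) (hr : z.re ≤ 1 / 2) :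
    (0 ≤ ht z ∧ ht z ≤ z.re - 1 / 3) ∨ z ∈ psi 1 '' bump := by
  rcases mem_bump_iff.1 hz with ⟨a, b, c⟩ | ⟨i, w, hw, rfl⟩
  · exact Or.inl ⟨a, b⟩
  · obtain ⟨a, b, c⟩ := bump_subset_hull hw
    fin_cases i
    · simp at hl
      exact Or.inr ⟨0, kochCurve_subset_bump zero_mem_kochCurve,
        ext_ht (by simp; linarith) (by simp; linarith)⟩
    · exact Or.inr ⟨w, hw, rfl⟩
    · simp at hl hr
      exact Or.inr ⟨1, kochCurve_subset_bump one_mem_kochCurve,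
        ext_ht (by simp; linarith) (by simp; linarith)⟩
    · simp at hl hr; linarith

/-! ### Nearest points -/

/-- The closed `e`-neighbourhood of the Koch curve. -/
def nbhd (e : ℝ) : Set ℂ := {z | ∃ y ∈ kochCurve, dist z y ≤ e}

lemma nbhd_mono {e e' : ℝ} (h : e ≤ e') : nbhd e ⊆ nbhd e' := fun _ ⟨y, hy, hd⟩ =>
  ⟨y, hy, hd.trans h⟩

lemma mem_nbhd_iff {z : ℂ} {e : ℝ} : z ∈ nbhd e ↔ Metric.infDist z kochCurve ≤ e := by
  constructor
  · rintro ⟨y, hy, hd⟩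
    exact (Metric.infDist_le_dist_of_mem hy).trans hd
  · intro h
    obtain ⟨y, hy, hd⟩ := isCompact_kochCurve.exists_infDist_eq_dist kochCurve_nonempty z
    exact ⟨y, hy, hd ▸ h⟩

lemma isBounded_nbhd (e : ℝ) : Bornology.IsBounded (nbhd e) := by
  refine Metric.isBounded_closedBall.subset (t := Metric.closedBall 0 (e + 1)) ?_
  rintro z ⟨y, hy, hd⟩
  rw [mem_closedBall_zero_iff]
  have := norm_le_one_of_mem_hull (kochCurve_subset_hull hy)
  have h2 := dist_triangle z y 0
  rw [dist_zero_right, dist_zero_right] at h2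
  linarith

lemma volume_nbhd_ne_top (e : ℝ) : volume (nbhd e) ≠ ⊤ := (isBounded_nbhd e).measure_lt_top.ne

lemma mirror_mem_nbhd {z : ℂ} {e : ℝ} (hz : z ∈ nbhd e) : mirror z ∈ nbhd e := by
  obtain ⟨y, hy, hd⟩ := hz
  exact ⟨mirror y, mirror_mem_kochCurve hy, by rwa [dist_mirror]⟩

/-- A point of the left half-plane is at least as close to a point of the left half of the curve as
to its mirror image. -/
lemma exists_left_dist_le {z y : ℂ} (hz : z.re ≤ 1 / 2) (hy : y ∈ kochCurve) :
    ∃ w ∈ kochCurve, dist z (psi 0 w) ≤ dist z y ∨ dist z (psi 1 w) ≤ dist z y := by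
  obtain ⟨i, w, hw, rfl⟩ := mem_kochCurve_iff.1 hy
  obtain ⟨a, b, c⟩ := kochCurve_subset_hull hw
  have key : ∀ x, x.re ≤ 1 / 2 → dist z x ≤ dist z (mirror x) := by
    intro x hx
    rw [dist_le_dist_iff]
    simp only [mirror_re, ht_mirror]
    nlinarith [mul_nonneg (sub_nonneg.2 hz) (sub_nonneg.2 hx)]
  fin_cases i
  · exact ⟨w, hw, Or.inl le_rfl⟩
  · exact ⟨w, hw, Or.inr le_rfl⟩
  · refine ⟨mirror w, mirror_mem_kochCurve hw, Or.inr ?_⟩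
    rw [psi_mirror]
    have h := key (mirror (psi 2 w)) (by simp; linarith)
    rwa [mirror_mirror] at h
  · refine ⟨mirror w, mirror_mem_kochCurve hw, Or.inl ?_⟩
    rw [psi_mirror]
    have h := key (mirror (psi 3 w)) (by simp; linarith)
    rwa [mirror_mirror] at h

/-- The pieces `ψ₁(F)` and `ψ₂(F)` are mirror images of each other in the bisector of the left
reentrant corner; here for the points to the left of the bisector. -/
lemma exists_psi_zero_dist_le {z y : ℂ} (hz : z.re ≤ 1 / 2) (hl : ht z ≤ 1 / 3 - z.re)
    (hy : y ∈ kochCurve) : ∃ w ∈ kochCurve, dist z (psi 0 w) ≤ dist z y := by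
  obtain ⟨w, hw, h | h⟩ := exists_left_dist_le hz hy
  · exact ⟨w, hw, h⟩
  · refine ⟨mirror w, mirror_mem_kochCurve hw, le_trans ?_ h⟩
    obtain ⟨a, b, c⟩ := kochCurve_subset_hull hw
    rw [dist_le_dist_iff]
    simp
    nlinarith [mul_nonneg (sub_nonneg.2 hl) (show 0 ≤ w.re - ht w by linarith)]

lemma exists_psi_one_dist_le {z y : ℂ} (hz : z.re ≤ 1 / 2) (hl : 1 / 3 - z.re ≤ ht z)
    (hy : y ∈ kochCurve) : ∃ w ∈ kochCurve, dist z (psi 1 w) ≤ dist z y := by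
  obtain ⟨w, hw, h | h⟩ := exists_left_dist_le hz hy
  · refine ⟨mirror w, mirror_mem_kochCurve hw, le_trans ?_ h⟩
    obtain ⟨a, b, c⟩ := kochCurve_subset_hull hw
    rw [dist_le_dist_iff]
    simp
    nlinarith [mul_nonneg (sub_nonneg.2 hl) (show 0 ≤ 1 - w.re - ht w by linarith)]
  · exact ⟨w, hw, h⟩

lemma psi_mem_nbhd (i : Fin 4) {z : ℂ} {e : ℝ} (hz : z ∈ nbhd (3 * e)) : psi i z ∈ nbhd e := by
  obtain ⟨y, hy, hd⟩ := hz
  exact ⟨psi i y, psi_mem_kochCurve i hy, by rw [dist_psi]; linarith⟩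

lemma psi_zero_mem_nbhd_iff {z : ℂ} {e : ℝ} (hz : (psi 0 z).re ≤ 1 / 2)
    (hl : ht (psi 0 z) ≤ 1 / 3 - (psi 0 z).re) : psi 0 z ∈ nbhd e ↔ z ∈ nbhd (3 * e) := by
  refine ⟨?_, psi_mem_nbhd 0⟩
  rintro ⟨y, hy, hd⟩
  obtain ⟨w, hw, hwd⟩ := exists_psi_zero_dist_le hz hl hy
  rw [dist_psi] at hwd
  exact ⟨w, hw, by linarith⟩

lemma psi_one_mem_nbhd_iff {z : ℂ} {e : ℝ} (hz : (psi 1 z).re ≤ 1 / 2)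
    (hl : 1 / 3 - (psi 1 z).re ≤ ht (psi 1 z)) : psi 1 z ∈ nbhd e ↔ z ∈ nbhd (3 * e) := by
  refine ⟨?_, psi_mem_nbhd 1⟩
  rintro ⟨y, hy, hd⟩
  obtain ⟨w, hw, hwd⟩ := exists_psi_one_dist_le hz hl hy
  rw [dist_psi] at hwd
  exact ⟨w, hw, by linarith⟩

/-! ### Regions below the curve -/

/-- The side of the Koch curve on which the snowflake lies: the lower half-plane with the region
between the Koch curve and the unit segment. -/
def below : Set ℂ := {z | ht z ≤ 0} ∪ bump

/-- The two kinds of corners that a polygon approximating the snowflake has: convex ones with the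
interior angle `60°`, and reentrant ones with the interior angle `240°`. -/
inductive Corner
  | convex
  | reentrant

open Corner

/-- The half-plane on the right of the bisector of a corner at the origin, one of whose sides
starts along the unit segment. -/
def leftEnd : Corner → Set ℂ
  | convex => {z | 0 ≤ z.re + 3 * ht z}
  | reentrant => {z | ht z ≤ z.re}

/-- The half-plane on the left of the bisector of a corner at `1`. -/
def rightEnd : Corner → Set ℂ
  | convex => {z | 0 ≤ 1 - z.re + 3 * ht z}
  | reentrant => {z | ht z ≤ 1 - z.re}

lemma mem_leftEnd_convex {z : ℂ} : z ∈ leftEnd convex ↔ 0 ≤ z.re + 3 * ht z := Iff.rfl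

lemma mem_leftEnd_reentrant {z : ℂ} : z ∈ leftEnd reentrant ↔ ht z ≤ z.re := Iff.rfl

lemma mem_rightEnd_convex {z : ℂ} : z ∈ rightEnd convex ↔ 0 ≤ 1 - z.re + 3 * ht z := Iff.rfl

lemma mem_rightEnd_reentrant {z : ℂ} : z ∈ rightEnd reentrant ↔ ht z ≤ 1 - z.re := Iff.rfl

/-- The part of the inside of the curve that belongs to the edge from `0` to `1`, if `a` and `b` are
the kinds of the corners at its end points. -/
def region (a b : Corner) : Set ℂ := below ∩ leftEnd a ∩ rightEnd b

/-- The points of a region that have distance at most `e` from the Koch curve. -/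
def strip (a b : Corner) (e : ℝ) : Set ℂ := region a b ∩ nbhd e

/-- The left half of `strip a b e`. -/
def leftStrip (a b : Corner) (e : ℝ) : Set ℂ := strip a b e ∩ {z | z.re ≤ 1 / 2}

lemma volume_strip_ne_top (a b : Corner) (e : ℝ) : volume (strip a b e) ≠ ⊤ :=
  measure_ne_top_of_subset inter_subset_right (volume_nbhd_ne_top e)

lemma volume_leftStrip_ne_top (a b : Corner) (e : ℝ) : volume (leftStrip a b e) ≠ ⊤ :=
  measure_ne_top_of_subset inter_subset_left (volume_strip_ne_top a b e)

lemma mirror_mem_strip {a b : Corner} {e : ℝ} {z : ℂ} (hz : z ∈ strip a b e) :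
    mirror z ∈ strip b a e := by
  obtain ⟨⟨⟨h1, h2⟩, h3⟩, h4⟩ := hz
  refine ⟨⟨⟨?_, ?_⟩, ?_⟩, mirror_mem_nbhd h4⟩
  · rcases h1 with h | h
    · exact Or.inl (by simpa using h)
    · exact Or.inr (mirror_mem_bump h)
  · cases b <;> simpa [leftEnd, rightEnd] using h3
  · cases a <;> simpa [leftEnd, rightEnd] using h2

lemma volume_real_strip (a b : Corner) (e : ℝ) :
    volume.real (strip a b e) = volume.real (leftStrip a b e) + volume.real (leftStrip b a e) := by
  rw [volume_real_split (volume_strip_ne_top a b e) 1 0 (1 / 2) (by norm_num),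
    ← volume_real_mirror_image (leftStrip b a e)]
  congr 2
  · ext z; simp [leftStrip]
  · ext z
    constructor
    · rintro ⟨h1, h2⟩
      simp at h2
      refine ⟨mirror z, ⟨mirror_mem_strip h1, ?_⟩, mirror_mirror z⟩
      change 1 - z.re ≤ 1 / 2
      linarith
    · rintro ⟨w, ⟨h1, h2⟩, rfl⟩
      refine ⟨mirror_mem_strip h1, ?_⟩
      change w.re ≤ 1 / 2 at h2
      simp
      linarith

lemma leftStrip_inter_left {a b : Corner} {e : ℝ} (he : e ≤ 1 / 3) :
    leftStrip a b e ∩ {z | 1 * z.re + 1 * ht z ≤ 1 / 3} = psi 0 '' strip a reentrant (3 * e) := by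
  ext z
  constructor
  · rintro ⟨⟨⟨⟨⟨h1, h2⟩, h3⟩, h4⟩, h5⟩, h6⟩
    obtain ⟨w, rfl⟩ := psi_surjective 0 z
    rw [mem_ofPred_eq] at h5 h6
    have hl : ht (psi 0 w) ≤ 1 / 3 - (psi 0 w).re := by linarith
    refine ⟨w, ⟨⟨⟨?_, ?_⟩, ?_⟩, (psi_zero_mem_nbhd_iff h5 hl).1 h4⟩, rfl⟩
    · rcases h1 with h | h
      · refine Or.inl ?_
        rw [mem_ofPred_eq] at h ⊢
        simp at h
        linarith
      · obtain ⟨v, hv, hvw⟩ := mem_bump_left h hl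
        rw [← injective_psi 0 hvw]
        exact Or.inr hv
    · cases a <;> simp [leftEnd] at h2 ⊢ <;> linarith
    · rw [mem_rightEnd_reentrant]
      simp at hl
      linarith
  · rintro ⟨w, ⟨⟨⟨h1, h2⟩, h3⟩, h4⟩, rfl⟩
    rw [mem_rightEnd_reentrant] at h3
    have h5 : -3 ≤ 3 * ht w - w.re := by
      obtain ⟨y, hy, hd⟩ := h4
      obtain ⟨p, q, r⟩ := kochCurve_subset_hull hy
      have := sub_three_mul_ht_le w y hd
      linarith
    refine ⟨⟨⟨⟨⟨?_, ?_⟩, ?_⟩, psi_mem_nbhd 0 h4⟩, ?_⟩, ?_⟩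
    · rcases h1 with h | h
      · refine Or.inl ?_
        rw [mem_ofPred_eq] at h ⊢
        simp
        linarith
      · exact Or.inr (psi_mem_bump 0 h)
    · cases a <;> simp [leftEnd] at h2 ⊢ <;> linarith
    · cases b <;> simp [rightEnd] <;> linarith
    · rw [mem_ofPred_eq]
      simp; linarith
    · rw [mem_ofPred_eq]
      simp; linarith

lemma leftStrip_inter_right {a b : Corner} {e : ℝ} :
    leftStrip a b e ∩ {z | 1 / 3 ≤ 1 * z.re + 1 * ht z} =
      psi 1 '' strip reentrant convex (3 * e) := by
  ext z
  constructor
  · rintro ⟨⟨⟨⟨⟨h1, h2⟩, h3⟩, h4⟩, h5⟩, h6⟩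
    obtain ⟨w, rfl⟩ := psi_surjective 1 z
    rw [mem_ofPred_eq] at h5 h6
    have hl : 1 / 3 - (psi 1 w).re ≤ ht (psi 1 w) := by linarith
    refine ⟨w, ⟨⟨⟨?_, ?_⟩, ?_⟩, (psi_one_mem_nbhd_iff h5 hl).1 h4⟩, rfl⟩
    · rcases h1 with h | h
      · refine Or.inl ?_
        rw [mem_ofPred_eq] at h ⊢
        simp at h h5 hl
        linarith
      · rcases mem_bump_middle h hl h5 with h | ⟨v, hv, hvw⟩
        · refine Or.inl ?_
          rw [mem_ofPred_eq]
          simp at h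
          linarith
        · rw [← injective_psi 1 hvw]
          exact Or.inr hv
    · rw [mem_leftEnd_reentrant]
      simp at hl
      linarith
    · rw [mem_rightEnd_convex]
      simp at h5
      linarith
  · rintro ⟨w, ⟨⟨⟨h1, h2⟩, h3⟩, h4⟩, rfl⟩
    rw [mem_leftEnd_reentrant] at h2
    rw [mem_rightEnd_convex] at h3
    have h5 : 3 * ht w ≤ w.re ∧ 3 * ht w ≤ 1 - w.re ∨ ht w ≤ 0 := by
      rcases h1 with h | h
      · exact Or.inr h
      · exact Or.inl (bump_subset_hull h).2
    refine ⟨⟨⟨⟨⟨?_, ?_⟩, ?_⟩, psi_mem_nbhd 1 h4⟩, ?_⟩, ?_⟩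
    · rcases h1 with h | h
      · rw [mem_ofPred_eq] at h
        by_cases h0 : ht (psi 1 w) ≤ 0
        · exact Or.inl h0
        · refine Or.inr (midTriangle_subset_bump ⟨by linarith, ?_, ?_⟩) <;> simp <;> linarith
      · exact Or.inr (psi_mem_bump 1 h)
    · cases a <;> simp [leftEnd] <;> rcases h5 with ⟨h5, h6⟩ | h5 <;> linarith
    · cases b <;> simp [rightEnd] <;> rcases h5 with ⟨h5, h6⟩ | h5 <;> linarith
    · rw [mem_ofPred_eq]
      simp; linarith
    · rw [mem_ofPred_eq]
      simp; linarith

/-- The self-similarity of the inner neighbourhoods. -/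
lemma volume_real_leftStrip {a b : Corner} {e : ℝ} (he : e ≤ 1 / 3) :
    volume.real (leftStrip a b e) = (volume.real (strip a reentrant (3 * e)) +
      volume.real (strip reentrant convex (3 * e))) / 9 := by
  rw [volume_real_split (volume_leftStrip_ne_top a b e) 1 1 (1 / 3) (by norm_num),
    leftStrip_inter_left he, leftStrip_inter_right, volume_real_psi_image, volume_real_psi_image]
  ring

lemma volume_real_strip_swap (a b : Corner) (e : ℝ) :
    volume.real (strip a b e) = volume.real (strip b a e) := by
  rw [volume_real_strip a b, volume_real_strip b a, add_comm]

lemma volume_real_strip_convex_convex {e : ℝ} (he : e ≤ 1 / 3) :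
    volume.real (strip convex convex e) =
      4 / 9 * volume.real (strip convex reentrant (3 * e)) := by
  rw [volume_real_strip, volume_real_leftStrip he, volume_real_strip_swap reentrant convex]
  ring

lemma volume_real_strip_convex_reentrant {e : ℝ} (he : e ≤ 1 / 3) :
    volume.real (strip convex reentrant e) =
      (3 * volume.real (strip convex reentrant (3 * e)) +
        volume.real (strip reentrant reentrant (3 * e))) / 9 := by
  rw [volume_real_strip, volume_real_leftStrip he, volume_real_leftStrip he,
    volume_real_strip_swap reentrant convex]
  ring

lemma volume_real_strip_reentrant_reentrant {e : ℝ} (he : e ≤ 1 / 3) :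
    volume.real (strip reentrant reentrant e) =
      2 * (volume.real (strip convex reentrant (3 * e)) +
        volume.real (strip reentrant reentrant (3 * e))) / 9 := by
  rw [volume_real_strip, volume_real_leftStrip he, volume_real_strip_swap reentrant convex]
  ring

/-- After `m + 1` steps of the construction of the snowflake, the edges between a convex and a
reentrant corner number `2 · 4^(m+1) + 4`, those between two reentrant corners
`4^(m+1) - 4`. -/
lemma volume_real_strip_convex_convex_pow (m : ℕ) {e : ℝ} (he0 : 0 ≤ e) (he : e ≤ 1) :
    3 * volume.real (strip convex convex (e / 3 ^ (m + 1))) =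
      ((2 * 4 ^ (m + 1) + 4) * volume.real (strip convex reentrant e) +
        (4 ^ (m + 1) - 4) * volume.real (strip reentrant reentrant e)) / 9 ^ (m + 1) := by
  induction m generalizing e with
  | zero =>
    rw [volume_real_strip_convex_convex (by linarith)]
    have : 3 * (e / 3 ^ (0 + 1)) = e := by ring
    rw [this]
    ring
  | succ m ih =>
    have h := ih (e := e / 3) (by linarith) (by linarith)
    have h3 : 3 * (e / 3) = e := by ring
    rw [volume_real_strip_convex_reentrant (e := e / 3) (by linarith),
      volume_real_strip_reentrant_reentrant (e := e / 3) (by linarith), h3] at h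
    have h4 : e / 3 ^ (m + 1 + 1) = e / 3 / 3 ^ (m + 1) := by rw [pow_succ' 3 (m + 1)]; field_simp
    rw [h4, h, pow_succ (4 : ℝ) (m + 1), pow_succ (9 : ℝ) (m + 1)]
    field_simp
    ring

/-! ### Areas -/

/-- The area between the graphs of two functions. -/
lemma volume_real_between {a b : ℝ} (hab : a ≤ b) {f g : ℝ → ℝ} (hf : Continuous f)
    (hg : Continuous g) (hfg : ∀ x ∈ Icc a b, f x ≤ g x) :
    volume.real {z : ℂ | (a ≤ z.re ∧ z.re ≤ b) ∧ f z.re ≤ z.im ∧ z.im ≤ g z.re} =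
      ∫ x in a..b, (g x - f x) := by
  set S : Set (ℝ × ℝ) := {p | (a ≤ p.1 ∧ p.1 ≤ b) ∧ f p.1 ≤ p.2 ∧ p.2 ≤ g p.1} with hS
  have hSm : MeasurableSet S := by
    simp only [hS, ofPred_and]
    refine (IsClosed.inter (IsClosed.inter ?_ ?_) (IsClosed.inter ?_ ?_)).measurableSet <;>
      apply isClosed_le <;> fun_prop
  have h1 : {z : ℂ | (a ≤ z.re ∧ z.re ≤ b) ∧ f z.re ≤ z.im ∧ z.im ≤ g z.re} =
      Complex.measurableEquivRealProd ⁻¹' S := rfl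
  rw [h1, measureReal_def,
    Complex.volume_preserving_equiv_real_prod.measure_preimage hSm.nullMeasurableSet,
    Measure.volume_eq_prod, Measure.prod_apply hSm]
  have h2 : ∀ x, volume (Prod.mk x ⁻¹' S) =
      (Icc a b).indicator (fun x => ENNReal.ofReal (g x - f x)) x := by
    intro x
    by_cases hx : x ∈ Icc a b
    · rw [indicator_of_mem hx, ← Real.volume_Icc]
      congr 1
      ext y
      exact ⟨fun h => h.2, fun h => ⟨hx, h⟩⟩
    · rw [indicator_of_notMem hx]
      have : Prod.mk x ⁻¹' S = ∅ := by
        ext y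
        simp only [mem_preimage, mem_empty_iff_false, iff_false]
        exact fun h => hx h.1
      rw [this, measure_empty]
  simp_rw [h2]
  rw [lintegral_indicator measurableSet_Icc, ← ofReal_integral_eq_lintegral_ofReal,
    integral_Icc_eq_integral_Ioc, ← intervalIntegral.integral_of_le hab, ENNReal.toReal_ofReal]
  · exact intervalIntegral.integral_nonneg hab fun x hx => sub_nonneg.2 (hfg x hx)
  · exact (hg.sub hf).continuousOn.integrableOn_Icc
  · filter_upwards [ae_restrict_mem measurableSet_Icc] with x hx
    exact sub_nonneg.2 (hfg x hx)

lemma volume_real_half_midTriangle :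
    volume.real {z : ℂ | 0 ≤ ht z ∧ ht z ≤ z.re - 1 / 3 ∧ z.re ≤ 1 / 2} = √3 / 72 := by
  have h := volume_real_between (a := 1 / 3) (b := 1 / 2) (by norm_num) (f := fun _ => 0)
    (g := fun x => √3 * (x - 1 / 3)) (by fun_prop) (by fun_prop)
    (fun x hx => mul_nonneg (by positivity) (sub_nonneg.2 hx.1))
  have h2 : ∫ x in (1 / 3 : ℝ)..(1 / 2), (√3 * (x - 1 / 3) - 0) = √3 / 72 := by
    simp
    ring
  rw [← h2, ← h]
  congr 1
  ext z
  have h3 : (0 : ℝ) < √3 := by positivity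
  simp only [mem_ofPred_eq, im_eq z, mul_le_mul_iff_right₀ h3, mul_nonneg_iff_of_pos_left h3]
  constructor
  · rintro ⟨p, q, r⟩; exact ⟨⟨by linarith, r⟩, p, q⟩
  · rintro ⟨⟨p, q⟩, r, t⟩; exact ⟨r, t, q⟩

lemma volume_real_half_base :
    volume.real {z : ℂ | ht z ≤ 0 ∧ 0 ≤ z.re + 3 * ht z ∧ z.re ≤ 1 / 2} = √3 / 24 := by
  have h := volume_real_between (a := 0) (b := 1 / 2) (by norm_num) (f := fun x => √3 * ((-1 / 3) * x))
    (g := fun x => 0) (by fun_prop) (by fun_prop)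
    (fun x hx => mul_nonpos_of_nonneg_of_nonpos (by positivity) (by linarith [hx.1]))
  have h2 : ∫ x in (0 : ℝ)..(1 / 2), (0 - √3 * ((-1 / 3) * x)) = √3 / 24 := by
    have h3 : ∀ x : ℝ, 0 - √3 * ((-1 / 3) * x) = √3 / 3 * x := fun x => by ring
    simp_rw [h3]
    rw [intervalIntegral.integral_const_mul, integral_id]
    ring
  rw [← h2, ← h]
  congr 1
  ext z
  have h3 : (0 : ℝ) < √3 := by positivity
  have h4 : √3 * ht z ≤ 0 ↔ ht z ≤ 0 := by
    constructor <;> intro h <;> nlinarith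
  simp only [mem_ofPred_eq, im_eq z, mul_le_mul_iff_right₀ h3, h4]
  constructor
  · rintro ⟨p, q, r⟩; exact ⟨⟨by linarith, r⟩, by linarith, p⟩
  · rintro ⟨⟨p, q⟩, r, t⟩; exact ⟨t, by linarith, q⟩

lemma volume_bump_ne_top : volume bump ≠ ⊤ := isBounded_bump.measure_lt_top.ne

lemma volume_real_half_bump_eq :
    volume.real (bump ∩ {z | z.re ≤ 1 / 2}) = volume.real bump / 2 := by
  rw [volume_real_split volume_bump_ne_top 1 0 (1 / 2) (by norm_num)]
  have h1 : bump ∩ {z | 1 / 2 ≤ 1 * z.re + 0 * ht z} = mirror '' (bump ∩ {z | z.re ≤ 1 / 2}) := by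
    ext z
    constructor
    · rintro ⟨h1, h2⟩
      simp at h2
      refine ⟨mirror z, ⟨mirror_mem_bump h1, ?_⟩, mirror_mirror z⟩
      rw [mem_ofPred_eq, mirror_re]
      linarith
    · rintro ⟨w, ⟨h1, h2⟩, rfl⟩
      refine ⟨mirror_mem_bump h1, ?_⟩
      rw [mem_ofPred_eq] at h2
      simp
      linarith
  rw [h1, volume_real_mirror_image]
  simp

/-- The region between the Koch curve and its base consists of an equilateral triangle and four
copies of the region, scaled by `1/3`. -/
lemma volume_real_half_bump : volume.real (bump ∩ {z | z.re ≤ 1 / 2}) = √3 / 40 := by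
  have hfin : ∀ S, volume (bump ∩ S) ≠ ⊤ := fun S =>
    measure_ne_top_of_subset inter_subset_left volume_bump_ne_top
  have e1 : bump ∩ {z | z.re ≤ 1 / 2} ∩ {z | 1 * z.re + 1 * ht z ≤ 1 / 3} = psi 0 '' bump := by
    ext z
    constructor
    · rintro ⟨⟨h1, h2⟩, h3⟩
      rw [mem_ofPred_eq] at h3
      exact mem_bump_left h1 (by linarith)
    · rintro ⟨w, hw, rfl⟩
      obtain ⟨a, b, c⟩ := bump_subset_hull hw
      refine ⟨⟨psi_mem_bump 0 hw, ?_⟩, ?_⟩ <;> simp <;> linarith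
  have e2 : bump ∩ {z | z.re ≤ 1 / 2} ∩ {z | 1 / 3 ≤ 1 * z.re + 1 * ht z} ∩
      {z | -1 * z.re + 1 * ht z ≤ -1 / 3} =
      {z : ℂ | 0 ≤ ht z ∧ ht z ≤ z.re - 1 / 3 ∧ z.re ≤ 1 / 2} := by
    ext z
    constructor
    · rintro ⟨⟨⟨h1, h2⟩, h3⟩, h4⟩
      rw [mem_ofPred_eq] at h2 h4
      exact ⟨(bump_subset_hull h1).1, by linarith, h2⟩
    · rintro ⟨h1, h2, h3⟩
      refine ⟨⟨⟨midTriangle_subset_bump ⟨h1, h2, by linarith⟩, h3⟩, ?_⟩, ?_⟩ <;>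
        rw [mem_ofPred_eq] <;> linarith
  have e3 : bump ∩ {z | z.re ≤ 1 / 2} ∩ {z | 1 / 3 ≤ 1 * z.re + 1 * ht z} ∩
      {z | -1 / 3 ≤ -1 * z.re + 1 * ht z} = psi 1 '' bump := by
    ext z
    constructor
    · rintro ⟨⟨⟨h1, h2⟩, h3⟩, h4⟩
      rw [mem_ofPred_eq] at h3 h2 h4
      rcases mem_bump_middle h1 (by linarith) h2 with ⟨h5, h6⟩ | h5
      · obtain ⟨w, rfl⟩ := psi_surjective 1 z
        simp at h2 h4 h5 h6
        exact ⟨w, mem_bump_of_ht_eq_zero (by linarith) (by linarith) (by linarith), rfl⟩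
      · exact h5
    · rintro ⟨w, hw, rfl⟩
      obtain ⟨a, b, c⟩ := bump_subset_hull hw
      refine ⟨⟨⟨psi_mem_bump 1 hw, ?_⟩, ?_⟩, ?_⟩ <;> simp <;> linarith
  have h := volume_real_half_bump_eq
  have h2 := volume_real_split (hfin {z | z.re ≤ 1 / 2}) 1 1 (1 / 3) (by norm_num)
  have h3 := volume_real_split (A := bump ∩ {z | z.re ≤ 1 / 2} ∩
    {z | 1 / 3 ≤ 1 * z.re + 1 * ht z}) (by rw [inter_assoc]; exact hfin _) (-1) 1 (-1 / 3)
    (by norm_num)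
  rw [e2, e3, volume_real_half_midTriangle, volume_real_psi_image] at h3
  rw [e1, h3, volume_real_psi_image] at h2
  linarith

/-- The left halves of the hull and of the triangle below it are within distance `1/3` of the left
reentrant corner. -/
lemma mem_nbhd_of_re_le {z : ℂ} (h1 : z.re ≤ 1 / 2) (h2 : 0 ≤ z.re + 3 * ht z)
    (h3 : 3 * ht z ≤ z.re) : z ∈ nbhd (1 / 3) := by
  refine ⟨psi 0 1, psi_mem_kochCurve 0 one_mem_kochCurve, ?_⟩
  rw [dist_le_iff (by norm_num)]
  simp
  nlinarith [mul_nonneg h2 (sub_nonneg.2 h3),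
    mul_nonneg (show 0 ≤ z.re by linarith) (sub_nonneg.2 h1)]

lemma volume_real_leftStrip_convex (b : Corner) {e : ℝ} (he : 1 / 3 ≤ e) :
    volume.real (leftStrip convex b e) = √3 / 15 := by
  have e1 : leftStrip convex b e ∩ {z | 0 * z.re + 1 * ht z ≤ 0} =
      {z : ℂ | ht z ≤ 0 ∧ 0 ≤ z.re + 3 * ht z ∧ z.re ≤ 1 / 2} := by
    ext z
    constructor
    · rintro ⟨⟨⟨⟨⟨h1, h2⟩, h3⟩, h4⟩, h5⟩, h6⟩
      rw [mem_ofPred_eq] at h6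
      exact ⟨by linarith, h2, h5⟩
    · rintro ⟨h1, h2, h3⟩
      refine ⟨⟨⟨⟨⟨Or.inl h1, h2⟩, ?_⟩, nbhd_mono he (mem_nbhd_of_re_le h3 h2 (by linarith))⟩, h3⟩,
        ?_⟩
      · cases b <;> simp [rightEnd] <;> linarith
      · rw [mem_ofPred_eq]; linarith
  have e2 : leftStrip convex b e ∩ {z | 0 ≤ 0 * z.re + 1 * ht z} =
      bump ∩ {z | z.re ≤ 1 / 2} := by
    ext z
    constructor
    · rintro ⟨⟨⟨⟨⟨h1, h2⟩, h3⟩, h4⟩, h5⟩, h6⟩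
      rw [mem_ofPred_eq] at h6 h5
      rw [mem_leftEnd_convex] at h2
      refine ⟨?_, h5⟩
      rcases h1 with h1 | h1
      · rw [mem_ofPred_eq] at h1
        exact mem_bump_of_ht_eq_zero (by linarith) (by linarith) (by linarith)
      · exact h1
    · rintro ⟨h1, h2⟩
      rw [mem_ofPred_eq] at h2
      obtain ⟨p, q, r⟩ := bump_subset_hull h1
      refine ⟨⟨⟨⟨⟨Or.inr h1, ?_⟩, ?_⟩, nbhd_mono he (mem_nbhd_of_re_le h2 (by linarith) q)⟩, h2⟩, ?_⟩
      · rw [mem_leftEnd_convex]; linarith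
      · cases b <;> simp [rightEnd] <;> linarith
      · rw [mem_ofPred_eq]; linarith
  rw [volume_real_split (volume_leftStrip_ne_top _ _ _) 0 1 0 (by norm_num), e1, e2,
    volume_real_half_base, volume_real_half_bump]
  ring

lemma volume_real_strip_convex_convex_of_le {e : ℝ} (he : 1 / 3 ≤ e) :
    volume.real (strip convex convex e) = 2 * √3 / 15 := by
  rw [volume_real_strip, volume_real_leftStrip_convex _ he]
  ring

/-- The points below the left half of the curve that are also below the bisector of a convex corner
at `0`. -/
def shadow (e : ℝ) : Set ℂ := {z | 0 ≤ z.re ∧ z.re ≤ 1 / 2 ∧ z.re + 3 * ht z ≤ 0} ∩ nbhd e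

/-- The part of `shadow e` above the bisector of a convex corner at `1`. It is part of an
equilateral triangle, which is the triangle `Γ` up to a similarity. -/
def cornerPart (e : ℝ) : Set ℂ :=
  {z | 0 ≤ z.re ∧ z.re + 3 * ht z ≤ 0 ∧ 0 ≤ 1 - z.re + 3 * ht z} ∩ nbhd e

/-- The circular sector at a reentrant corner at `0`. -/
def wedge (e : ℝ) : Set ℂ := {z | z.re ≤ 0 ∧ ht z ≤ z.re ∧ dist z 0 ≤ e}

/-- The part of the circular sector below the bisector of a convex corner at `1`. -/
def wedgeTip (e : ℝ) : Set ℂ := wedge e ∩ {z | 1 - z.re + 3 * ht z ≤ 0}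

lemma volume_wedge_ne_top (e : ℝ) : volume (wedge e) ≠ ⊤ :=
  measure_ne_top_of_subset (s := Metric.closedBall 0 e) (fun _ hz => hz.2.2)
    Metric.isBounded_closedBall.measure_lt_top.ne

lemma volume_shadow_ne_top (e : ℝ) : volume (shadow e) ≠ ⊤ :=
  measure_ne_top_of_subset inter_subset_right (volume_nbhd_ne_top e)

/-- The point of the curve nearest to a point of the sector is the corner. -/
lemma mem_nbhd_iff_of_re_nonpos {z : ℂ} {e : ℝ} (h1 : z.re ≤ 0) (h2 : ht z ≤ 0) :
    z ∈ nbhd e ↔ dist z 0 ≤ e := by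
  constructor
  · rintro ⟨y, hy, hd⟩
    refine le_trans ?_ hd
    obtain ⟨a, b, c⟩ := kochCurve_subset_hull hy
    rw [dist_le_dist_iff]
    simp
    nlinarith [mul_nonneg (neg_nonneg.2 h1) (show 0 ≤ y.re by linarith),
      mul_nonneg (neg_nonneg.2 h2) a]
  · exact fun h => ⟨0, zero_mem_kochCurve, h⟩

lemma leftStrip_reentrant_inter (b : Corner) (e : ℝ) :
    leftStrip reentrant b e ∩ {z | 0 ≤ 1 * z.re + 3 * ht z} = leftStrip convex b e := by
  ext z
  constructor
  · rintro ⟨⟨⟨⟨⟨h1, h2⟩, h3⟩, h4⟩, h5⟩, h6⟩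
    rw [mem_ofPred_eq] at h6
    exact ⟨⟨⟨⟨h1, by rw [mem_leftEnd_convex]; linarith⟩, h3⟩, h4⟩, h5⟩
  · rintro ⟨⟨⟨⟨h1, h2⟩, h3⟩, h4⟩, h5⟩
    rw [mem_leftEnd_convex] at h2
    refine ⟨⟨⟨⟨⟨h1, ?_⟩, h3⟩, h4⟩, h5⟩, by rw [mem_ofPred_eq]; linarith⟩
    rw [mem_leftEnd_reentrant]
    rcases h1 with h | h
    · rw [mem_ofPred_eq] at h
      linarith
    · obtain ⟨p, q, r⟩ := bump_subset_hull h
      linarith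

lemma leftStrip_reentrant_inter_nonneg (b : Corner) (e : ℝ) :
    leftStrip reentrant b e ∩ {z | 1 * z.re + 3 * ht z ≤ 0} ∩ {z | 0 ≤ 1 * z.re + 0 * ht z} =
      shadow e ∩ rightEnd b := by
  ext z
  constructor
  · rintro ⟨⟨⟨⟨⟨⟨h1, h2⟩, h3⟩, h4⟩, h5⟩, h6⟩, h7⟩
    rw [mem_ofPred_eq] at h6 h7
    exact ⟨⟨⟨by linarith, h5, by linarith⟩, h4⟩, h3⟩
  · rintro ⟨⟨⟨h1, h2, h3⟩, h4⟩, h5⟩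
    refine ⟨⟨⟨⟨⟨⟨Or.inl ?_, ?_⟩, h5⟩, h4⟩, h2⟩, ?_⟩, ?_⟩
    · rw [mem_ofPred_eq]; linarith
    · rw [mem_leftEnd_reentrant]; linarith
    · rw [mem_ofPred_eq]; linarith
    · rw [mem_ofPred_eq]; linarith

lemma leftStrip_reentrant_inter_nonpos (b : Corner) (e : ℝ) :
    leftStrip reentrant b e ∩ {z | 1 * z.re + 3 * ht z ≤ 0} ∩ {z | 1 * z.re + 0 * ht z ≤ 0} =
      wedge e ∩ rightEnd b := by
  ext z
  constructor
  · rintro ⟨⟨⟨⟨⟨⟨h1, h2⟩, h3⟩, h4⟩, h5⟩, h6⟩, h7⟩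
    rw [mem_ofPred_eq] at h6 h7
    rw [mem_leftEnd_reentrant] at h2
    exact ⟨⟨by linarith, h2, (mem_nbhd_iff_of_re_nonpos (by linarith) (by linarith)).1 h4⟩, h3⟩
  · rintro ⟨⟨h1, h2, h4⟩, h5⟩
    refine ⟨⟨⟨⟨⟨⟨Or.inl ?_, h2⟩, h5⟩,
      (mem_nbhd_iff_of_re_nonpos h1 (by linarith)).2 h4⟩, ?_⟩, ?_⟩, ?_⟩ <;>
      rw [mem_ofPred_eq] <;> linarith

lemma volume_real_leftStrip_reentrant (b : Corner) {e : ℝ} (he : 1 / 3 ≤ e) :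
    volume.real (leftStrip reentrant b e) = √3 / 15 + volume.real (shadow e ∩ rightEnd b) +
      volume.real (wedge e ∩ rightEnd b) := by
  rw [volume_real_split (volume_leftStrip_ne_top _ _ _) 1 3 0 (by norm_num),
    leftStrip_reentrant_inter, volume_real_leftStrip_convex b he,
    volume_real_split (A := leftStrip reentrant b e ∩ _)
      (measure_ne_top_of_subset inter_subset_left (volume_leftStrip_ne_top _ _ _)) 1 0 0
      (by norm_num),
    leftStrip_reentrant_inter_nonneg, leftStrip_reentrant_inter_nonpos]
  ring

lemma shadow_inter_rightEnd_convex (e : ℝ) : shadow e ∩ rightEnd convex = cornerPart e := by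
  ext z
  constructor
  · rintro ⟨⟨⟨h1, h2, h3⟩, h4⟩, h5⟩
    exact ⟨⟨h1, h3, h5⟩, h4⟩
  · rintro ⟨⟨h1, h3, h5⟩, h4⟩
    exact ⟨⟨⟨h1, by linarith, h3⟩, h4⟩, h5⟩

lemma volume_real_wedge_split (e : ℝ) : volume.real (wedge e ∩ rightEnd convex) =
    volume.real (wedge e) - volume.real (wedgeTip e) := by
  rw [volume_real_split (volume_wedge_ne_top e) 1 (-3) 1 (by norm_num), eq_sub_iff_add_eq]
  congr 2
  · ext z
    refine and_congr_right fun _ => ?_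
    rw [mem_rightEnd_convex, mem_ofPred_eq]
    constructor <;> intro h <;> linarith
  · ext z
    refine and_congr_right fun _ => ?_
    rw [mem_ofPred_eq, mem_ofPred_eq]
    constructor <;> intro h <;> linarith

lemma volume_real_shadow_split (e : ℝ) : volume.real (shadow e) =
    volume.real (cornerPart e) +
      volume.real (shadow e ∩ {z | 1 - z.re + 3 * ht z ≤ 0}) := by
  rw [volume_real_split (volume_shadow_ne_top e) 1 (-3) 1 (by norm_num),
    ← shadow_inter_rightEnd_convex]
  congr 2
  · ext z
    refine and_congr_right fun _ => ?_
    rw [mem_rightEnd_convex, mem_ofPred_eq]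
    constructor <;> intro h <;> linarith
  · ext z
    refine and_congr_right fun _ => ?_
    rw [mem_ofPred_eq, mem_ofPred_eq]
    constructor <;> intro h <;> linarith

lemma volume_real_strip_convex_reentrant_of_le {e : ℝ} (he : 1 / 3 ≤ e) :
    volume.real (strip convex reentrant e) = 2 * √3 / 15 + volume.real (cornerPart e) +
      volume.real (wedge e) - volume.real (wedgeTip e) := by
  rw [volume_real_strip, volume_real_leftStrip_convex _ he, volume_real_leftStrip_reentrant _ he,
    shadow_inter_rightEnd_convex, volume_real_wedge_split]
  ring

lemma volume_real_strip_reentrant_reentrant_of_le {e : ℝ} (he : 1 / 3 ≤ e) :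
    volume.real (strip reentrant reentrant e) = 2 * √3 / 15 + 2 * volume.real (shadow e) +
      2 * volume.real (wedge e) := by
  have h1 : shadow e ∩ rightEnd reentrant = shadow e := by
    refine inter_eq_left.2 fun z hz => ?_
    obtain ⟨⟨a, b, c⟩, -⟩ := hz
    rw [mem_rightEnd_reentrant]
    linarith
  have h2 : wedge e ∩ rightEnd reentrant = wedge e := by
    refine inter_eq_left.2 fun z hz => ?_
    obtain ⟨a, b, -⟩ := hz
    rw [mem_rightEnd_reentrant]
    linarith
  rw [volume_real_strip, volume_real_leftStrip_reentrant _ he, h1, h2]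
  ring

/-- The triangle of `cornerPart (e / 3)`, enlarged by the factor `3`, extends below the whole curve
and ends with a tip of the sector at the corner at `1`. -/
lemma volume_real_cornerPart_div_three {e : ℝ} (he : e ≤ 1) :
    9 * volume.real (cornerPart (e / 3)) =
      2 * volume.real (shadow e) - volume.real (cornerPart e) + volume.real (wedgeTip e) := by
  set D : Set ℂ :=
    {z | 0 ≤ z.re ∧ z.re + 3 * ht z ≤ 0 ∧ 0 ≤ 3 - z.re + 3 * ht z} ∩ nbhd e with hD
  have hDtop : volume D ≠ ⊤ := measure_ne_top_of_subset inter_subset_right (volume_nbhd_ne_top e)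
  have hlow : ∀ z ∈ nbhd e, 0 ≤ 3 - z.re + 3 * ht z := by
    rintro z ⟨y, hy, hd⟩
    obtain ⟨a, b, c⟩ := kochCurve_subset_hull hy
    have := sub_three_mul_ht_le z y hd
    linarith
  have e0 : cornerPart (e / 3) = psi 0 '' D := by
    have key : ∀ w, 0 ≤ w.re → w.re + 3 * ht w ≤ 0 → 0 ≤ 3 - w.re + 3 * ht w →
        (psi 0 w ∈ nbhd (e / 3) ↔ w ∈ nbhd e) := by
      intro w h1 h2 h3
      rw [psi_zero_mem_nbhd_iff (by simp; linarith) (by simp; linarith)]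
      rw [show 3 * (e / 3) = e by ring]
    ext z
    constructor
    · rintro ⟨⟨h1, h2, h3⟩, h4⟩
      obtain ⟨w, rfl⟩ := psi_surjective 0 z
      simp at h1 h2 h3
      refine ⟨w, ⟨⟨by linarith, by linarith, by linarith⟩, ?_⟩, rfl⟩
      exact (key w (by linarith) (by linarith) (by linarith)).1 h4
    · rintro ⟨w, ⟨⟨h1, h2, h3⟩, h4⟩, rfl⟩
      refine ⟨⟨?_, ?_, ?_⟩, (key w h1 h2 h3).2 h4⟩ <;> simp <;> linarith
  have e1 : D ∩ {z | 1 * z.re + 0 * ht z ≤ 1 / 2} = shadow e := by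
    ext z
    constructor
    · rintro ⟨⟨⟨h1, h2, h3⟩, h4⟩, h5⟩
      rw [mem_ofPred_eq] at h5
      exact ⟨⟨h1, by linarith, h2⟩, h4⟩
    · rintro ⟨⟨h1, h2, h3⟩, h4⟩
      exact ⟨⟨⟨h1, h3, hlow z h4⟩, h4⟩, by rw [mem_ofPred_eq]; linarith⟩
  have e2 : D ∩ {z | 1 / 2 ≤ 1 * z.re + 0 * ht z} ∩ {z | 1 * z.re + 0 * ht z ≤ 1} =
      mirror '' (shadow e ∩ {z | 1 - z.re + 3 * ht z ≤ 0}) := by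
    ext z
    constructor
    · rintro ⟨⟨⟨⟨h1, h2, h3⟩, h4⟩, h5⟩, h6⟩
      rw [mem_ofPred_eq] at h5 h6
      refine ⟨mirror z, ⟨⟨⟨?_, ?_, ?_⟩, mirror_mem_nbhd h4⟩, ?_⟩, mirror_mirror z⟩ <;> simp <;>
        linarith
    · rintro ⟨w, ⟨⟨⟨h1, h2, h3⟩, h4⟩, h5⟩, rfl⟩
      rw [mem_ofPred_eq] at h5
      refine ⟨⟨⟨⟨?_, ?_, hlow _ (mirror_mem_nbhd h4)⟩, mirror_mem_nbhd h4⟩, ?_⟩, ?_⟩ <;> simp <;>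
        linarith
  have e3 : D ∩ {z | 1 / 2 ≤ 1 * z.re + 0 * ht z} ∩ {z | 1 ≤ 1 * z.re + 0 * ht z} =
      mirror '' wedgeTip e := by
    ext z
    constructor
    · rintro ⟨⟨⟨⟨h1, h2, h3⟩, h4⟩, h5⟩, h6⟩
      rw [mem_ofPred_eq] at h5 h6
      have h7 := (mem_nbhd_iff_of_re_nonpos (by simp; linarith) (by simp; linarith)).1
        (mirror_mem_nbhd h4)
      refine ⟨mirror z, ⟨⟨?_, ?_, h7⟩, ?_⟩, mirror_mirror z⟩
      · simp; linarith
      · -- Outside the half-plane of the corner, the tip would have distance more than `1` from it.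
        rw [dist_le_iff (dist_nonneg.trans h7)] at h7
        simp at h7 ⊢
        by_contra! hc
        nlinarith [dist_nonneg.trans h4.choose_spec.2]
      · simp; linarith
    · rintro ⟨w, ⟨⟨h1, h2, h3⟩, h5⟩, rfl⟩
      rw [mem_ofPred_eq] at h5
      have h4 := (mem_nbhd_iff_of_re_nonpos (e := e) h1 (by linarith)).2 h3
      refine ⟨⟨⟨⟨?_, ?_, hlow _ (mirror_mem_nbhd h4)⟩, mirror_mem_nbhd h4⟩, ?_⟩, ?_⟩ <;> simp <;>
        linarith
  rw [e0, volume_real_psi_image, volume_real_split hDtop 1 0 (1 / 2) (by norm_num), e1,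
    volume_real_split (A := D ∩ _) (measure_ne_top_of_subset inter_subset_left hDtop) 1 0 1
      (by norm_num), e2, e3, volume_real_mirror_image, volume_real_mirror_image]
  have := volume_real_shadow_split e
  linarith

/-- An antiderivative of `√(e² - x²)`. -/
noncomputable def circlePrimitive (e x : ℝ) : ℝ :=
  (x * √(e ^ 2 - x ^ 2) + e ^ 2 * Real.arcsin (x / e)) / 2

lemma hasDerivAt_circlePrimitive {e x : ℝ} (he : 0 < e) (hx : |x| < e) :
    HasDerivAt (circlePrimitive e) (√(e ^ 2 - x ^ 2)) x := by
  obtain ⟨h1, h2⟩ := abs_lt.1 hx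
  have hpos : 0 < e ^ 2 - x ^ 2 := by nlinarith
  have hs : HasDerivAt (fun x : ℝ => e ^ 2 - x ^ 2) (-(2 * x)) x := by
    simpa using (hasDerivAt_pow 2 x).const_sub (e ^ 2)
  have h3 := (hasDerivAt_id x).mul (hs.sqrt hpos.ne')
  have h4 : HasDerivAt (fun x : ℝ => Real.arcsin (x / e)) (1 / √(1 - (x / e) ^ 2) * (1 / e)) x := by
    refine (Real.hasDerivAt_arcsin ?_ ?_).comp x ((hasDerivAt_id x).div_const e)
    · rw [ne_eq, div_eq_iff he.ne']; simp; linarith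
    · rw [ne_eq, div_eq_iff he.ne']; simp; linarith
  have h5 := (h3.add (h4.const_mul (e ^ 2))).div_const 2
  refine h5.congr_deriv ?_
  have h6 : √(1 - (x / e) ^ 2) = √(e ^ 2 - x ^ 2) / e := by
    rw [show 1 - (x / e) ^ 2 = (e ^ 2 - x ^ 2) / e ^ 2 by field_simp, Real.sqrt_div hpos.le,
      Real.sqrt_sq he.le]
  rw [h6]
  have h7 : 0 < √(e ^ 2 - x ^ 2) := Real.sqrt_pos.2 hpos
  have h8 : √(e ^ 2 - x ^ 2) ^ 2 = e ^ 2 - x ^ 2 := Real.sq_sqrt hpos.le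
  field_simp
  simp only [id]
  linear_combination -h8

lemma integral_sqrt_sub {e a b k : ℝ} (he : 0 < e) (ha : -e < a) (hab : a ≤ b) (hb : b < e) :
    ∫ x in a..b, (√(e ^ 2 - x ^ 2) - k * x) =
      circlePrimitive e b - circlePrimitive e a - k * (b ^ 2 - a ^ 2) / 2 := by
  rw [intervalIntegral.integral_sub, intervalIntegral.integral_const_mul, integral_id,
    intervalIntegral.integral_eq_sub_of_hasDerivAt (f := circlePrimitive e)]
  · ring
  · intro x hx
    rw [uIcc_of_le hab] at hx
    exact hasDerivAt_circlePrimitive he (abs_lt.2 ⟨by linarith [hx.1], by linarith [hx.2]⟩)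
  all_goals exact Continuous.intervalIntegrable (by fun_prop) _ _

lemma im_sq_le_iff {z : ℂ} {e : ℝ} (he : 0 ≤ e) (hz : 0 ≤ z.im) (hx : z.re ^ 2 ≤ e ^ 2) :
    z.im ≤ √(e ^ 2 - z.re ^ 2) ↔ dist z 0 ≤ e := by
  rw [Real.le_sqrt hz (sub_nonneg.2 hx), dist_le_iff he, im_eq]
  simp
  have : (√3 * ht z) ^ 2 = 3 * ht z ^ 2 := by rw [mul_pow, Real.sq_sqrt (by norm_num)]
  rw [this]
  constructor <;> intro h <;> linarith

lemma circlePrimitive_half {e : ℝ} (he : 0 < e) :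
    circlePrimitive e (e / 2) = (√3 / 4 + Real.pi / 6) * e ^ 2 / 2 := by
  have h1 : √(e ^ 2 - (e / 2) ^ 2) = √3 / 2 * e := by
    rw [show e ^ 2 - (e / 2) ^ 2 = (√3 / 2 * e) ^ 2 by
      rw [mul_pow, div_pow √3, Real.sq_sqrt (by norm_num)]; ring, Real.sqrt_sq (by positivity)]
  have h2 : Real.arcsin (e / 2 / e) = Real.pi / 6 := by
    rw [show e / 2 / e = Real.sin (Real.pi / 6) by rw [Real.sin_pi_div_six]; field_simp]
    exact Real.arcsin_sin (by linarith [Real.pi_pos]) (by linarith [Real.pi_pos])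
  rw [circlePrimitive, h1, h2]
  ring

lemma circlePrimitive_sqrt_three {e : ℝ} (he : 0 < e) :
    circlePrimitive e (√3 / 2 * e) = (√3 / 4 + Real.pi / 3) * e ^ 2 / 2 := by
  have h1 : √(e ^ 2 - (√3 / 2 * e) ^ 2) = e / 2 := by
    rw [show e ^ 2 - (√3 / 2 * e) ^ 2 = (e / 2) ^ 2 by
      rw [mul_pow, div_pow √3, Real.sq_sqrt (by norm_num)]; ring, Real.sqrt_sq (by positivity)]
  have h2 : Real.arcsin (√3 / 2 * e / e) = Real.pi / 3 := by
    rw [show √3 / 2 * e / e = Real.sin (Real.pi / 3) by rw [Real.sin_pi_div_three]; field_simp]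
    exact Real.arcsin_sin (by linarith [Real.pi_pos]) (by linarith [Real.pi_pos])
  rw [circlePrimitive, h1, h2]
  ring

lemma volume_real_wedge {e : ℝ} (he : 0 < e) : volume.real (wedge e) = Real.pi * e ^ 2 / 12 := by
  have h3 : (0 : ℝ) < √3 := by positivity
  have h := volume_real_between (a := 0) (b := e / 2) (by positivity) (f := fun x => √3 * x)
    (g := fun x => √(e ^ 2 - x ^ 2)) (by fun_prop) (by fun_prop) (fun x hx => by
      refine Real.le_sqrt_of_sq_le ?_
      rw [mul_pow, Real.sq_sqrt (by norm_num)]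
      nlinarith [hx.1, hx.2])
  rw [integral_sqrt_sub he (by linarith) (by positivity) (by linarith), circlePrimitive_half he]
    at h
  have h4 : circlePrimitive e 0 = 0 := by simp [circlePrimitive]
  have h5 : volume.real ((fun z : ℂ => -z) '' wedge e) = volume.real (wedge e) := by
    rw [volume_real_image_of_dist one_pos (fun x y => by rw [dist_neg_neg, one_mul])]
    simp
  have hn : ∀ z, ht (-z) = -ht z := fun z => by simp [ht, neg_div]
  rw [← h5]
  rw [h4] at h
  trans (√3 / 4 + Real.pi / 6) * e ^ 2 / 2 - 0 - √3 * ((e / 2) ^ 2 - 0 ^ 2) / 2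
  · rw [← h]
    congr 1
    ext z
    constructor
    · rintro ⟨w, ⟨h1, h2, h6⟩, rfl⟩
      have h7 : dist (-w) 0 ≤ e := by simpa using h6
      have h8 := (dist_le_iff he.le).1 h7
      simp only [Complex.neg_re, hn, Complex.zero_re, ht_zero, sub_zero] at h8
      have h9 : 0 ≤ (-w).im := by rw [im_eq, hn]; exact mul_nonneg h3.le (by linarith)
      refine ⟨⟨?_, ?_⟩, ?_, (im_sq_le_iff he.le h9 ?_).2 h7⟩
      · simpa using h1
      · rw [Complex.neg_re]; nlinarith
      · rw [im_eq (-w), hn, Complex.neg_re]; exact mul_le_mul_of_nonneg_left (by linarith) h3.le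
      · rw [Complex.neg_re]; nlinarith
    · rintro ⟨⟨h1, h2⟩, h6, h7⟩
      have h8 : z.re ≤ ht z := by rwa [im_eq, mul_le_mul_iff_right₀ h3] at h6
      have h9 : 0 ≤ z.im := by rw [im_eq]; exact mul_nonneg h3.le (by linarith)
      have h10 := (im_sq_le_iff he.le h9 (by nlinarith)).1 h7
      exact ⟨-z, ⟨by simpa using h1, by rw [hn, Complex.neg_re]; linarith, by simpa using h10⟩,
        neg_neg z⟩
  · ring

/-- The reflection in the line through the origin that takes the bisector of a convex corner at `1`
to the line `x = 1/2`. -/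
noncomputable def flip (z : ℂ) : ℂ := pt (z.re / 2 - 3 / 2 * ht z) (-(z.re + ht z) / 2)

@[simp] lemma flip_re (z : ℂ) : (flip z).re = z.re / 2 - 3 / 2 * ht z := rfl

@[simp] lemma ht_flip (z : ℂ) : ht (flip z) = -(z.re + ht z) / 2 := by simp [flip]

lemma flip_flip (z : ℂ) : flip (flip z) = z := ext_ht (by simp; ring) (by simp; ring)

lemma dist_flip (z w : ℂ) : dist (flip z) (flip w) = dist z w := by
  apply le_antisymm <;> rw [dist_le_dist_iff] <;> simp <;> nlinarith

lemma volume_real_wedgeTip {e : ℝ} (he0 : 1 / √3 ≤ e) (he : e ≤ 1) :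
    volume.real (wedgeTip e) = √3 / 24 - √(e ^ 2 - 1 / 4) / 4
      - e ^ 2 / 2 * Real.arcsin (1 / (2 * e)) + Real.pi * e ^ 2 / 6 := by
  have h3 : (0 : ℝ) < √3 := by positivity
  have hs : √3 ^ 2 = 3 := Real.sq_sqrt (by norm_num)
  have hs2 : √3 < 2 := by nlinarith
  have hpos : 0 < e := lt_of_lt_of_le (by positivity) he0
  have h13 : 1 ≤ e * √3 := (div_le_iff₀ h3).1 he0
  have he2 : 1 / 2 < e := by nlinarith
  have hab : 1 / 2 ≤ √3 / 2 * e := by linarith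
  have h := volume_real_between hab (f := fun x => √3 / 3 * x)
    (g := fun x => √(e ^ 2 - x ^ 2)) (by fun_prop) (by fun_prop) (fun x hx => by
      have h0 : 0 ≤ x := by linarith [hx.1]
      refine Real.le_sqrt_of_sq_le ?_
      rw [mul_pow, div_pow, hs]
      have h1 : x ^ 2 ≤ (√3 / 2 * e) ^ 2 := pow_le_pow_left₀ h0 hx.2 2
      rw [mul_pow, div_pow, hs] at h1
      linarith)
  rw [integral_sqrt_sub hpos (by linarith) hab (by nlinarith), circlePrimitive_sqrt_three hpos] at h
  have h4 : volume.real (flip '' wedgeTip e) = volume.real (wedgeTip e) := by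
    rw [volume_real_image_of_dist one_pos (fun x y => by rw [dist_flip, one_mul])]
    simp
  have hflip0 : flip 0 = 0 := ext_ht (by simp) (by simp)
  have hd : ∀ z, dist (flip z) 0 = dist z 0 := fun z => by
    conv_lhs => rw [← hflip0]
    exact dist_flip z 0
  have h5 : flip '' wedgeTip e = {z : ℂ | (1 / 2 ≤ z.re ∧ z.re ≤ √3 / 2 * e) ∧
      √3 / 3 * z.re ≤ z.im ∧ z.im ≤ √(e ^ 2 - z.re ^ 2)} := by
    have hbound : ∀ z, dist z 0 ≤ e → 0 ≤ z.re → z.re ≤ 3 * ht z → z.re ≤ √3 / 2 * e := by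
      intro z h1 h0 h2
      rw [dist_le_iff hpos.le] at h1
      simp only [Complex.zero_re, ht_zero, sub_zero] at h1
      refine (sq_le_sq₀ h0 (by positivity)).1 ?_
      rw [mul_pow, div_pow, hs]
      nlinarith
    ext z
    constructor
    · rintro ⟨w, ⟨⟨h1, h2, h6⟩, h7⟩, rfl⟩
      rw [mem_ofPred_eq] at h7
      have h8 : dist (flip w) 0 ≤ e := by rwa [hd]
      have h9 : 1 / 2 ≤ (flip w).re := by simp; linarith
      have h10 : (flip w).re ≤ 3 * ht (flip w) := by simp; linarith
      have h11 := hbound _ h8 (by linarith) h10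
      have h12 : 0 ≤ (flip w).im := by rw [im_eq]; exact mul_nonneg h3.le (by linarith)
      refine ⟨⟨h9, h11⟩, ?_, (im_sq_le_iff hpos.le h12 ?_).2 h8⟩
      · rw [im_eq]; nlinarith
      · nlinarith
    · rintro ⟨⟨h1, h2⟩, h6, h7⟩
      have h8 : z.re ≤ 3 * ht z := by
        rw [im_eq] at h6
        nlinarith
      have h9 : 0 ≤ z.im := by rw [im_eq]; exact mul_nonneg h3.le (by linarith)
      have h10 := (im_sq_le_iff hpos.le h9 (by nlinarith)).1 h7
      have h11 := (dist_le_iff hpos.le).1 h10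
      simp only [Complex.zero_re, ht_zero, sub_zero] at h11
      refine ⟨flip z, ⟨⟨?_, ?_, by rwa [hd]⟩, ?_⟩, flip_flip z⟩
      · simp; linarith
      · -- The disc of radius `1` meets the half-plane `x ≥ 1/2` in directions of at most `60°`.
        have : ht z ≤ z.re := by nlinarith
        simp; linarith
      · simp; linarith
  rw [← h4, h5, h, circlePrimitive]
  rw [show e ^ 2 - (1 / 2) ^ 2 = e ^ 2 - 1 / 4 by ring, show 1 / 2 / e = 1 / (2 * e) by field_simp,
    mul_pow, div_pow, hs]
  ring

lemma volume_real_wedgeTip_of_le {e : ℝ} (he : e ≤ 1 / √3) : volume.real (wedgeTip e) = 0 := by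
  have h3 : (0 : ℝ) < √3 := by positivity
  have hs : √3 ^ 2 = 3 := Real.sq_sqrt (by norm_num)
  refine measureReal_mono_null ?_ (s₂ := {z : ℂ | 1 * z.re + (-3) * ht z = 1}) ?_ ?_
  · rintro z ⟨⟨h1, h2, h4⟩, h5⟩
    rw [mem_ofPred_eq] at h5
    have h0 := dist_nonneg.trans h4
    have h6 : e ^ 2 ≤ 1 / 3 := by
      have := pow_le_pow_left₀ h0 he 2
      rwa [div_pow, hs, one_pow] at this
    rw [dist_le_iff h0] at h4
    simp only [Complex.zero_re, ht_zero, sub_zero] at h4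
    rw [mem_ofPred_eq]
    nlinarith
  · rw [measureReal_def, volume_line (by norm_num)]; simp
  · rw [volume_line (by norm_num)]; simp

/-! ### The sector bounded by the Koch curve -/

lemma isOpenMap_psi (i : Fin 4) : IsOpenMap (psi i) :=
  ((isClosedEmbedding_psi i).isEmbedding.toHomeomorphOfSurjective (psi_surjective i)).isOpenMap

lemma mem_bump_of_psi_mem (i : Fin 4) {z : ℂ} (hz : z ∈ hull) (h : psi i z ∈ bump) :
    z ∈ bump := by
  have h0 : ∀ z ∈ hull, psi 0 z ∈ bump → z ∈ bump := by
    rintro z ⟨a, b, c⟩ h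
    obtain ⟨v, hv, hvz⟩ := mem_bump_left h (by simp; linarith)
    rwa [← injective_psi 0 hvz]
  have h1 : ∀ z ∈ hull, psi 1 z ∈ bump → z ∈ bump := by
    rintro z ⟨a, b, c⟩ h
    rcases mem_bump_middle h (by simp; linarith) (by simp; linarith) with ⟨h2, h3⟩ | ⟨v, hv, hvz⟩
    · simp at h3
      exact mem_bump_of_ht_eq_zero (by linarith) (by linarith) (by linarith)
    · rwa [← injective_psi 1 hvz]
  have hm := mirror_mem_bump h
  rw [← mirror_mirror z, psi_mirror, mirror_mirror] at hm
  fin_cases i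
  · exact h0 z hz h
  · exact h1 z hz h
  · simpa using mirror_mem_bump (h1 _ (mirror_mem_hull hz) hm)
  · simpa using mirror_mem_bump (h0 _ (mirror_mem_hull hz) hm)

lemma psi_one_mem_below {w : ℂ} (hw : w ∈ below)
    (h2 : (psi 1 w).re ≤ 1 / 2) : psi 1 w ∈ below := by
  rcases hw with hw | hw
  · rw [mem_ofPred_eq] at hw
    by_cases h0 : ht (psi 1 w) ≤ 0
    · exact Or.inl h0
    · simp at h0 h2
      refine Or.inr (midTriangle_subset_bump ⟨?_, ?_, ?_⟩) <;> simp <;> linarith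
  · exact Or.inr (psi_mem_bump 1 hw)

lemma mirror_mem_below {z : ℂ} (hz : z ∈ below) : mirror z ∈ below := by
  rcases hz with h | h
  · exact Or.inl (by simpa using h)
  · exact Or.inr (mirror_mem_bump h)

lemma ne_of_not_mem_kochCurve {w : ℂ} (h : w ∉ kochCurve) : ¬ (w.re = 0 ∧ ht w = 0) ∧
    ¬ (w.re = 1 ∧ ht w = 0) := by
  refine ⟨fun h2 => h ?_, fun h2 => h ?_⟩
  · rw [show w = 0 from ext_ht (by simp [h2.1]) (by simp [h2.2])]; exact zero_mem_kochCurve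
  · rw [show w = 1 from ext_ht (by simp [h2.1]) (by simp [h2.2])]; exact one_mem_kochCurve

/-- The points of the region above the unit segment that do not lie on the curve are inside. -/
lemma mem_interior_below {z : ℂ} (hz : z ∈ bump) (hzF : z ∉ kochCurve) : z ∈ interior below := by
  refine hull_induction (P := fun z => z ∈ bump → z ∈ interior below) ?_ z (bump_subset_hull hz)
    hzF hz
  intro z hz hzF ih hzb
  have key : ∀ i, ∀ w ∈ bump, psi i w = z → z ∈ interior below := by
    rintro i w hwb rfl
    have hw := bump_subset_hull hwb
    have hwF : w ∉ kochCurve := fun h => hzF (psi_mem_kochCurve i h)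
    have hint := ih i w hw hwF rfl hwb
    have hopen : IsOpen (psi i '' interior below) := isOpenMap_psi i _ isOpen_interior
    obtain ⟨hne0, hne1⟩ := ne_of_not_mem_kochCurve hwF
    obtain ⟨a, b, c⟩ := hw
    have hout : ∀ i : Fin 4, (i = 0 ∨ i = 3) → psi i '' interior below ⊆ below := by
      rintro i hi _ ⟨v, hv, rfl⟩
      rcases interior_subset hv with h | h
      · refine Or.inl ?_
        rw [mem_ofPred_eq] at h ⊢
        rcases hi with rfl | rfl <;> simp <;> linarith
      · exact Or.inr (psi_mem_bump i h)
    have hmem : psi i w ∈ psi i '' interior below := ⟨w, hint, rfl⟩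
    fin_cases i
    · exact interior_maximal (hout 0 (Or.inl rfl)) hopen hmem
    · -- Near a point of the second piece, its inside is cut off by the bisectors at its end points.
      have ho : IsOpen {z : ℂ | 1 / 3 - z.re < ht z ∧ z.re < 1 / 2} := by
        simp only [ofPred_and]
        refine IsOpen.inter ?_ ?_ <;> apply isOpen_lt <;> fun_prop
      refine interior_maximal ?_ (hopen.inter ho) ⟨hmem, ?_, ?_⟩
      · rintro _ ⟨⟨v, hv, rfl⟩, h1, h2⟩
        exact psi_one_mem_below (interior_subset hv) h2.le
      · by_contra! h
        simp at h
        exact hne0 ⟨by linarith, by linarith⟩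
      · by_contra! h
        simp at h
        exact hne1 ⟨by linarith, by linarith⟩
    · have ho : IsOpen {z : ℂ | z.re - 2 / 3 < ht z ∧ 1 / 2 < z.re} := by
        simp only [ofPred_and]
        refine IsOpen.inter ?_ ?_ <;> apply isOpen_lt <;> fun_prop
      refine interior_maximal ?_ (hopen.inter ho) ⟨hmem, ?_, ?_⟩
      · rintro _ ⟨⟨v, hv, rfl⟩, h1, h2⟩
        have h3 : psi 1 (mirror v) ∈ below := by
          refine psi_one_mem_below (mirror_mem_below (interior_subset hv)) ?_
          simp at h2 ⊢; linarith
        have h4 := mirror_mem_below h3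
        rwa [psi_mirror, mirror_mirror] at h4
      · by_contra! h
        simp at h
        exact hne1 ⟨by linarith, by linarith⟩
      · by_contra! h
        simp at h
        exact hne0 ⟨by linarith, by linarith⟩
    · exact interior_maximal (hout 3 (Or.inr rfl)) hopen hmem
  rcases mem_bump_iff.1 hzb with ⟨h0, h1, h2⟩ | ⟨i, w, hw, hwz⟩
  · rcases h1.lt_or_eq with h1 | h1
    · rcases h2.lt_or_eq with h2 | h2
      · have ho : IsOpen {z : ℂ | ht z < z.re - 1 / 3 ∧ ht z < 2 / 3 - z.re} := by
          simp only [ofPred_and]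
          refine IsOpen.inter ?_ ?_ <;> apply isOpen_lt <;> fun_prop
        refine interior_maximal ?_ ho ⟨h1, h2⟩
        rintro v ⟨h3, h4⟩
        by_cases hv : ht v ≤ 0
        · exact Or.inl hv
        · exact Or.inr (midTriangle_subset_bump ⟨by linarith, h3.le, h4.le⟩)
      · obtain ⟨w, rfl⟩ := psi_surjective 2 z
        simp at h0 h1 h2
        exact key 2 w (mem_bump_of_ht_eq_zero (by linarith) (by linarith) (by linarith)) rfl
    · obtain ⟨w, rfl⟩ := psi_surjective 1 z
      simp at h0 h1 h2
      exact key 1 w (mem_bump_of_ht_eq_zero (by linarith) (by linarith) (by linarith)) rfl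
  · exact key i w hw hwz

lemma isClosed_below : IsClosed below :=
  (isClosed_le (by fun_prop) (by fun_prop)).union isClosed_bump

lemma isClosed_region_convex : IsClosed (region convex convex) :=
  (isClosed_below.inter (isClosed_le (by fun_prop) (by fun_prop))).inter
    (isClosed_le (by fun_prop) (by fun_prop))

lemma mem_segment_zero_iff {z : ℂ} : z ∈ segment ℝ 0 center ↔
    z.re + 3 * ht z = 0 ∧ ht z ≤ 0 ∧ z.re ≤ 1 / 2 := by
  constructor
  · rintro ⟨a, b, ha, hb, hab, rfl⟩
    simp only [smul_zero, zero_add, ht_smul, Complex.smul_re, center_re, ht_center, smul_eq_mul]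
    refine ⟨?_, ?_, ?_⟩ <;> linarith
  · rintro ⟨h1, h2, h3⟩
    refine ⟨1 - 2 * z.re, 2 * z.re, by linarith, by linarith, by ring, ext_ht ?_ ?_⟩
    · simp only [smul_zero, zero_add, Complex.smul_re, center_re, smul_eq_mul]; ring
    · simp only [smul_zero, zero_add, ht_smul, ht_center]; linarith

lemma mem_segment_one_iff {z : ℂ} : z ∈ segment ℝ 1 center ↔
    1 - z.re + 3 * ht z = 0 ∧ ht z ≤ 0 ∧ 1 / 2 ≤ z.re := by
  constructor
  · rintro ⟨a, b, ha, hb, hab, rfl⟩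
    simp only [ht_add, ht_smul, Complex.add_re, Complex.smul_re, center_re, ht_center, smul_eq_mul,
      Complex.one_re, ht_one]
    refine ⟨?_, ?_, ?_⟩ <;> linarith
  · rintro ⟨h1, h2, h3⟩
    refine ⟨2 * z.re - 1, 2 - 2 * z.re, by linarith, by linarith, by ring, ext_ht ?_ ?_⟩
    · simp only [Complex.add_re, Complex.smul_re, Complex.one_re, center_re, smul_eq_mul]; ring
    · simp only [ht_add, ht_smul, ht_one, ht_center]; linarith

lemma region_diff_subset_interior :
    region convex convex \ sectorBoundary ⊆ interior (region convex convex) := by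
  rintro z ⟨⟨⟨h1, h2⟩, h3⟩, hb⟩
  rw [mem_leftEnd_convex] at h2
  rw [mem_rightEnd_convex] at h3
  have hF : z ∉ kochCurve := fun h => hb (Or.inl (Or.inl h))
  have hs0 : z ∉ segment ℝ 0 center := fun h => hb (Or.inl (Or.inr h))
  have hs1 : z ∉ segment ℝ 1 center := fun h => hb (Or.inr h)
  rw [mem_segment_zero_iff] at hs0
  rw [mem_segment_one_iff] at hs1
  obtain ⟨hne0, hne1⟩ := ne_of_not_mem_kochCurve hF
  have h2' : 0 < z.re + 3 * ht z := by
    refine lt_of_le_of_ne h2 fun h => ?_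
    rcases h1 with h1 | h1
    · rw [mem_ofPred_eq] at h1
      exact hs0 ⟨h.symm, h1, by linarith⟩
    · obtain ⟨p, q, r⟩ := bump_subset_hull h1
      exact hne0 ⟨by linarith, by linarith⟩
  have h3' : 0 < 1 - z.re + 3 * ht z := by
    refine lt_of_le_of_ne h3 fun h => ?_
    rcases h1 with h1 | h1
    · rw [mem_ofPred_eq] at h1
      exact hs1 ⟨h.symm, h1, by linarith⟩
    · obtain ⟨p, q, r⟩ := bump_subset_hull h1
      exact hne1 ⟨by linarith, by linarith⟩
  have hbelow : z ∈ interior below := by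
    rcases lt_or_ge (ht z) 0 with h | h
    · exact interior_maximal (show {z | ht z < 0} ⊆ below from fun w (hw : ht w < 0) => Or.inl hw.le)
        (isOpen_lt (by fun_prop) (by fun_prop)) h
    · refine mem_interior_below ?_ hF
      rcases h1 with h1 | h1
      · rw [mem_ofPred_eq] at h1
        exact mem_bump_of_ht_eq_zero (by linarith) (by linarith) (by linarith)
      · exact h1
  have ho : IsOpen {z : ℂ | 0 < z.re + 3 * ht z ∧ 0 < 1 - z.re + 3 * ht z} := by
    simp only [ofPred_and]
    refine IsOpen.inter ?_ ?_ <;> apply isOpen_lt <;> fun_prop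
  refine interior_maximal ?_ (isOpen_interior.inter ho) ⟨hbelow, h2', h3'⟩
  rintro w ⟨hw, h4, h5⟩
  exact ⟨⟨interior_subset hw, h4.le⟩, h5.le⟩

/-- From `z`, one of the two equal sides of the hull can be reached within the hull without touching
the region between the curve and the unit segment. -/
def Escapes (z : ℂ) : Prop :=
  ∃ C : Set ℂ, IsPreconnected C ∧ C ⊆ hull \ bump ∧ z ∈ C ∧
    ∃ p ∈ C, p.re = 3 * ht p ∨ 1 - p.re = 3 * ht p

lemma Escapes.of_mem {C : Set ℂ} {z p : ℂ} (hC : IsPreconnected C) (hCs : C ⊆ hull \ bump)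
    (hz : z ∈ C) (hp : p ∈ C) (h : Escapes p) : Escapes z := by
  obtain ⟨C', hC', hCs', hp', q, hq, hq'⟩ := h
  exact ⟨C ∪ C', hC.union p hp hp' hC', union_subset hCs hCs', Or.inl hz, q, Or.inr hq, hq'⟩

lemma Escapes.mirror {z : ℂ} (h : Escapes z) : Escapes (mirror z) := by
  obtain ⟨C, hC, hCs, hz, p, hp, hp'⟩ := h
  refine ⟨Koch.mirror '' C, hC.image _ continuous_mirror.continuousOn, ?_, ⟨z, hz, rfl⟩,
    Koch.mirror p, ⟨p, hp, rfl⟩, ?_⟩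
  · rintro _ ⟨w, hw, rfl⟩
    refine ⟨mirror_mem_hull (hCs hw).1, fun h => (hCs hw).2 ?_⟩
    simpa using mirror_mem_bump h
  · rw [mirror_re, ht_mirror, sub_sub_cancel]
    exact hp'.symm

lemma not_mem_bump_of_gap {z : ℂ} (h1 : z.re < 1 / 3) (h2 : 1 / 3 - z.re < 3 * ht z) :
    z ∉ bump := by
  intro h
  rcases mem_bump_iff.1 h with ⟨a, b, c⟩ | ⟨i, w, hw, rfl⟩
  · linarith
  · obtain ⟨a, b, c⟩ := bump_subset_hull hw
    fin_cases i <;> simp at h1 h2 <;> linarith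

/-- The gap between the first two pieces of the hull is a triangle that has a side in common with
the hull. -/
lemma escapes_of_gap {z : ℂ} (h1 : z.re ≤ 1 / 3) (h2 : 1 / 3 - z.re ≤ 3 * ht z)
    (h3 : 3 * ht z ≤ z.re) (hz : z ∉ bump) : Escapes z := by
  refine ⟨segment ℝ z (pt (1 / 4) (1 / 12)), (convex_segment _ _).isPreconnected, ?_,
    left_mem_segment _ _ _, _, right_mem_segment _ _ _, Or.inl (by simp; norm_num)⟩
  rintro _ ⟨a, b, ha, hb, hab, rfl⟩
  rcases hb.eq_or_lt with rfl | hb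
  · rw [add_zero] at hab
    subst hab
    rw [one_smul, zero_smul, add_zero]
    exact ⟨⟨by linarith, by linarith, by linarith⟩, hz⟩
  have ha' : a = 1 - b := by linarith
  have h4 : a * z.re ≤ a * (1 / 3) := mul_le_mul_of_nonneg_left h1 ha
  have h5 : a * (1 / 3 - z.re) ≤ a * (3 * ht z) := mul_le_mul_of_nonneg_left h2 ha
  have h6 : a * (3 * ht z) ≤ a * z.re := mul_le_mul_of_nonneg_left h3 ha
  refine ⟨⟨?_, ?_, ?_⟩, not_mem_bump_of_gap ?_ ?_⟩ <;>
    simp only [ht_add, ht_smul, Complex.add_re, Complex.smul_re, smul_eq_mul, pt_re, ht_pt] <;>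
    linarith

lemma Escapes.psi (i : Fin 4) {w : ℂ} (hw : Escapes w) : Escapes (psi i w) := by
  have key : ∀ i : Fin 4, (i = 0 ∨ i = 1) → ∀ w, Escapes w → Escapes (Koch.psi i w) := by
    rintro i hi w ⟨C, hC, hCs, hw, p, hp, hp'⟩
    have hCs' : Koch.psi i '' C ⊆ hull \ bump := by
      rintro _ ⟨v, hv, rfl⟩
      exact ⟨psi_mem_hull i (hCs hv).1, fun h => (hCs hv).2 (mem_bump_of_psi_mem i (hCs hv).1 h)⟩
    have hC' := hC.image _ (continuous_psi i).continuousOn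
    have hpi : Koch.psi i p ∈ Koch.psi i '' C := ⟨p, hp, rfl⟩
    obtain ⟨⟨a, b, c⟩, -⟩ := hCs hp
    have hpb := (hCs' hpi).2
    refine Escapes.of_mem hC' hCs' ⟨w, hw, rfl⟩ hpi ?_
    rcases hi with rfl | rfl <;> rcases hp' with h | h
    · exact ⟨_, hC', hCs', hpi, _, hpi, Or.inl (by simp; linarith)⟩
    · exact escapes_of_gap (by simp; linarith) (by simp; linarith) (by simp; linarith) hpb
    · exact escapes_of_gap (by simp; linarith) (by simp; linarith) (by simp; linarith) hpb
    · exact ⟨_, hC', hCs', hpi, _, hpi, Or.inl (by simp; linarith)⟩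
  have hm : ∀ i : Fin 4, (i = 0 ∨ i = 1) → Escapes (Koch.psi i.rev w) := by
    intro i hi
    have := (key i hi _ hw.mirror).mirror
    rwa [psi_mirror, mirror_mirror] at this
  fin_cases i
  · exact key 0 (Or.inl rfl) w hw
  · exact key 1 (Or.inr rfl) w hw
  · exact hm 1 (Or.inr rfl)
  · exact hm 0 (Or.inl rfl)

lemma escapes_of_mem_hull {z : ℂ} (hz : z ∈ hull) (hzb : z ∉ bump) : Escapes z := by
  refine hull_induction (P := fun z => z ∉ bump → Escapes z) ?_ z hz
    (fun h => hzb (kochCurve_subset_bump h)) hzb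
  intro z hz hzF ih hzb
  have key : ∀ i w, w ∈ hull → Koch.psi i w = z → Escapes z := by
    rintro i w hw rfl
    exact (ih i w hw (fun h => hzF (psi_mem_kochCurve i h)) rfl
      (fun h => hzb (psi_mem_bump i h))).psi i
  obtain ⟨a, b, c⟩ := hz
  have hmid : ¬ (ht z ≤ z.re - 1 / 3 ∧ ht z ≤ 2 / 3 - z.re) := fun h =>
    hzb (midTriangle_subset_bump ⟨a, h.1, h.2⟩)
  by_cases h1 : 3 * ht z ≤ 1 / 3 - z.re
  · obtain ⟨w, rfl⟩ := psi_surjective 0 z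
    simp at a b c h1
    exact key 0 w ⟨by linarith, by linarith, by linarith⟩ rfl
  by_cases h2 : z.re ≤ 1 / 3
  · exact escapes_of_gap h2 (by linarith) b hzb
  by_cases h3 : 3 * ht z ≤ z.re - 2 / 3
  · obtain ⟨w, rfl⟩ := psi_surjective 3 z
    simp at a b c h3
    exact key 3 w ⟨by linarith, by linarith, by linarith⟩ rfl
  by_cases h4 : 2 / 3 ≤ z.re
  · have := (escapes_of_gap (z := mirror z) (by simp; linarith) (by simp; linarith)
      (by simp; linarith) (fun h => hzb (by simpa using mirror_mem_bump h))).mirror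
    rwa [mirror_mirror] at this
  by_cases h5 : z.re ≤ 1 / 2
  · have h6 : z.re - 1 / 3 ≤ ht z := by
      by_contra! h
      exact hmid ⟨h.le, by linarith⟩
    obtain ⟨w, rfl⟩ := psi_surjective 1 z
    simp at a b c h6 h2 h5
    exact key 1 w ⟨by linarith, by linarith, by linarith⟩ rfl
  · have h6 : 2 / 3 - z.re ≤ ht z := by
      by_contra! h
      exact hmid ⟨by linarith, h.le⟩
    obtain ⟨w, rfl⟩ := psi_surjective 2 z
    simp at a b c h6 h4 h5
    exact key 2 w ⟨by linarith, by linarith, by linarith⟩ rfl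

/-- A point is in an unbounded component of `Aᶜ` if it can be joined to a vertical ray in `Aᶜ`. -/
lemma not_isBounded_component {A C : Set ℂ} {z p : ℂ} (hC : IsPreconnected C) (hCA : C ⊆ Aᶜ)
    (hz : z ∈ C) (hp : p ∈ C) (s : ℝ) (hs : |s| = 1)
    (hray : ∀ t : ℝ, 0 ≤ t → p + pt 0 (s * t) ∉ A) :
    ¬ Bornology.IsBounded (connectedComponentIn Aᶜ z) := by
  set R : Set ℂ := (fun t : ℝ => p + pt 0 (s * t)) '' Ici 0 with hR
  have hpt : Continuous fun t : ℝ => p + pt 0 (s * t) := by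
    have : (fun t : ℝ => p + pt 0 (s * t)) =
        fun t : ℝ => p + ((√3 * (s * t) : ℝ) : ℂ) * Complex.I := by
      funext t
      congr 1
      apply Complex.ext <;> simp [pt]
    rw [this]
    fun_prop
  have hRc : IsPreconnected R := isPreconnected_Ici.image _ hpt.continuousOn
  have hpR : p ∈ R := ⟨0, self_mem_Ici, by
    apply ext_ht <;> simp [ht_add]⟩
  have hsub : C ∪ R ⊆ connectedComponentIn Aᶜ z := by
    refine (hC.union p hp hpR hRc).subset_connectedComponentIn (Or.inl hz) (union_subset hCA ?_)
    rintro _ ⟨t, ht, rfl⟩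
    exact hray t ht
  intro hb
  obtain ⟨M, hM⟩ := (hb.subset hsub).exists_norm_le
  have h1 : ∀ t : ℝ, 0 ≤ t → t ≤ M + |ht p| := by
    intro t h0
    have h2 := hM _ (Or.inr ⟨t, h0, rfl⟩)
    have h3 : |ht p + s * t| ≤ M := by
      refine le_trans (abs_le_of_sq_le_sq ?_ (norm_nonneg _)) h2
      rw [norm_sq_eq, ht_add, ht_pt]
      nlinarith [sq_nonneg (p + pt 0 (s * t)).re, sq_nonneg (ht p + s * t)]
    have h4 := abs_sub_abs_le_abs_sub (s * t) (-ht p)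
    rw [abs_neg, abs_mul, hs, abs_of_nonneg h0, sub_neg_eq_add, add_comm (s * t)] at h4
    linarith
  have := h1 (|M| + |ht p| + 1) (by positivity)
  linarith [le_abs_self M]

/-- The closed curve that bounds the sector lies in a rhombus, which consists of the hull of the Koch
curve and the mirror image of this hull in the unit segment. -/
lemma sectorBoundary_subset {z : ℂ} (hz : z ∈ sectorBoundary) :
    0 ≤ z.re + 3 * ht z ∧ 0 ≤ 1 - z.re + 3 * ht z ∧ 3 * ht z ≤ z.re ∧ 3 * ht z ≤ 1 - z.re := by
  rcases hz with (hz | hz) | hz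
  · obtain ⟨a, b, c⟩ := kochCurve_subset_hull hz
    exact ⟨by linarith, by linarith, b, c⟩
  · obtain ⟨a, b, c⟩ := mem_segment_zero_iff.1 hz
    exact ⟨by linarith, by linarith, by linarith, by linarith⟩
  · obtain ⟨a, b, c⟩ := mem_segment_one_iff.1 hz
    exact ⟨by linarith, by linarith, by linarith, by linarith⟩

lemma not_isBounded_component_of_not_mem {z : ℂ} (hz : z ∉ region convex convex) :
    ¬ Bornology.IsBounded (connectedComponentIn sectorBoundaryᶜ z) := by
  have hsingle : ∀ s : ℝ, |s| = 1 → (∀ t : ℝ, 0 ≤ t → z + pt 0 (s * t) ∉ sectorBoundary) →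
      ¬ Bornology.IsBounded (connectedComponentIn sectorBoundaryᶜ z) := by
    intro s hs h
    refine not_isBounded_component (C := {z}) isPreconnected_singleton ?_ rfl rfl s hs h
    refine singleton_subset_iff.2 ?_
    have h0 := h 0 le_rfl
    have : z + pt 0 (s * 0) = z := by apply ext_ht <;> simp [ht_add]
    rwa [this] at h0
  have hdown : (z.re + 3 * ht z < 0 ∨ 1 - z.re + 3 * ht z < 0) →
      ¬ Bornology.IsBounded (connectedComponentIn sectorBoundaryᶜ z) := by
    intro h
    refine hsingle (-1) (by norm_num) fun t h0 hmem => ?_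
    obtain ⟨h1, h2, h3, h4⟩ := sectorBoundary_subset hmem
    simp [ht_add] at h1 h2
    rcases h with h | h <;> linarith
  have hup : (z.re < 3 * ht z ∨ 1 - z.re < 3 * ht z) →
      ¬ Bornology.IsBounded (connectedComponentIn sectorBoundaryᶜ z) := by
    intro h
    refine hsingle 1 (by norm_num) fun t h0 hmem => ?_
    obtain ⟨h1, h2, h3, h4⟩ := sectorBoundary_subset hmem
    simp [ht_add] at h3 h4
    rcases h with h | h <;> linarith
  by_cases h1 : z.re + 3 * ht z < 0
  · exact hdown (Or.inl h1)
  by_cases h2 : 1 - z.re + 3 * ht z < 0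
  · exact hdown (Or.inr h2)
  by_cases h3 : z.re < 3 * ht z
  · exact hup (Or.inl h3)
  by_cases h4 : 1 - z.re < 3 * ht z
  · exact hup (Or.inr h4)
  push Not at h1 h2 h3 h4
  have hnb : z ∉ below := fun h => hz ⟨⟨h, h1⟩, h2⟩
  have hpos : 0 < ht z := by
    by_contra! h
    exact hnb (Or.inl h)
  obtain ⟨C, hC, hCs, hzC, p, hp, hp'⟩ :=
    escapes_of_mem_hull (z := z) ⟨hpos.le, h3, h4⟩ (fun h => hnb (Or.inr h))
  have hCb : C ⊆ sectorBoundaryᶜ := by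
    intro w hw hmem
    have hwb := (hCs hw).2
    obtain ⟨a, b, c⟩ := (hCs hw).1
    rcases hmem with (hmem | hmem) | hmem
    · exact hwb (kochCurve_subset_bump hmem)
    · obtain ⟨h5, h6, h7⟩ := mem_segment_zero_iff.1 hmem
      exact hwb (mem_bump_of_ht_eq_zero (by linarith) (by linarith) (by linarith))
    · obtain ⟨h5, h6, h7⟩ := mem_segment_one_iff.1 hmem
      exact hwb (mem_bump_of_ht_eq_zero (by linarith) (by linarith) (by linarith))
  refine not_isBounded_component hC hCb hzC hp 1 (by norm_num) fun t h0 hmem => ?_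
  rcases h0.eq_or_lt with rfl | h0
  · have : p + pt 0 (1 * 0) = p := by apply ext_ht <;> simp [ht_add]
    rw [this] at hmem
    exact hCb hp hmem
  · obtain ⟨h5, h6, h7, h8⟩ := sectorBoundary_subset hmem
    simp [ht_add] at h7 h8
    rcases hp' with h | h <;> linarith

lemma isBounded_region_convex : Bornology.IsBounded (region convex convex) := by
  refine Metric.isBounded_closedBall.subset (t := Metric.closedBall 0 1) ?_
  rintro z ⟨⟨h1, h2⟩, h3⟩
  rw [mem_leftEnd_convex] at h2
  rw [mem_rightEnd_convex] at h3
  rw [Metric.mem_closedBall, dist_le_iff zero_le_one]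
  simp
  rcases h1 with h1 | h1
  · rw [mem_ofPred_eq] at h1
    nlinarith
  · obtain ⟨a, b, c⟩ := bump_subset_hull h1
    nlinarith

/-- The bounded components of the complement of the closed curve fill the region under the curve and
above the two segments. -/
lemma sector_eq : sector = region convex convex \ sectorBoundary := by
  ext z
  constructor
  · rintro ⟨h1, h2⟩
    refine ⟨?_, h1⟩
    by_contra h
    exact not_isBounded_component_of_not_mem h h2
  · rintro ⟨h1, h2⟩
    refine ⟨h2, isBounded_region_convex.subset ?_⟩
    have hpre : IsPreconnected (connectedComponentIn sectorBoundaryᶜ z) :=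
      isPreconnected_connectedComponentIn
    have hsub := connectedComponentIn_subset sectorBoundaryᶜ z
    have hz := mem_connectedComponentIn (F := sectorBoundaryᶜ) h2
    have hcov : connectedComponentIn sectorBoundaryᶜ z ⊆
        interior (region convex convex) ∪ (region convex convex)ᶜ := by
      intro w hw
      by_cases h : w ∈ region convex convex
      · exact Or.inl (region_diff_subset_interior ⟨h, hsub hw⟩)
      · exact Or.inr h
    refine (hpre.subset_left_of_subset_union isOpen_interior isClosed_region_convex.isOpen_compl
      ?_ hcov ⟨z, hz, region_diff_subset_interior ⟨h1, h2⟩⟩).trans interior_subset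
    exact disjoint_compl_right.mono_left interior_subset

lemma volume_kochCurve : volume kochCurve = 0 := by
  have hfin : volume kochCurve ≠ ⊤ := isCompact_kochCurve.measure_lt_top.ne
  have h1 : volume.real kochCurve ≤ ∑ i, volume.real (psi i '' kochCurve) := by
    conv_lhs => rw [← hutchinson_kochCurve]
    exact measureReal_iUnion_fintype_le _
  simp only [volume_real_psi_image, Finset.sum_const, Finset.card_univ, Fintype.card_fin,
    nsmul_eq_mul] at h1
  have h2 : 0 ≤ volume.real kochCurve := measureReal_nonneg
  push_cast at h1
  exact (measureReal_eq_zero_iff hfin).1 (by linarith)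

lemma volume_sectorBoundary : volume sectorBoundary = 0 := by
  refine measure_union_null (measure_union_null volume_kochCurve ?_) ?_
  · refine measure_mono_null (t := {z : ℂ | 1 * z.re + 3 * ht z = 0}) (fun z hz => ?_)
      (volume_line (by norm_num) 0)
    rw [mem_ofPred_eq]
    linarith [(mem_segment_zero_iff.1 hz).1]
  · refine measure_mono_null (t := {z : ℂ | 1 * z.re + (-3) * ht z = 1}) (fun z hz => ?_)
      (volume_line (by norm_num) 1)
    rw [mem_ofPred_eq]
    linarith [(mem_segment_one_iff.1 hz).1]

lemma convex_halfPlane (a b c : ℝ) : Convex ℝ {z : ℂ | a * z.re + b * ht z ≤ c} := by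
  intro z hz w hw s t hs ht hst
  rw [mem_ofPred_eq] at hz hw ⊢
  simp only [ht_add, ht_smul, Complex.add_re, Complex.smul_re, smul_eq_mul]
  have h1 := mul_le_mul_of_nonneg_left hz hs
  have h2 := mul_le_mul_of_nonneg_left hw ht
  have h3 : s * c + t * c = c := by rw [← add_mul, hst, one_mul]
  linarith

lemma subset_closure_interior_bump : bump ⊆ closure (interior bump) := by
  have hmem : pt (1 / 2) (1 / 12) ∈ interior midTriangle := by
    have ho : IsOpen {z : ℂ | 0 < ht z ∧ ht z < z.re - 1 / 3 ∧ ht z < 2 / 3 - z.re} := by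
      simp only [ofPred_and]
      refine IsOpen.inter ?_ (IsOpen.inter ?_ ?_) <;> apply isOpen_lt <;> fun_prop
    refine interior_maximal ?_ ho ⟨?_, ?_, ?_⟩
    · rintro z ⟨h1, h2, h3⟩
      exact ⟨h1.le, h2.le, h3.le⟩
    all_goals simp; try norm_num
  have hpsi : ∀ i, ∀ z ∈ interior bump, psi i z ∈ interior bump := fun i z hz =>
    interior_maximal (by rintro _ ⟨w, hw, rfl⟩; exact psi_mem_bump i (interior_subset hw))
      (isOpenMap_psi i _ isOpen_interior) ⟨z, hz, rfl⟩
  have hF : kochCurve ⊆ closure (interior bump) :=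
    kochCurve_subset_closure ⟨_, interior_mono midTriangle_subset_bump hmem⟩
      (isBounded_bump.subset interior_subset) hpsi
  intro z hz
  by_cases hzF : z ∈ kochCurve
  · exact hF hzF
  refine hull_induction (P := fun z => z ∈ bump → z ∈ closure (interior bump)) ?_ z
    (bump_subset_hull hz) hzF hz
  intro z _ hzF ih hz
  rcases mem_bump_iff.1 hz with h | ⟨i, w, hw, rfl⟩
  · have hconv : Convex ℝ midTriangle := by
      have : midTriangle = {z : ℂ | 0 * z.re + (-1) * ht z ≤ 0} ∩
          ({z : ℂ | (-1) * z.re + 1 * ht z ≤ -1 / 3} ∩ {z : ℂ | 1 * z.re + 1 * ht z ≤ 2 / 3}) := by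
        ext z
        simp only [midTriangle, mem_inter_iff, mem_ofPred_eq]
        constructor <;> rintro ⟨h1, h2, h3⟩ <;> refine ⟨?_, ?_, ?_⟩ <;> linarith
      rw [this]
      exact (convex_halfPlane _ _ _).inter ((convex_halfPlane _ _ _).inter (convex_halfPlane _ _ _))
    have h2 := hconv.closure_interior_eq_closure_of_nonempty_interior ⟨_, hmem⟩
    exact closure_mono (interior_mono midTriangle_subset_bump) (h2 ▸ subset_closure h)
  · have h1 := ih i w (bump_subset_hull hw) (fun h => hzF (psi_mem_kochCurve i h)) rfl hw
    exact map_mem_closure (continuous_psi i) h1 (hpsi i)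

lemma subset_closure_interior_region :
    region convex convex ⊆ closure (interior (region convex convex)) := by
  have hbump : bump ⊆ region convex convex := fun z hz => by
    obtain ⟨a, b, c⟩ := bump_subset_hull hz
    exact ⟨⟨Or.inr hz, by rw [mem_leftEnd_convex]; linarith⟩, by rw [mem_rightEnd_convex]; linarith⟩
  set T : Set ℂ := {z : ℂ | 0 * z.re + 1 * ht z ≤ 0} ∩
    ({z : ℂ | (-1) * z.re + (-3) * ht z ≤ 0} ∩ {z : ℂ | 1 * z.re + (-3) * ht z ≤ 1}) with hT
  have hTsub : T ⊆ region convex convex := by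
    rintro z ⟨h1, h2, h3⟩
    rw [mem_ofPred_eq] at h1 h2 h3
    refine ⟨⟨Or.inl ?_, ?_⟩, ?_⟩
    · rw [mem_ofPred_eq]; linarith
    · rw [mem_leftEnd_convex]; linarith
    · rw [mem_rightEnd_convex]; linarith
  have hconv : Convex ℝ T :=
    (convex_halfPlane _ _ _).inter ((convex_halfPlane _ _ _).inter (convex_halfPlane _ _ _))
  have hmem : pt (1 / 2) (-1 / 12) ∈ interior T := by
    have ho : IsOpen {z : ℂ | ht z < 0 ∧ 0 < z.re + 3 * ht z ∧ 0 < 1 - z.re + 3 * ht z} := by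
      simp only [ofPred_and]
      refine IsOpen.inter ?_ (IsOpen.inter ?_ ?_) <;> apply isOpen_lt <;> fun_prop
    refine interior_maximal ?_ ho ⟨?_, ?_, ?_⟩
    · rintro z ⟨h1, h2, h3⟩
      refine ⟨?_, ?_, ?_⟩ <;> rw [mem_ofPred_eq] <;> linarith
    all_goals simp; try norm_num
  have h2 := hconv.closure_interior_eq_closure_of_nonempty_interior ⟨_, hmem⟩
  rintro z ⟨⟨h3, h4⟩, h5⟩
  rw [mem_leftEnd_convex] at h4
  rw [mem_rightEnd_convex] at h5
  rcases h3 with h3 | h3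
  · rw [mem_ofPred_eq] at h3
    refine closure_mono (interior_mono hTsub) (h2 ▸ subset_closure ⟨?_, ?_, ?_⟩) <;>
      rw [mem_ofPred_eq] <;> linarith
  · exact closure_mono (interior_mono hbump) (subset_closure_interior_bump h3)

lemma closure_sector : closure sector = region convex convex := by
  rw [sector_eq]
  refine Subset.antisymm (closure_minimal sdiff_subset isClosed_region_convex) ?_
  have hdense : Dense (sectorBoundaryᶜ) := by
    have := Measure.dense_of_ae (μ := (volume : Measure ℂ)) (p := fun z => z ∉ sectorBoundary)
      (measure_eq_zero_iff_ae_notMem.1 volume_sectorBoundary)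
    exact this
  have h1 := hdense.open_subset_closure_inter (isOpen_interior (s := region convex convex))
  refine subset_closure_interior_region.trans (closure_minimal (h1.trans ?_) isClosed_closure)
  exact closure_mono fun z hz => ⟨interior_subset hz.1, hz.2⟩

/-! ### The snowflake and its boundary -/

/-- The rotation about the centre by `k · 120°`. -/
noncomputable def spin (k : Fin 3) : ℂ → ℂ := rot center (2 * Real.pi * (k : ℕ) / 3)

lemma spin_zero (z : ℂ) : spin 0 z = z := by simp [spin, rot]

lemma exp_spin_one : Complex.exp ((2 * Real.pi * (1 : ℕ) / 3 : ℝ) * Complex.I) =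
    ⟨-1 / 2, √3 / 2⟩ := by
  have h : 2 * Real.pi * (1 : ℕ) / 3 = Real.pi - Real.pi / 3 := by push_cast; ring
  rw [h, Complex.exp_mul_I, ← Complex.ofReal_cos, ← Complex.ofReal_sin, Real.cos_pi_sub,
    Real.sin_pi_sub, Real.cos_pi_div_three, Real.sin_pi_div_three]
  apply Complex.ext <;> simp
  norm_num

lemma exp_spin_two : Complex.exp ((2 * Real.pi * (2 : ℕ) / 3 : ℝ) * Complex.I) =
    ⟨-1 / 2, -(√3 / 2)⟩ := by
  have h : 2 * Real.pi * (2 : ℕ) / 3 = Real.pi / 3 + Real.pi := by push_cast; ring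
  rw [h, Complex.exp_mul_I, ← Complex.ofReal_cos, ← Complex.ofReal_sin, Real.cos_add_pi,
    Real.sin_add_pi, Real.cos_pi_div_three, Real.sin_pi_div_three]
  apply Complex.ext <;> simp
  norm_num

lemma center_im : center.im = -√3 / 6 := by simp [center]; ring

@[simp] lemma spin_one_re (z : ℂ) : (spin 1 z).re = 1 / 2 - z.re / 2 - 3 / 2 * ht z := by
  have h : spin 1 z = center + ⟨-1 / 2, √3 / 2⟩ * (z - center) := by
    rw [← exp_spin_one]; rfl
  rw [h]
  simp [im_eq z, center_im]
  linear_combination (-(ht z) / 2 - 1 / 12) * sqrt_three_sq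

@[simp] lemma ht_spin_one (z : ℂ) : ht (spin 1 z) = -1 / 2 + z.re / 2 - ht z / 2 := by
  have h : spin 1 z = center + ⟨-1 / 2, √3 / 2⟩ * (z - center) := by
    rw [← exp_spin_one]; rfl
  rw [h, ht, div_eq_iff (by positivity)]
  simp [im_eq z, center_im]
  ring

@[simp] lemma spin_two_re (z : ℂ) : (spin 2 z).re = 1 - z.re / 2 + 3 / 2 * ht z := by
  have h : spin 2 z = center + ⟨-1 / 2, -(√3 / 2)⟩ * (z - center) := by
    rw [← exp_spin_two]; rfl
  rw [h]
  simp [im_eq z, center_im]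
  linear_combination ((ht z) / 2 + 1 / 12) * sqrt_three_sq

@[simp] lemma ht_spin_two (z : ℂ) : ht (spin 2 z) = -z.re / 2 - ht z / 2 := by
  have h : spin 2 z = center + ⟨-1 / 2, -(√3 / 2)⟩ * (z - center) := by
    rw [← exp_spin_two]; rfl
  rw [h, ht, div_eq_iff (by positivity)]
  simp [im_eq z, center_im]
  ring

lemma dist_spin (k : Fin 3) (z w : ℂ) : dist (spin k z) (spin k w) = dist z w := by
  have : spin k z - spin k w =
      Complex.exp ((2 * Real.pi * (k : ℕ) / 3 : ℝ) * Complex.I) * (z - w) := by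
    simp only [spin, rot]; ring
  rw [dist_eq_norm, this, norm_mul, Complex.norm_exp_ofReal_mul_I, one_mul, dist_eq_norm]

lemma spin_spin (j k : Fin 3) (z : ℂ) : spin j (spin k z) = spin (j + k) z := by
  have h1 : (1 : Fin 3) + 1 = 2 := rfl
  have h2 : (1 : Fin 3) + 2 = 0 := rfl
  have h3 : (2 : Fin 3) + 1 = 0 := rfl
  have h4 : (2 : Fin 3) + 2 = 1 := rfl
  fin_cases j <;> fin_cases k <;>
    simp only [Fin.mk_one, Fin.reduceFinMk, Fin.zero_eta, spin_zero, zero_add, add_zero, h1, h2, h3,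
      h4] <;>
    apply ext_ht <;> simp <;> ring

/-- The rotation by `k · 120°` as a homeomorphism. -/
noncomputable def spinHomeomorph (k : Fin 3) : ℂ ≃ₜ ℂ where
  toFun := spin k
  invFun := spin (-k)
  left_inv z := by rw [spin_spin, neg_add_cancel, spin_zero]
  right_inv z := by rw [spin_spin, add_neg_cancel, spin_zero]
  continuous_toFun := (Isometry.of_dist_eq (dist_spin k)).continuous
  continuous_invFun := (Isometry.of_dist_eq (dist_spin (-k))).continuous

lemma snowflake_eq : snowflake = ⋃ k, spin k '' region convex convex := by
  rw [← closure_sector]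
  change closure (⋃ k, spin k '' sector) = _
  rw [closure_iUnion_of_finite]
  exact iUnion_congr fun k => ((spinHomeomorph k).image_closure sector).symm

lemma mem_snowflake_iff {z : ℂ} :
    z ∈ snowflake ↔ ∃ k, ∃ w ∈ region convex convex, spin k w = z := by
  rw [snowflake_eq]; simp

lemma isClosed_snowflake : IsClosed snowflake := isClosed_closure

lemma spin_mem_snowflake {k : Fin 3} {z : ℂ} : spin k z ∈ snowflake ↔ z ∈ snowflake := by
  have h : ∀ (k : Fin 3) (z : ℂ), z ∈ snowflake → spin k z ∈ snowflake := by
    intro k z hz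
    obtain ⟨j, w, hw, rfl⟩ := mem_snowflake_iff.1 hz
    exact mem_snowflake_iff.2 ⟨k + j, w, hw, (spin_spin k j w).symm⟩
  refine ⟨fun hz => ?_, h k z⟩
  have := h (-k) _ hz
  rwa [spin_spin, neg_add_cancel, spin_zero] at this

lemma spin_image_snowflake (k : Fin 3) : spin k '' snowflake = snowflake := by
  ext z
  constructor
  · rintro ⟨w, hw, rfl⟩
    exact spin_mem_snowflake.2 hw
  · intro hz
    exact ⟨spin (-k) z, spin_mem_snowflake.2 hz, by rw [spin_spin, add_neg_cancel, spin_zero]⟩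

lemma spin_mem_frontier {k : Fin 3} {z : ℂ} (hz : z ∈ frontier snowflake) :
    spin k z ∈ frontier snowflake := by
  have h := (spinHomeomorph k).image_frontier snowflake
  have h2 : spinHomeomorph k '' snowflake = snowflake := spin_image_snowflake k
  rw [h2] at h
  rw [← h]
  exact ⟨z, hz, rfl⟩

lemma spin_mem_interior {k : Fin 3} {z : ℂ} (hz : z ∈ interior snowflake) :
    spin k z ∈ interior snowflake := by
  have h := (spinHomeomorph k).image_interior snowflake
  have h2 : spinHomeomorph k '' snowflake = snowflake := spin_image_snowflake k
  rw [h2] at h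
  rw [← h]
  exact ⟨z, hz, rfl⟩

lemma region_subset_snowflake : region convex convex ⊆ snowflake := fun z hz =>
  mem_snowflake_iff.2 ⟨0, z, hz, spin_zero z⟩

lemma fin_three_cases (k : Fin 3) : k = 0 ∨ k = 1 ∨ k = 2 := by
  fin_cases k <;> simp

/-- The points of the hull above the curve come arbitrarily close to each point of the curve, and
those inside the hull do not belong to the snowflake. -/
lemma kochCurve_subset_frontier : kochCurve ⊆ frontier snowflake := by
  set P : Set ℂ := {z | 0 < ht z ∧ 3 * ht z < z.re ∧ 3 * ht z < 1 - z.re ∧ z ∉ bump} with hP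
  have hPhull : P ⊆ hull := fun z hz => ⟨hz.1.le, hz.2.1.le, hz.2.2.1.le⟩
  have hne : P.Nonempty := by
    refine ⟨pt (1 / 4) (1 / 18), ?_, ?_, ?_, not_mem_bump_of_gap ?_ ?_⟩ <;> simp <;> norm_num
  have hpsi : ∀ i, ∀ z ∈ P, psi i z ∈ P := by
    intro i z hz
    have hn : psi i z ∉ bump := fun h => hz.2.2.2 (mem_bump_of_psi_mem i (hPhull hz) h)
    obtain ⟨a, b, c, -⟩ := hz
    refine ⟨?_, ?_, ?_, hn⟩ <;> fin_cases i <;> simp <;> linarith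
  have hout : P ⊆ snowflakeᶜ := by
    rintro z ⟨a, b, c, hz⟩ hmem
    obtain ⟨k, w, ⟨⟨h1, h2⟩, h3⟩, rfl⟩ := mem_snowflake_iff.1 hmem
    rw [mem_leftEnd_convex] at h2
    rw [mem_rightEnd_convex] at h3
    rcases fin_three_cases k with rfl | rfl | rfl
    · rw [spin_zero] at a hz
      rcases h1 with h1 | h1
      · rw [mem_ofPred_eq] at h1; linarith
      · exact hz h1
    · simp at a b c; linarith
    · simp at a b c; linarith
  have hF := kochCurve_subset_closure hne (isBounded_hull.subset hPhull) hpsi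
  intro z hz
  rw [frontier_eq_closure_inter_closure]
  refine ⟨subset_closure (region_subset_snowflake ?_), closure_mono hout (hF hz)⟩
  obtain ⟨a, b, c⟩ := kochCurve_subset_hull hz
  refine ⟨⟨Or.inr (kochCurve_subset_bump hz), ?_⟩, ?_⟩
  · rw [mem_leftEnd_convex]; linarith
  · rw [mem_rightEnd_convex]; linarith

/-- The big triangle of the snowflake consists of the three triangles below the Koch curves. -/
lemma mem_snowflake_of_triangle {z : ℂ} (h1 : ht z ≤ 0) (h2 : 0 ≤ z.re + ht z)
    (h3 : 0 ≤ 1 - z.re + ht z) : z ∈ snowflake := by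
  have key : ∀ w : ℂ, ht w ≤ 0 → 0 ≤ w.re + 3 * ht w → 0 ≤ 1 - w.re + 3 * ht w →
      w ∈ snowflake := fun w a b c => region_subset_snowflake ⟨⟨Or.inl a, b⟩, c⟩
  by_cases h4 : 0 ≤ z.re + 3 * ht z ∧ 0 ≤ 1 - z.re + 3 * ht z
  · exact key z h1 h4.1 h4.2
  by_cases h5 : z.re ≤ 1 / 2
  · have h6 : z.re + 3 * ht z ≤ 0 := by
      by_contra! h
      exact h4 ⟨h.le, by linarith⟩
    refine (spin_mem_snowflake (k := 2)).1 (key _ ?_ ?_ ?_) <;> simp <;> linarith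
  · have h6 : 1 - z.re + 3 * ht z ≤ 0 := by
      by_contra! h
      exact h4 ⟨by linarith, h.le⟩
    refine (spin_mem_snowflake (k := 1)).1 (key _ ?_ ?_ ?_) <;> simp <;> linarith

lemma region_diff_subset_interior_snowflake {z : ℂ} (hz : z ∈ region convex convex)
    (hF : z ∉ kochCurve) : z ∈ interior snowflake := by
  by_cases hb : z ∈ sectorBoundary
  · obtain ⟨hne0, hne1⟩ := ne_of_not_mem_kochCurve hF
    have ho : IsOpen {z : ℂ | ht z < 0 ∧ 0 < z.re + ht z ∧ 0 < 1 - z.re + ht z} := by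
      simp only [ofPred_and]
      refine IsOpen.inter ?_ (IsOpen.inter ?_ ?_) <;> apply isOpen_lt <;> fun_prop
    refine interior_maximal (fun w hw => mem_snowflake_of_triangle hw.1.le hw.2.1.le hw.2.2.le) ho
      ?_
    rcases hb with (hb | hb) | hb
    · exact absurd hb hF
    · obtain ⟨h1, h2, h3⟩ := mem_segment_zero_iff.1 hb
      have h4 : ht z < 0 := lt_of_le_of_ne h2 fun h => hne0 ⟨by linarith, h⟩
      exact ⟨h4, by linarith, by linarith⟩
    · obtain ⟨h1, h2, h3⟩ := mem_segment_one_iff.1 hb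
      have h4 : ht z < 0 := lt_of_le_of_ne h2 fun h => hne1 ⟨by linarith, h⟩
      exact ⟨h4, by linarith, by linarith⟩
  · exact interior_mono region_subset_snowflake (region_diff_subset_interior ⟨hz, hb⟩)

/-- The boundary of the snowflake consists of three Koch curves. -/
lemma mem_frontier_iff {z : ℂ} :
    z ∈ frontier snowflake ↔ ∃ k, ∃ w ∈ kochCurve, spin k w = z := by
  constructor
  · intro hz
    have hzK : z ∈ snowflake := isClosed_snowflake.frontier_subset hz
    obtain ⟨k, w, hw, rfl⟩ := mem_snowflake_iff.1 hzK
    refine ⟨k, w, ?_, rfl⟩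
    by_contra h
    exact hz.2 (spin_mem_interior (region_diff_subset_interior_snowflake hw h))
  · rintro ⟨k, w, hw, rfl⟩
    exact spin_mem_frontier (kochCurve_subset_frontier hw)

/-- The two other Koch curves are mirror images of the first one in the lines that bound its sector,
so that they are not closer to a point of this sector. -/
lemma infDist_frontier {z : ℂ} (h1 : 0 ≤ z.re + 3 * ht z) (h2 : 0 ≤ 1 - z.re + 3 * ht z) :
    Metric.infDist z (frontier snowflake) = Metric.infDist z kochCurve := by
  apply le_antisymm
  · exact Metric.infDist_le_infDist_of_subset kochCurve_subset_frontier kochCurve_nonempty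
  · refine (Metric.le_infDist (kochCurve_nonempty.mono kochCurve_subset_frontier)).2 ?_
    intro y hy
    obtain ⟨k, w, hw, rfl⟩ := mem_frontier_iff.1 hy
    obtain ⟨a, b, c⟩ := kochCurve_subset_hull hw
    rcases fin_three_cases k with rfl | rfl | rfl
    · rw [spin_zero]
      exact Metric.infDist_le_dist_of_mem hw
    · refine (Metric.infDist_le_dist_of_mem (mirror_mem_kochCurve hw)).trans ?_
      rw [dist_le_dist_iff]
      simp
      nlinarith [mul_nonneg h1 (show 0 ≤ 1 - w.re + 3 * ht w by linarith)]
    · refine (Metric.infDist_le_dist_of_mem (mirror_mem_kochCurve hw)).trans ?_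
      rw [dist_le_dist_iff]
      simp
      nlinarith [mul_nonneg h2 (show 0 ≤ w.re + 3 * ht w by linarith)]

lemma infDist_spin (k : Fin 3) (z : ℂ) :
    Metric.infDist (spin k z) (frontier snowflake) = Metric.infDist z (frontier snowflake) := by
  have hne := kochCurve_nonempty.mono kochCurve_subset_frontier
  have h : ∀ (k : Fin 3) (z : ℂ),
      Metric.infDist (spin k z) (frontier snowflake) ≤ Metric.infDist z (frontier snowflake) := by
    intro k z
    refine (Metric.le_infDist hne).2 fun y hy => ?_
    rw [← dist_spin k]
    exact Metric.infDist_le_dist_of_mem (spin_mem_frontier hy)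
  refine le_antisymm (h k z) ?_
  have := h (-k) (spin k z)
  rwa [spin_spin, neg_add_cancel, spin_zero] at this

/-- In one of the three sectors, the inner neighbourhood of the snowflake is the strip along an edge
between two convex corners. -/
lemma inner_eq (e : ℝ) : inner e = ⋃ k, spin k '' strip convex convex e := by
  ext z
  simp only [mem_iUnion]
  constructor
  · rintro ⟨h1, h2⟩
    obtain ⟨k, w, hw, rfl⟩ := mem_snowflake_iff.1 h1
    rw [infDist_spin, infDist_frontier hw.1.2 hw.2] at h2
    exact ⟨k, w, ⟨hw, mem_nbhd_iff.2 h2⟩, rfl⟩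
  · rintro ⟨k, w, ⟨hw, h2⟩, rfl⟩
    refine ⟨mem_snowflake_iff.2 ⟨k, w, hw, rfl⟩, ?_⟩
    rw [infDist_spin, infDist_frontier hw.1.2 hw.2]
    exact mem_nbhd_iff.1 h2

lemma isClosed_nbhd (e : ℝ) : IsClosed (nbhd e) := by
  have : nbhd e = {z | Metric.infDist z kochCurve ≤ e} := by
    ext z; exact mem_nbhd_iff
  rw [this]
  exact isClosed_le (Metric.continuous_infDist_pt _) continuous_const

lemma volume_real_inner (e : ℝ) :
    volume.real (inner e) = 3 * volume.real (strip convex convex e) := by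
  have hclosed : IsClosed (strip convex convex e) := isClosed_region_convex.inter (isClosed_nbhd e)
  have hspin : ∀ k, volume.real (spin k '' strip convex convex e) =
      volume.real (strip convex convex e) := by
    intro k
    rw [volume_real_image_of_dist one_pos (fun x y => by rw [dist_spin, one_mul])]
    simp
  have h01 : volume (spin 0 '' strip convex convex e ∩ spin 1 '' strip convex convex e) = 0 := by
    refine measure_mono_null ?_ (volume_line (a := 1) (b := 3) (by norm_num) 0)
    rintro _ ⟨⟨w, ⟨⟨⟨-, h1⟩, h2⟩, -⟩, rfl⟩, ⟨v, ⟨⟨⟨-, h3⟩, h4⟩, -⟩, h5⟩⟩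
    rw [mem_leftEnd_convex] at h1 h3
    rw [mem_rightEnd_convex] at h2 h4
    rw [spin_zero] at h5 ⊢
    rw [mem_ofPred_eq]
    rw [← h5] at h1 h2 ⊢
    simp at h1 h2 ⊢
    linarith
  have h02 : volume (spin 0 '' strip convex convex e ∩ spin 2 '' strip convex convex e) = 0 := by
    refine measure_mono_null ?_ (volume_line (a := 1) (b := -3) (by norm_num) 1)
    rintro _ ⟨⟨w, ⟨⟨⟨-, h1⟩, h2⟩, -⟩, rfl⟩, ⟨v, ⟨⟨⟨-, h3⟩, h4⟩, -⟩, h5⟩⟩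
    rw [mem_leftEnd_convex] at h1 h3
    rw [mem_rightEnd_convex] at h2 h4
    rw [spin_zero] at h5 ⊢
    rw [mem_ofPred_eq]
    rw [← h5] at h1 h2 ⊢
    simp at h1 h2 ⊢
    linarith
  have h12 : volume (spin 1 '' strip convex convex e ∩ spin 2 '' strip convex convex e) = 0 := by
    refine measure_mono_null ?_ (volume_line (a := 1) (b := 0) (by norm_num) (1 / 2))
    rintro _ ⟨⟨w, ⟨⟨⟨-, h1⟩, h2⟩, -⟩, rfl⟩, ⟨v, ⟨⟨⟨-, h3⟩, h4⟩, -⟩, h5⟩⟩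
    rw [mem_leftEnd_convex] at h1 h3
    rw [mem_rightEnd_convex] at h2 h4
    have h6 := congrArg Complex.re h5
    have h7 := congrArg ht h5
    rw [mem_ofPred_eq]
    simp at h6 h7 ⊢
    linarith
  have hd : Pairwise (Function.onFun (AEDisjoint volume)
      fun k => spin k '' strip convex convex e) := by
    intro j k hjk
    rcases fin_three_cases j with rfl | rfl | rfl <;> rcases fin_three_cases k with rfl | rfl | rfl
    · exact absurd rfl hjk
    · exact h01
    · exact h02
    · exact AEDisjoint.symm h01
    · exact absurd rfl hjk
    · exact h12
    · exact AEDisjoint.symm h02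
    · exact AEDisjoint.symm h12
    · exact absurd rfl hjk
  have hm : ∀ k, NullMeasurableSet (spin k '' strip convex convex e) volume := fun k =>
    ((spinHomeomorph k).isClosedMap _ hclosed).measurableSet.nullMeasurableSet
  have hfin : ∀ k, volume (spin k '' strip convex convex e) ≠ ⊤ := by
    intro k
    refine (Bornology.IsBounded.measure_lt_top ?_).ne
    exact (LipschitzWith.of_dist_le_mul (K := 1) (f := spin k) fun x y => by
      rw [dist_spin]; simp).isBounded_image (isBounded_region_convex.subset inter_subset_left)
  rw [inner_eq, measureReal_def, measure_iUnion₀ hd hm, tsum_fintype,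
    ENNReal.toReal_sum fun k _ => hfin k]
  simp only [← measureReal_def, hspin]
  simp

/-! ### The triangle `Γ` -/

lemma mem_triangle_iff {z : ℂ} :
    z ∈ triangle ↔ z.re ≤ 1 / 3 ∧ 3 * ht z ≤ z.re - 1 / 3 ∧ 0 ≤ z.re + 3 * ht z := by
  have hA : (1 / 18 : ℝ) * (⟨3, -√3⟩ : ℂ) = pt (1 / 6) (-1 / 18) := by
    apply ext_ht
    · simp; norm_num
    · rw [ht_real_mul, ht_pt]; simp [ht]; norm_num
  have hB : (1 / 9 : ℝ) * (⟨3, -√3⟩ : ℂ) = pt (1 / 3) (-1 / 9) := by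
    apply ext_ht
    · simp; norm_num
    · rw [ht_real_mul, ht_pt]; simp [ht]; norm_num
  have hC : (1 / 3 : ℝ) * (⟨1, 0⟩ : ℂ) = pt (1 / 3) 0 := by
    apply ext_ht
    · simp
    · rw [ht_real_mul, ht_pt]; simp [ht]
  rw [triangle, hA, hB, hC]
  constructor
  · intro hz
    have hconv : Convex ℝ ({z : ℂ | 1 * z.re + 0 * ht z ≤ 1 / 3} ∩
        ({z : ℂ | (-1) * z.re + 3 * ht z ≤ -1 / 3} ∩ {z : ℂ | (-1) * z.re + (-3) * ht z ≤ 0})) :=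
      (convex_halfPlane _ _ _).inter ((convex_halfPlane _ _ _).inter (convex_halfPlane _ _ _))
    have h := convexHull_min ?_ hconv hz
    · obtain ⟨h1, h2, h3⟩ := h
      rw [mem_ofPred_eq] at h1 h2 h3
      exact ⟨by linarith, by linarith, by linarith⟩
    · rintro w (rfl | rfl | rfl) <;> refine ⟨?_, ?_, ?_⟩ <;> simp <;> norm_num
  · rintro ⟨h1, h2, h3⟩
    -- The barycentric coordinates of the point.
    have h := (convex_convexHull ℝ ({pt (1 / 6) (-1 / 18), pt (1 / 3) (-1 / 9), pt (1 / 3) 0} :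
      Set ℂ)).sum_mem (t := Finset.univ)
      (w := ![6 * (1 / 3 - z.re), 3 * (z.re - 1 / 3 - 3 * ht z), 3 * (z.re + 3 * ht z)])
      (z := ![pt (1 / 6) (-1 / 18), pt (1 / 3) (-1 / 9), pt (1 / 3) 0])
      (by
        intro i _
        fin_cases i <;> simp <;> linarith)
      (by simp [Fin.sum_univ_three]; ring)
      (by
        intro i _
        apply subset_convexHull
        fin_cases i <;> simp)
    convert h using 1
    rw [Fin.sum_univ_three]
    apply ext_ht
    · simp only [Matrix.cons_val_zero, Matrix.cons_val_one, Matrix.cons_val, Complex.add_re,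
        Complex.smul_re, pt_re, smul_eq_mul]
      ring
    · simp only [Matrix.cons_val_zero, Matrix.cons_val_one, Matrix.cons_val, ht_add, ht_smul, ht_pt]
      ring

lemma triangleArea_eq (e : ℝ) : triangleArea e = volume.real (cornerPart (3 * e)) / 9 := by
  rw [triangleArea, ← volume_real_mirror_image (cornerPart (3 * e)), ← volume_real_psi_image 0]
  congr 1
  have key : ∀ z : ℂ, z.re ≤ 1 / 3 → 3 * ht z ≤ z.re - 1 / 3 → 0 ≤ z.re + 3 * ht z →
      (z ∈ inner e ↔ z ∈ nbhd e) := by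
    intro z h1 h2 h3
    have hz : z ∈ snowflake := region_subset_snowflake ⟨⟨Or.inl (by
      rw [mem_ofPred_eq]; linarith), h3⟩, by rw [mem_rightEnd_convex]; linarith⟩
    rw [mem_nbhd_iff, ← infDist_frontier h3 (by linarith)]
    exact ⟨fun h => h.2, fun h => ⟨hz, h⟩⟩
  ext z
  rw [mem_inter_iff, mem_triangle_iff]
  constructor
  · rintro ⟨h0, h1, h2, h3⟩
    obtain ⟨w, rfl⟩ := psi_surjective 0 z
    have h4 := (psi_zero_mem_nbhd_iff (by linarith) (by linarith)).1 ((key _ h1 h2 h3).1 h0)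
    simp at h1 h2 h3
    refine ⟨w, ⟨mirror w, ⟨⟨?_, ?_, ?_⟩, mirror_mem_nbhd h4⟩, mirror_mirror w⟩, rfl⟩ <;> simp <;>
      linarith
  · rintro ⟨_, ⟨w, ⟨⟨h1, h2, h3⟩, h4⟩, rfl⟩, rfl⟩
    have h5 : (psi 0 (mirror w)).re ≤ 1 / 3 ∧
        3 * ht (psi 0 (mirror w)) ≤ (psi 0 (mirror w)).re - 1 / 3 ∧
        0 ≤ (psi 0 (mirror w)).re + 3 * ht (psi 0 (mirror w)) := by
      refine ⟨?_, ?_, ?_⟩ <;> simp <;> linarith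
    exact ⟨(key _ h5.1 h5.2.1 h5.2.2).2 (psi_mem_nbhd 0 (mirror_mem_nbhd h4)), h5⟩

/-! ### Continuity -/

lemma volume_real_ball (x : ℂ) {r : ℝ} (hr : 0 ≤ r) :
    volume.real (Metric.ball x r) = Real.pi * r ^ 2 := by
  rw [measureReal_def, Complex.volume_ball, ENNReal.toReal_mul, ENNReal.toReal_pow,
    ENNReal.toReal_ofReal hr, ENNReal.coe_toReal, NNReal.coe_real_pi, mul_comm]

lemma volume_real_closedBall (x : ℂ) {r : ℝ} (hr : 0 ≤ r) :
    volume.real (Metric.closedBall x r) = Real.pi * r ^ 2 := by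
  rw [measureReal_def, Complex.volume_closedBall, ENNReal.toReal_mul, ENNReal.toReal_pow,
    ENNReal.toReal_ofReal hr, ENNReal.coe_toReal, NNReal.coe_real_pi, mul_comm]

/-- The set of the points that have a given positive distance from a closed set is a null set: close
to each of its points, a fixed proportion of each disc is nearer to the closed set, so that no point
of the set is a density point. -/
lemma volume_infDist_eq {A : Set ℂ} (hA : IsClosed A) (hne : A.Nonempty) {r : ℝ} (hr : 0 < r) :
    volume {z | Metric.infDist z A = r} = 0 := by
  set S := {z | Metric.infDist z A = r} with hS
  have hSm : MeasurableSet S :=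
    (isClosed_eq (Metric.continuous_infDist_pt A) continuous_const).measurableSet
  have hae := Besicovitch.ae_tendsto_measure_inter_div (volume : Measure ℂ) S
  have hfalse : ∀ᵐ x ∂(volume : Measure ℂ).restrict S, False := by
    filter_upwards [hae, ae_restrict_mem hSm] with x hx hxS
    obtain ⟨y, hy, hxy⟩ := hA.exists_infDist_eq_dist hne x
    rw [show Metric.infDist x A = r from hxS] at hxy
    have hbound : ∀ᶠ δ in 𝓝[>] (0 : ℝ),
        volume (S ∩ Metric.closedBall x δ) / volume (Metric.closedBall x δ) ≤
          ENNReal.ofReal (3 / 4) := by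
      filter_upwards [Ioo_mem_nhdsGT hr] with δ hδ
      obtain ⟨h0, h1⟩ := hδ
      -- The disc of radius `δ / 2` whose centre is on the way from `x` to its nearest point.
      set c : ℂ := x + ((δ / (2 * r) : ℝ) : ℂ) * (y - x) with hc
      have hcx : dist c x = δ / 2 := by
        rw [dist_eq_norm, hc, add_sub_cancel_left, norm_mul, Complex.norm_real, ← dist_eq_norm,
          dist_comm y x, ← hxy, Real.norm_of_nonneg (by positivity)]
        field_simp
      have hcy : dist c y = r - δ / 2 := by
        have : c - y = ((1 - δ / (2 * r) : ℝ) : ℂ) * (x - y) := by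
          rw [hc]; push_cast; ring
        have h2 : δ / (2 * r) ≤ 1 := by rw [div_le_one (by positivity)]; linarith
        rw [dist_eq_norm, this, norm_mul, Complex.norm_real, ← dist_eq_norm x y, ← hxy,
          Real.norm_of_nonneg (by linarith)]
        field_simp
      have hsub : S ∩ Metric.closedBall x δ ⊆ Metric.closedBall x δ \ Metric.ball c (δ / 2) := by
        rintro p ⟨hpS, hp⟩
        refine ⟨hp, fun hpc => ?_⟩
        have h2 := Metric.infDist_le_dist_of_mem (x := p) hy
        rw [show Metric.infDist p A = r from hpS] at h2
        have h3 := dist_triangle p c y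
        rw [Metric.mem_ball] at hpc
        linarith
      have hball : Metric.ball c (δ / 2) ⊆ Metric.closedBall x δ := by
        intro p hp
        rw [Metric.mem_ball] at hp
        rw [Metric.mem_closedBall]
        linarith [dist_triangle p c x]
      have hfin : volume (Metric.closedBall x δ) ≠ ⊤ := measure_closedBall_lt_top.ne
      have hreal : volume.real (S ∩ Metric.closedBall x δ) ≤
          3 / 4 * volume.real (Metric.closedBall x δ) := by
        have h2 := measureReal_mono (μ := volume) hsub
          (measure_ne_top_of_subset sdiff_subset hfin)
        rw [measureReal_sdiff hball Metric.isOpen_ball.measurableSet, volume_real_ball _ (by linarith),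
          volume_real_closedBall _ h0.le] at h2
        rw [volume_real_closedBall _ h0.le]
        linarith
      refine ENNReal.div_le_of_le_mul ?_
      rw [← ofReal_measureReal (measure_ne_top_of_subset inter_subset_right hfin),
        ← ofReal_measureReal hfin, ← ENNReal.ofReal_mul (by norm_num)]
      exact ENNReal.ofReal_le_ofReal hreal
    have hle := le_of_tendsto hx hbound
    rw [← ENNReal.ofReal_one, ENNReal.ofReal_le_ofReal_iff (by norm_num)] at hle
    norm_num at hle
  rw [Filter.eventually_false_iff_eq_bot, ae_eq_bot, Measure.restrict_eq_zero] at hfalse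
  exact hfalse

lemma isBounded_snowflake : Bornology.IsBounded snowflake := by
  rw [snowflake_eq]
  refine (Bornology.isBounded_iUnion).2 fun k => ?_
  exact (LipschitzWith.of_dist_le_mul (K := 1) (f := spin k) fun x y => by
    rw [dist_spin]; simp).isBounded_image isBounded_region_convex

lemma continuousOn_volume_real_inner :
    ContinuousOn (fun ε : ℝ => volume.real (inner ε)) (Ioi 0) := by
  intro ε hε
  refine ContinuousAt.continuousWithinAt ?_
  have hm : ∀ ε, MeasurableSet (inner ε) := fun ε =>
    (isClosed_snowflake.inter
      (isClosed_le (Metric.continuous_infDist_pt _) continuous_const)).measurableSet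
  have hfin : volume snowflake ≠ ⊤ := isBounded_snowflake.measure_lt_top.ne
  have hsub : ∀ ε, inner ε ⊆ snowflake := fun ε z hz => hz.1
  have hnull := volume_infDist_eq (isClosed_frontier (s := snowflake))
    (kochCurve_nonempty.mono kochCurve_subset_frontier) hε
  have h : Filter.Tendsto (fun ε => volume (inner ε)) (𝓝 ε) (𝓝 (volume (inner ε))) := by
    refine tendsto_measure_of_ae_tendsto_indicator _ (hm ε) hm isClosed_snowflake.measurableSet hfin
      (Filter.Eventually.of_forall hsub) ?_
    filter_upwards [measure_eq_zero_iff_ae_notMem.1 hnull] with z hz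
    have hz' : Metric.infDist z (frontier snowflake) ≠ ε := hz
    rcases lt_or_gt_of_ne hz' with hlt | hgt
    · filter_upwards [lt_mem_nhds hlt] with δ hδ
      exact ⟨fun h => ⟨h.1, hlt.le⟩, fun h => ⟨h.1, le_of_lt hδ⟩⟩
    · filter_upwards [gt_mem_nhds hgt] with δ hδ
      exact ⟨fun h => absurd h.2 (not_le.2 hδ), fun h => absurd h.2 (not_le.2 hgt)⟩
  exact (ENNReal.tendsto_toReal (measure_ne_top_of_subset (hsub ε) hfin)).comp h

/-! ### The formula -/

lemma volume_real_half_middle :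
    volume.real {z : ℂ | 0 ≤ z.re ∧ z.re + 3 * ht z ≤ 0 ∧ 0 ≤ 1 - z.re + 3 * ht z} = √3 / 12 := by
  have h3 : (0 : ℝ) < √3 := by positivity
  have h := volume_real_between (a := 0) (b := 1 / 2) (by norm_num)
    (f := fun x => √3 * ((x - 1) / 3)) (g := fun x => √3 * (-x / 3)) (by fun_prop) (by fun_prop)
    (fun x hx => mul_le_mul_of_nonneg_left (by linarith [hx.2]) h3.le)
  have h2 : ∫ x in (0 : ℝ)..(1 / 2), (√3 * (-x / 3) - √3 * ((x - 1) / 3)) = √3 / 12 := by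
    have h4 : ∀ x : ℝ, √3 * (-x / 3) - √3 * ((x - 1) / 3) = √3 / 3 * (1 - 2 * x) := fun x => by ring
    simp_rw [h4]
    rw [intervalIntegral.integral_const_mul, intervalIntegral.integral_sub (by simp)
      (Continuous.intervalIntegrable (by fun_prop) _ _), intervalIntegral.integral_const_mul,
      integral_id, intervalIntegral.integral_const]
    simp
    ring
  rw [← h2, ← h]
  congr 1
  ext z
  simp only [mem_ofPred_eq, im_eq z, mul_le_mul_iff_right₀ h3]
  constructor
  · rintro ⟨p, q, r⟩; exact ⟨⟨p, by linarith⟩, by linarith, by linarith⟩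
  · rintro ⟨⟨p, q⟩, r, t⟩; exact ⟨p, by linarith, by linarith⟩

/-- Beyond the circumradius of `Γ`, all of `Γ` belongs to the inner neighbourhood. -/
lemma triangleArea_of_le {e : ℝ} (he : √3 / 9 ≤ e) : triangleArea e = √3 / 108 := by
  have h3 : (0 : ℝ) < √3 := by positivity
  have hs : √3 ^ 2 = 3 := Real.sq_sqrt (by norm_num)
  rw [triangleArea_eq, ← show √3 / 12 / 9 = √3 / 108 by ring, ← volume_real_half_middle, cornerPart]
  congr 2
  refine inter_eq_left.2 fun z hz => ?_
  obtain ⟨h1, h2, h4⟩ := hz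
  refine ⟨0, zero_mem_kochCurve, ?_⟩
  rw [dist_le_iff (by linarith)]
  simp
  have h5 : 1 / 3 ≤ (3 * e) ^ 2 := by nlinarith
  nlinarith [mul_nonneg h1 (neg_nonneg.2 h2)]

/-- The contributions of the `3 · 4^(m+1)` edges and of the `2 · (4^(m+1) - 1)` reentrant corners of
the polygon of side length `3^(-m-1)`. -/
lemma volume_real_inner_pow (m : ℕ) {e : ℝ} (he0 : 1 / 3 ≤ e) (he : e ≤ 1) :
    volume.real (inner (e / 3 ^ (m + 1))) =
      (3 * 4 ^ (m + 1) * (2 * √3 / 15 + 9 * triangleArea (e / 3) - volume.real (wedgeTip e)) +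
        81 * (4 ^ (m + 1) - 4) * triangleArea (e / 9) +
        (4 ^ (m + 1) - 1) * (Real.pi * e ^ 2 / 3)) / 9 ^ (m + 1) := by
  have h1 : volume.real (cornerPart e) = 9 * triangleArea (e / 3) := by
    rw [triangleArea_eq, show 3 * (e / 3) = e by ring]; ring
  have h2 : volume.real (cornerPart (e / 3)) = 9 * triangleArea (e / 9) := by
    rw [triangleArea_eq, show 3 * (e / 9) = e / 3 by ring]; ring
  have h3 := volume_real_cornerPart_div_three he
  have h4 : 2 * volume.real (shadow e) =
      81 * triangleArea (e / 9) + 9 * triangleArea (e / 3) - volume.real (wedgeTip e) := by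
    rw [h1, h2] at h3
    linarith
  rw [volume_real_inner, volume_real_strip_convex_convex_pow m (by linarith) he,
    volume_real_strip_convex_reentrant_of_le he0, volume_real_strip_reentrant_reentrant_of_le he0,
    h4, h1, volume_real_wedge (by linarith)]
  ring

lemma volume_real_inner_of_gt {ε : ℝ} (h : 1 / 3 < ε) :
    volume.real (inner ε) = 2 * √3 / 5 := by
  rw [volume_real_inner, volume_real_strip_convex_convex_of_le h.le]
  ring

lemma inv_sqrt_three : 1 / √3 = √3 / 3 := by
  rw [div_eq_div_iff (by positivity) (by norm_num), one_mul, sqrt_three_sq]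

lemma volume_real_inner_first {ε : ℝ} (h1 : √3 / 9 < ε) (h2 : ε ≤ 1 / 3) :
    volume.real (inner ε) =
      7 * √3 / 30 + √(ε ^ 2 - 1 / 36) + 6 * ε ^ 2 * Real.arcsin (1 / (6 * ε))
        - Real.pi * ε ^ 2 := by
  have hs : 1 < √3 := by
    rw [Real.lt_sqrt (by norm_num)]; norm_num
  have h := volume_real_inner_pow 0 (e := 3 * ε) (by linarith) (by linarith)
  rw [volume_real_wedgeTip (by rw [inv_sqrt_three]; linarith) (by linarith),
    show 3 * ε / 3 = ε by ring, triangleArea_of_le h1.le, zero_add, pow_one, pow_one, pow_one,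
    show 3 * ε / 3 = ε by ring,
    show (3 * ε) ^ 2 - 1 / 4 = 3 ^ 2 * (ε ^ 2 - 1 / 36) by ring,
    Real.sqrt_mul (by norm_num), Real.sqrt_sq (by norm_num), show 2 * (3 * ε) = 6 * ε by ring] at h
  rw [h]
  ring

lemma volume_real_inner_second {ε : ℝ} (h1 : 1 / 9 < ε) (h2 : ε ≤ √3 / 9) :
    volume.real (inner ε) =
      8 * √3 / 45 + Real.pi * ε ^ 2 + 12 * volume.real (inner ε ∩ triangle) := by
  have hs : √3 < 2 := by
    rw [Real.sqrt_lt' (by norm_num)]; norm_num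
  have h := volume_real_inner_pow 0 (e := 3 * ε) (by linarith) (by linarith)
  rw [volume_real_wedgeTip_of_le (by rw [inv_sqrt_three]; linarith),
    zero_add, pow_one, pow_one, pow_one, show 3 * ε / 3 = ε by ring] at h
  rw [h, triangleArea]
  ring

/-- With `t = alpha ε` and `e = 3^(-t)`, the number `ε` is `e / 3^(m+1)`, where `m + 1 ≥ 2` is the
integer part of `-log ε / log 3`. -/
lemma exists_scale {ε : ℝ} (h0 : 0 < ε) (h1 : ε ≤ 1 / 9) :
    ∃ (m : ℕ) (e : ℝ), e = (3 : ℝ) ^ (-alpha ε) ∧ ε = e / 3 ^ (m + 1) ∧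
      (9 / 4 : ℝ) ^ alpha ε * ε ^ (2 - Real.log 4 / Real.log 3) = 4 ^ (m + 1) / 9 ^ (m + 1) ∧
      (1 / 4 : ℝ) ^ alpha ε * ε ^ (2 - Real.log 4 / Real.log 3) =
        4 ^ (m + 1) * e ^ 2 / 9 ^ (m + 1) ∧
      (9 : ℝ) ^ alpha ε * ε ^ 2 = 1 / 9 ^ (m + 1) := by
  have hl3 : 0 < Real.log 3 := Real.log_pos (by norm_num)
  have hl9 : Real.log 9 = 2 * Real.log 3 := by
    rw [show (9 : ℝ) = 3 ^ 2 by norm_num, Real.log_pow]; norm_num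
  set x : ℝ := -(Real.log ε / Real.log 3) with hx
  have hx2 : 2 ≤ x := by
    have h2 := Real.log_le_log h0 h1
    rw [one_div, Real.log_inv, hl9] at h2
    rw [hx, ← neg_div, le_div_iff₀ hl3]
    linarith
  have hfl : 2 ≤ ⌊x⌋ := Int.le_floor.2 (by exact_mod_cast hx2)
  obtain ⟨n, hn⟩ := Int.eq_ofNat_of_zero_le (show 0 ≤ ⌊x⌋ by omega)
  obtain ⟨m, rfl⟩ : ∃ m, n = m + 1 := ⟨n - 1, by omega⟩
  have halpha : alpha ε = x - (m + 1 : ℕ) := by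
    have h2 := Int.self_sub_floor x
    rw [hn] at h2
    rw [alpha, ← hx, ← h2]
    norm_cast
  set t := alpha ε with ht
  have hlog : Real.log ε = -(Real.log 3 * (t + (m + 1 : ℕ))) := by
    rw [halpha, sub_add_cancel, hx]
    field_simp
  have hpow : ∀ a : ℝ, 0 < a → a ^ (m + 1) = Real.exp (Real.log a * (m + 1 : ℕ)) := by
    intro a ha
    rw [mul_comm, Real.exp_nat_mul, Real.exp_log ha]
  have hε : ε = Real.exp (-(Real.log 3 * (t + (m + 1 : ℕ)))) := by rw [← hlog, Real.exp_log h0]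
  have hεp : ε ^ (2 - Real.log 4 / Real.log 3) =
      Real.exp (-((2 * Real.log 3 - Real.log 4) * (t + (m + 1 : ℕ)))) := by
    rw [Real.rpow_def_of_pos h0, hlog]
    congr 1
    field_simp
  have he : (3 : ℝ) ^ (-t) = Real.exp (Real.log 3 * -t) := Real.rpow_def_of_pos (by norm_num) _
  have hε2 : ε ^ 2 = Real.exp (2 * -(Real.log 3 * (t + (m + 1 : ℕ)))) := by
    rw [two_mul, Real.exp_add, ← hε, sq]
  refine ⟨m, (3 : ℝ) ^ (-t), rfl, ?_, ?_, ?_, ?_⟩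
  · rw [he, hpow 3 (by norm_num), ← Real.exp_sub, hε]
    congr 1
    ring
  · rw [hεp, hpow 4 (by norm_num), hpow 9 (by norm_num), ← Real.exp_sub,
      Real.rpow_def_of_pos (by norm_num), ← Real.exp_add, Real.log_div (by norm_num) (by norm_num),
      hl9]
    congr 1
    ring
  · rw [hεp, hpow 4 (by norm_num), hpow 9 (by norm_num), he, sq, ← Real.exp_add, ← Real.exp_add,
      ← Real.exp_sub, Real.rpow_def_of_pos (by norm_num), ← Real.exp_add, one_div, Real.log_inv,
      hl9]
    congr 1
    ring
  · rw [hε2, hpow 9 (by norm_num), one_div, ← Real.exp_neg, Real.rpow_def_of_pos (by norm_num),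
      ← Real.exp_add, hl9]
    congr 1
    ring

lemma rpow_neg_alpha_bounds (ε : ℝ) : 1 / 3 ≤ (3 : ℝ) ^ (-alpha ε) ∧ (3 : ℝ) ^ (-alpha ε) ≤ 1 := by
  have h0 : 0 ≤ alpha ε := Int.fract_nonneg _
  have h1 : alpha ε < 1 := Int.fract_lt_one _
  constructor
  · rw [one_div, ← Real.rpow_neg_one]
    exact Real.rpow_le_rpow_of_exponent_le (by norm_num) (by linarith)
  · exact Real.rpow_le_one_of_one_le_of_nonpos (by norm_num) (by linarith)

lemma rpow_div_three (t : ℝ) : (3 : ℝ) ^ (-t - 1) = (3 : ℝ) ^ (-t) / 3 := by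
  rw [Real.rpow_sub (by norm_num), Real.rpow_one]

lemma rpow_div_nine (t : ℝ) : (3 : ℝ) ^ (-t - 2) = (3 : ℝ) ^ (-t) / 9 := by
  rw [Real.rpow_sub (by norm_num), Real.rpow_two]; norm_num

lemma rpow_neg_half : (3 : ℝ) ^ (-(1 / 2) : ℝ) = 1 / √3 := by
  rw [Real.rpow_neg (by norm_num), ← Real.sqrt_eq_rpow, one_div]

lemma volume_real_inner_of_alpha_lt {ε : ℝ} (h0 : 0 < ε) (h1 : ε ≤ 1 / 9)
    (h2 : alpha ε < 1 / 2) : volume.real (inner ε) =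
      u (alpha ε) * ε ^ (2 - Real.log 4 / Real.log 3) + v (alpha ε) * ε ^ 2 := by
  obtain ⟨m, e, he, hεe, hA, hB, hC⟩ := exists_scale h0 h1
  obtain ⟨hb1, hb2⟩ := rpow_neg_alpha_bounds ε
  have hse : 1 / √3 ≤ (3 : ℝ) ^ (-alpha ε) := by
    rw [← rpow_neg_half]
    exact Real.rpow_le_rpow_of_exponent_le (by norm_num) (by linarith)
  have harc : (3 : ℝ) ^ alpha ε / 2 = 1 / (2 * (3 : ℝ) ^ (-alpha ε)) := by
    rw [Real.rpow_neg (by norm_num)]; field_simp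
  have hsq : (3 : ℝ) ^ (-2 * alpha ε) = ((3 : ℝ) ^ (-alpha ε)) ^ 2 := by
    rw [← Real.rpow_natCast, ← Real.rpow_mul (by norm_num)]
    congr 1
    push_cast
    ring
  rw [u, v, rpow_div_nine, harc, hsq]
  rw [← he] at hb1 hb2 hse ⊢
  have hD : ε ^ 2 = e ^ 2 / 9 ^ (m + 1) := by
    rw [hεe, div_pow, ← pow_mul, mul_comm (m + 1) 2, pow_mul]
    norm_num
  have h := volume_real_inner_pow m hb1 hb2
  rw [← hεe, volume_real_wedgeTip hse hb2,
    triangleArea_of_le (by rw [inv_sqrt_three] at hse; linarith)] at h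
  rw [h]
  linear_combination
    -(21 * √3 / 40 + 3 / 4 * √(e ^ 2 - 1 / 4) + 81 * triangleArea (e / 9)) * hA
      - (3 / 2 * Real.arcsin (1 / (2 * e)) - Real.pi / 6) * hB
      + 324 * triangleArea (e / 9) * hC + Real.pi / 3 * hD

lemma volume_real_inner_of_le_alpha {ε : ℝ} (h0 : 0 < ε) (h1 : ε ≤ 1 / 9)
    (h2 : 1 / 2 ≤ alpha ε) : volume.real (inner ε) =
      uTilde (alpha ε) * ε ^ (2 - Real.log 4 / Real.log 3) + v (alpha ε) * ε ^ 2 := by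
  obtain ⟨m, e, he, hεe, hA, hB, hC⟩ := exists_scale h0 h1
  obtain ⟨hb1, hb2⟩ := rpow_neg_alpha_bounds ε
  have hse : (3 : ℝ) ^ (-alpha ε) ≤ 1 / √3 := by
    rw [← rpow_neg_half]
    exact Real.rpow_le_rpow_of_exponent_le (by norm_num) (by linarith)
  rw [uTilde, v, rpow_div_nine, rpow_div_three]
  rw [← he] at hb1 hb2 hse ⊢
  have hD : ε ^ 2 = e ^ 2 / 9 ^ (m + 1) := by
    rw [hεe, div_pow, ← pow_mul, mul_comm (m + 1) 2, pow_mul]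
    norm_num
  have h := volume_real_inner_pow m hb1 hb2
  rw [← hεe, volume_real_wedgeTip_of_le hse] at h
  rw [h]
  linear_combination
    -(2 * √3 / 5 + 27 * triangleArea (e / 3) + 81 * triangleArea (e / 9)) * hA
      - Real.pi / 3 * hB + 324 * triangleArea (e / 9) * hC + Real.pi / 3 * hD

end Koch

theorem mainTheorem3 :
    ContinuousOn (fun ε : ℝ => volume.real (Koch.inner ε)) (Ioi 0) ∧
    ∀ ε : ℝ, 0 < ε →
      (1 / 3 < ε → volume.real (Koch.inner ε) = 2 * √3 / 5) ∧
      (√3 / 9 < ε → ε ≤ 1 / 3 →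
        volume.real (Koch.inner ε) =
          7 * √3 / 30 + √(ε ^ 2 - 1 / 36) + 6 * ε ^ 2 * Real.arcsin (1 / (6 * ε))
            - Real.pi * ε ^ 2) ∧
      (1 / 9 < ε → ε ≤ √3 / 9 →
        volume.real (Koch.inner ε) =
          8 * √3 / 45 + Real.pi * ε ^ 2 + 12 * volume.real (Koch.inner ε ∩ Koch.triangle)) ∧
      (ε ≤ 1 / 9 → Koch.alpha ε < 1 / 2 →
        volume.real (Koch.inner ε) =
          Koch.u (Koch.alpha ε) * ε ^ (2 - Real.log 4 / Real.log 3)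
            + Koch.v (Koch.alpha ε) * ε ^ 2) ∧
      (ε ≤ 1 / 9 → 1 / 2 ≤ Koch.alpha ε →
        volume.real (Koch.inner ε) =
          Koch.uTilde (Koch.alpha ε) * ε ^ (2 - Real.log 4 / Real.log 3)
            + Koch.v (Koch.alpha ε) * ε ^ 2) := by
  refine ⟨Koch.continuousOn_volume_real_inner, fun ε hε => ⟨Koch.volume_real_inner_of_gt,
    Koch.volume_real_inner_first, Koch.volume_real_inner_second,
    Koch.volume_real_inner_of_alpha_lt hε, Koch.volume_real_inner_of_le_alpha hε⟩⟩
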